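/- Let $R$ be a commutative ring in which $2$ is invertible, let $S$ be a Deligne--Mumford stack over $R$, presented by an étale groupoid in schemes (for instance any $R$-scheme), and let $C_S\to S$ be a schematic smooth morphism of relative dimension $1$ (for instance a proper curve of genus $g>1$). Write $\mathcal T,\Omega$ for the relative tangent and cotangent sheaves of $C_S/S$, $\mathcal D$ for the sheaf of crystalline differential operators (generated by $\mathcal O$ and $\mathcal T$ with the usual relations), $\mathcal D^{\le j}$ for the operators of order $\le j$, $G=\mathrm{PGL}_2$, and $B\subset G$ for the image of the upper triangular matrices. All sheaves are for the étale topology. In $\mathcal D^{\le j}\otimes\mathcal L$ the tensor product uses right multiplication on $\mathcal D^{\le j}$ and the result is a module by left multiplication; in $\mathcal M\otimes\mathcal D^{\le j}$ it is the other way round. An indigenous bundle on $C_S/S$ is a pair $(\mathcal P_B,\nabla)$ of a right $B$-torsor $\mathcal P_B$ on $C_S$ and an $S$-connection $\nabla:\mathcal T\to\widetilde{\mathcal T}_{\mathcal P_G/S}$ (an $\mathcal O$-linear splitting of the Atiyah sequence) on $\mathcal P_G=\mathcal P_B\times^BG$, such that the composite $\mathcal T\to\widetilde{\mathcal T}_{\mathcal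 P_G/S}\to\widetilde{\mathcal T}_{\mathcal P_G/S}/\widetilde{\mathcal T}_{\mathcal P_B/S}$ is an isomorphism. An isomorphism of indigenous bundles is an isomorphism of $B$-torsors compatible with the connections on the induced $G$-torsors. Let $\mathcal P^\dagger_B$ be the $B$-torsor of local bases of $\mathcal D^{\le1}$, regarded as an $\mathcal O$-module by right multiplication, whose first vector lies in $\mathcal D^{\le 0}=\mathcal O$, modulo scalars. A local chart is an étale $U\to C_S$ with a function $x$ such that $dx$ generates $\Omega|_U$; $\partial_x$ is the dual vector field. An indigenous bundle is of canonical type if it is of the form $(\mathcal P_B^\dagger,\nabla)$ and if, in every local chart $(U,x)$, $\nabla$ sends $\partial_x$ to $\partial_x+\begin{pmatrix}0&a\\1&0\end{pmatrix}$ for some function $a$ on $U$, with respect to the section $(1,\tfrac12\partial_x)$ of $\mathcal P_B^\dagger$. (i) Suppose that $\mathcal L$ is a theta characteristic of $C_S/S$ (a line bundle with an isomorphism $\mathcal L^{\otimes2}\cong\Omega$). Consider the second order differential operators $\mathbb D\in\Gamma(C_S,\mathcal Hom_{\mathcal O}(\mathcal L^\vee,\mathcal L^\vee\otimes\Omega^{\otimes2}\otimes\mathcal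 D^{\le2}))$ with principal symbol $1$ and subprincipal symbol $0$, i.e. such that for every local chart $(U,x)$ and every square root $(dx)^{1/2}\in\mathcal L(U)$ of $dx$, with dual basis $(dx)^{-1/2}$, there is $a\in\Gamma(U,\Omega^{\otimes 2})$ with $$\mathbb D((dx)^{-1/2})=(dx)^{-1/2}\otimes(dx)^{\otimes2}\otimes\partial_x^2+(dx)^{-1/2}\otimes a\otimes1 .$$ Let ${}^\circlearrowright\mathbb D:\mathcal T^{\otimes2}\otimes\mathcal L\to\mathcal D^{\le2}\otimes\mathcal L$ be the transpose of $\mathbb D$, let $\nabla_{\mathbb D}$ be the connection on $\mathcal D^{\le1}\otimes\mathcal L\cong(\mathcal D\otimes\mathcal L)/\langle\mathrm{Im}\,{}^\circlearrowright\mathbb D\rangle$ defined by the left $\mathcal D$-module structure of the quotient, and let $\mathcal P^{\circledast\dagger}_{\mathbb D}=(\mathcal P^\dagger_B,\nabla_{\mathbb D,G})$, where $\nabla_{\mathbb D,G}$ is the connection induced by $\nabla_{\mathbb D}$ on the $G$-torsor of $\mathcal D^{\le1}\otimes\mathcal L$, identified with $\mathcal P^\dagger_G$ in such a way that in every chart the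 frame $((dx)^{1/2},\partial_x\otimes(dx)^{1/2})$ corresponds to $(1,\tfrac12\partial_x)$. Then $\nabla_{\mathbb D,G}$ is well defined, $\mathcal P^{\circledast\dagger}_{\mathbb D}$ is an indigenous bundle of canonical type, and $\mathbb D\mapsto\mathcal P^{\circledast\dagger}_{\mathbb D}$ induces a bijection from the set of these operators onto the set of isomorphism classes of indigenous bundles on $C_S/S$. (ii) For every indigenous bundle $\mathcal P^{\circledast}$ on $C_S/S$ there is a unique indigenous bundle of canonical type (a unique connection on $\mathcal P^\dagger_G$) that is isomorphic to $\mathcal P^{\circledast}$. -/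

import Mathlib

open CategoryTheory AlgebraicGeometry
open scoped TensorProduct Matrix

universe u

noncomputable section

namespace IndigenousBundles

/-! ## Bases and curves -/

/-- An étale groupoid in schemes over `R`, i.e. a presentation of a Deligne-Mumford stack
`S = [ob / mor]` over `R` (`mor = ob ×_S ob`).  A scheme `S` is the case `ob = mor = S`.
The composition law is given on `T`-valued points: `comp a b` is "first `a`, then `b`". -/
structure EtaleGroupoid (R : Type u) [CommRing R] where
  ob : Scheme.{u}
  mor : Scheme.{u}
  base : ob ⟶ Spec (CommRingCat.of R)
  src : mor ⟶ ob
  tgt : mor ⟶ ob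
  src_etale : Etale src
  tgt_etale : Etale tgt
  src_base : src ≫ base = tgt ≫ base
  one : ob ⟶ mor
  inv : mor ⟶ mor
  comp : ∀ {T : Scheme.{u}} (a b : T ⟶ mor), a ≫ tgt = b ≫ src → (T ⟶ mor)
  comp_natural : ∀ {T' T : Scheme.{u}} (h : T' ⟶ T) (a b : T ⟶ mor) (hab : a ≫ tgt = b ≫ src)
    (hab' : (h ≫ a) ≫ tgt = (h ≫ b) ≫ src), h ≫ comp a b hab = comp (h ≫ a) (h ≫ b) hab'
  one_src : one ≫ src = 𝟙 ob
  one_tgt : one ≫ tgt = 𝟙 ob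
  inv_src : inv ≫ src = tgt
  inv_tgt : inv ≫ tgt = src
  comp_src : ∀ {T : Scheme.{u}} (a b : T ⟶ mor) (hab : a ≫ tgt = b ≫ src),
    comp a b hab ≫ src = a ≫ src
  comp_tgt : ∀ {T : Scheme.{u}} (a b : T ⟶ mor) (hab : a ≫ tgt = b ≫ src),
    comp a b hab ≫ tgt = b ≫ tgt
  one_comp : ∀ {T : Scheme.{u}} (a : T ⟶ mor) (h : ((a ≫ src) ≫ one) ≫ tgt = a ≫ src),
    comp ((a ≫ src) ≫ one) a h = a
  comp_one : ∀ {T : Scheme.{u}} (a : T ⟶ mor) (h : a ≫ tgt = ((a ≫ tgt) ≫ one) ≫ src),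
    comp a ((a ≫ tgt) ≫ one) h = a
  comp_assoc : ∀ {T : Scheme.{u}} (a b c : T ⟶ mor) (hab : a ≫ tgt = b ≫ src)
    (hbc : b ≫ tgt = c ≫ src) (h : comp a b hab ≫ tgt = c ≫ src)
    (h' : a ≫ tgt = comp b c hbc ≫ src),
    comp (comp a b hab) c h = comp a (comp b c hbc) h'
  comp_inv : ∀ {T : Scheme.{u}} (a : T ⟶ mor) (h : a ≫ tgt = (a ≫ inv) ≫ src),
    comp a (a ≫ inv) h = (a ≫ src) ≫ one
  inv_comp : ∀ {T : Scheme.{u}} (a : T ⟶ mor) (h : (a ≫ inv) ≫ tgt = a ≫ src),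
    comp (a ≫ inv) a h = (a ≫ tgt) ≫ one

/-- A smooth relative curve `C / S` over the stack `S = [ob / mor]`: a scheme `total`, smooth of
relative dimension `1` over `ob`, with a descent datum to `S`, i.e. an action of the groupoid
(given on `T`-valued points).  No properness or connectedness of the fibres is required. -/
structure RelCurve {R : Type u} [CommRing R] (S : EtaleGroupoid R) where
  total : Scheme.{u}
  proj : total ⟶ S.ob
  smooth : SmoothOfRelativeDimension 1 proj
  act : ∀ {T : Scheme.{u}} (c : T ⟶ total) (a : T ⟶ S.mor), c ≫ proj = a ≫ S.src → (T ⟶ total)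
  act_natural : ∀ {T' T : Scheme.{u}} (h : T' ⟶ T) (c : T ⟶ total) (a : T ⟶ S.mor)
    (hca : c ≫ proj = a ≫ S.src) (hca' : (h ≫ c) ≫ proj = (h ≫ a) ≫ S.src),
    h ≫ act c a hca = act (h ≫ c) (h ≫ a) hca'
  act_proj : ∀ {T : Scheme.{u}} (c : T ⟶ total) (a : T ⟶ S.mor) (hca : c ≫ proj = a ≫ S.src),
    act c a hca ≫ proj = a ≫ S.tgt
  act_one : ∀ {T : Scheme.{u}} (c : T ⟶ total) (h : c ≫ proj = ((c ≫ proj) ≫ S.one) ≫ S.src),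
    act c ((c ≫ proj) ≫ S.one) h = c
  act_comp : ∀ {T : Scheme.{u}} (c : T ⟶ total) (a b : T ⟶ S.mor) (hca : c ≫ proj = a ≫ S.src)
    (hab : a ≫ S.tgt = b ≫ S.src) (h : act c a hca ≫ proj = b ≫ S.src)
    (h' : c ≫ proj = S.comp a b hab ≫ S.src),
    act (act c a hca) b h = act c (S.comp a b hab) h'

/-! ## The étale site of a curve

The charts below form a basis of the small étale site of `C`; a sheaf (a quasi-coherent module)
on the étale site of `C` is the same thing as a sheaf (a cartesian module) on the charts. -/

section Site

variable {R : Type u} [CommRing R] {S : EtaleGroupoid R}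

/-- Affine étale charts of `C / S`: a commutative square of an étale `Spec A ⟶ C` over an étale
`Spec k ⟶ S`, such that `Ω_{A/k}` is generated by `dx` for some `x`. -/
structure Chart (C : RelCurve S) where
  k : CommRingCat.{u}
  A : CommRingCat.{u}
  str : k ⟶ A
  toS : Spec k ⟶ S.ob
  toC : Spec A ⟶ C.total
  toS_etale : Etale toS
  toC_etale : Etale toC
  comm : toC ≫ C.proj = Spec.map str ≫ toS
  exists_coord : letI := str.hom.toAlgebra
    ∃ x : A, Submodule.span A {KaehlerDifferential.D k A x} = ⊤

variable {C : RelCurve S}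

instance (U : Chart C) : Algebra U.k U.A := U.str.hom.toAlgebra

/-- Morphisms of charts over the stacks `S` and `C`; `iso` is the `2`-isomorphism between the two
points `Spec V.k ⟶ S`. -/
@[ext]
structure Chart.Hom (V U : Chart C) where
  base : U.k ⟶ V.k
  ring : U.A ⟶ V.A
  iso : Spec V.k ⟶ S.mor
  comm : U.str ≫ ring = base ≫ V.str
  iso_src : iso ≫ S.src = V.toS
  iso_tgt : iso ≫ S.tgt = Spec.map base ≫ U.toS
  act_eq : C.act V.toC (Spec.map V.str ≫ iso) (by rw [V.comm, Category.assoc, iso_src])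
    = Spec.map ring ≫ U.toC

/-- The identity morphism of a chart. -/
def Chart.Hom.id (U : Chart C) : Chart.Hom U U where
  base := 𝟙 _
  ring := 𝟙 _
  iso := U.toS ≫ S.one
  comm := by simp
  iso_src := by simp [S.one_src]
  iso_tgt := by simp [S.one_tgt]
  act_eq := by
    have h : U.toC ≫ C.proj = ((U.toC ≫ C.proj) ≫ S.one) ≫ S.src := by simp [S.one_src]
    have := C.act_one U.toC h
    rw [Spec.map_id, Category.id_comp]
    refine Eq.trans ?_ this
    congr 1
    rw [U.comm, Category.assoc]

/-- Composition of morphisms of charts. -/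
def Chart.Hom.comp {W V U : Chart C} (g : Chart.Hom W V) (f : Chart.Hom V U) :
    Chart.Hom W U where
  base := f.base ≫ g.base
  ring := f.ring ≫ g.ring
  iso := S.comp g.iso (Spec.map g.base ≫ f.iso) (by rw [g.iso_tgt, Category.assoc, f.iso_src])
  comm := by rw [← Category.assoc, f.comm, Category.assoc, g.comm, Category.assoc]
  iso_src := by rw [S.comp_src, g.iso_src]
  iso_tgt := by rw [S.comp_tgt, Category.assoc, f.iso_tgt, Spec.map_comp, Category.assoc]
  act_eq := by
    have e : Spec.map g.ring ≫ Spec.map V.str = Spec.map W.str ≫ Spec.map g.base := by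
      rw [← Spec.map_comp, ← Spec.map_comp, g.comm]
    have h1 : (Spec.map W.str ≫ g.iso) ≫ S.tgt
        = (Spec.map W.str ≫ Spec.map g.base ≫ f.iso) ≫ S.src := by
      simp only [Category.assoc, g.iso_tgt, f.iso_src]
    have h2 : (Spec.map g.ring ≫ V.toC) ≫ C.proj
        = (Spec.map g.ring ≫ Spec.map V.str ≫ f.iso) ≫ S.src := by
      simp only [Category.assoc, V.comm, f.iso_src]
    have key := congrArg (fun t => Spec.map g.ring ≫ t) f.act_eq
    rw [C.act_natural _ _ _ _ h2] at key
    have e2 : Spec.map (f.ring ≫ g.ring) ≫ U.toC = Spec.map g.ring ≫ Spec.map f.ring ≫ U.toC := by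
      rw [Spec.map_comp, Category.assoc]
    refine Eq.trans ?_ (key.trans e2.symm)
    simp only [S.comp_natural _ _ _ _ h1, ← g.act_eq, reassoc_of% e]
    rw [C.act_comp]

instance : Category (Chart C) where
  Hom := Chart.Hom
  id := Chart.Hom.id
  comp := Chart.Hom.comp
  id_comp {V U} f := by
    apply Chart.Hom.ext
    · exact Category.comp_id _
    · exact Category.comp_id _
    · have h : ((f.iso ≫ S.src) ≫ S.one) ≫ S.tgt = f.iso ≫ S.src := by simp [S.one_tgt]
      have := S.one_comp f.iso h
      simp only [f.iso_src] at this
      simpa [Chart.Hom.comp, Chart.Hom.id] using this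
  comp_id {V U} f := by
    apply Chart.Hom.ext
    · exact Category.id_comp _
    · exact Category.id_comp _
    · have h : f.iso ≫ S.tgt = ((f.iso ≫ S.tgt) ≫ S.one) ≫ S.src := by simp [S.one_src]
      have := S.comp_one f.iso h
      simp only [f.iso_tgt, Category.assoc] at this
      simpa [Chart.Hom.comp, Chart.Hom.id] using this
  assoc {X W V U} h g f := by
    apply Chart.Hom.ext
    · exact (Category.assoc _ _ _).symm
    · exact (Category.assoc _ _ _).symm
    · have h1 : (Spec.map h.base ≫ g.iso) ≫ S.tgt
          = (Spec.map h.base ≫ Spec.map g.base ≫ f.iso) ≫ S.src := by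
        simp only [Category.assoc, g.iso_tgt, f.iso_src]
      simp only [Chart.Hom.comp, Spec.map_comp, Category.assoc, S.comp_natural _ _ _ _ h1]
      rw [S.comp_assoc]

/-- Restriction of functions. -/
def res {V U : Chart C} (f : V ⟶ U) : U.A →+* V.A := (Chart.Hom.ring f).hom

/-- Restriction of functions on the base. -/
def resBase {V U : Chart C} (f : V ⟶ U) : U.k →+* V.k := (Chart.Hom.base f).hom

@[simp] lemma res_id (U : Chart C) (a : U.A) : res (𝟙 U) a = a := rfl

@[simp] lemma res_comp {W V U : Chart C} (g : W ⟶ V) (f : V ⟶ U) (a : U.A) :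
    res (g ≫ f) a = res g (res f a) := rfl

lemma res_algebraMap {V U : Chart C} (f : V ⟶ U) (c : U.k) :
    res f (algebraMap U.k U.A c) = algebraMap V.k V.A (resBase f c) :=
  congrArg (fun h => h.hom c) (Chart.Hom.comm f)

/-- Covering sieves of the étale topology: the morphisms of the sieve are jointly surjective. -/
def IsCovering {U : Chart C} (J : Sieve U) : Prop :=
  ∀ x : PrimeSpectrum U.A, ∃ (V : Chart C) (f : V ⟶ U), J f ∧
    ∃ y : PrimeSpectrum V.A, PrimeSpectrum.comap (res f) y = x

/-! ## Differentials and vector fields -/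

/-- `Ω_{C/S}` on a chart. -/
abbrev Om (U : Chart C) : Type u := KaehlerDifferential U.k U.A

/-- `d : O ⟶ Ω`. -/
abbrev dd {U : Chart C} (x : U.A) : Om U := KaehlerDifferential.D U.k U.A x

/-- `x` is a coordinate: `dx` generates `Ω`. -/
def IsCoord {U : Chart C} (x : U.A) : Prop := Submodule.span U.A {dd x} = ⊤

/-- Restriction of differential forms, `a db ↦ a|_V d(b|_V)`. -/
def resOm {V U : Chart C} (f : V ⟶ U) : Om U →+ Om V :=
  letI : Algebra U.k V.k := (resBase f).toAlgebra
  letI : Algebra U.A V.A := (res f).toAlgebra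
  letI : Algebra U.k V.A := ((algebraMap V.k V.A).comp (resBase f)).toAlgebra
  haveI : IsScalarTower U.k V.k V.A := IsScalarTower.of_algebraMap_eq fun _ => rfl
  haveI : IsScalarTower U.k U.A V.A := IsScalarTower.of_algebraMap_eq fun c =>
    (res_algebraMap f c).symm
  (KaehlerDifferential.map U.k V.k U.A V.A).toAddMonoidHom

/-- The sections of `T_{C/S}` over `U`: the derivations of the sheaf `O_C` restricted to `U`
over the sheaf of functions on the base. -/
def vecField (U : Chart C) : AddSubgroup (∀ (V : Chart C) (_ : V ⟶ U), Derivation V.k V.A V.A) where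
  carrier := {ξ | ∀ (V W : Chart C) (f : V ⟶ U) (g : W ⟶ V) (a : V.A),
    ξ W (g ≫ f) (res g a) = res g (ξ V f a)}
  zero_mem' := by intro V W f g a; simp
  add_mem' := by
    intro ξ η hξ hη V W f g a
    simp [hξ V W f g a, hη V W f g a]
  neg_mem' := by
    intro ξ hξ V W f g a
    simp [hξ V W f g a]

/-- `T_{C/S}` on a chart. -/
abbrev T (U : Chart C) : Type (u + 1) := vecField U

/-- The derivation of `O(U)` defined by a vector field on `U`. -/
def T.toDer {U : Chart C} (ξ : T U) : Derivation U.k U.A U.A := ξ.1 U (𝟙 U)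

instance (U : Chart C) : SMul U.A (T U) where
  smul a ξ := ⟨fun V f => res f a • ξ.1 V f, by
    intro V W f g b
    simp [ξ.2 V W f g b]⟩

@[simp] lemma smul_T_apply {U : Chart C} (a : U.A) (ξ : T U) {V : Chart C} (f : V ⟶ U) :
    (a • ξ).1 V f = res f a • ξ.1 V f := rfl

instance (U : Chart C) : Module U.A (T U) where
  one_smul ξ := by ext V f : 3; simp
  mul_smul a b ξ := by ext V f : 3; simp [mul_smul]
  smul_zero a := by ext V f : 3; simp
  smul_add a ξ η := by ext V f : 3; simp
  add_smul a b ξ := by ext V f : 3; simp [add_smul]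
  zero_smul ξ := by ext V f : 3; simp

/-- The Lie bracket of vector fields. -/
instance (U : Chart C) : Bracket (T U) (T U) where
  bracket ξ η := ⟨fun V f => ⁅ξ.1 V f, η.1 V f⁆, by
    intro V W f g a
    simp [Derivation.commutator_apply, ξ.2 V W f g, η.2 V W f g]⟩

@[simp] lemma bracket_T_apply {U : Chart C} (ξ η : T U) {V : Chart C} (f : V ⟶ U) :
    (⁅ξ, η⁆ : T U).1 V f = ⁅ξ.1 V f, η.1 V f⁆ := rfl

/-- Restriction of vector fields. -/
def resT {V U : Chart C} (f : V ⟶ U) : T U →+ T V where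
  toFun ξ := ⟨fun W g => ξ.1 W (g ≫ f), by
    intro W W' g h a
    have := ξ.2 W W' (g ≫ f) h a
    rwa [← Category.assoc] at this⟩
  map_zero' := rfl
  map_add' _ _ := rfl

@[simp] lemma resT_apply {V U : Chart C} (f : V ⟶ U) (ξ : T U) {W : Chart C} (g : W ⟶ V) :
    (resT f ξ).1 W g = ξ.1 W (g ≫ f) := rfl

/-- `∂` is the vector field `∂_x` dual to `dx`, for a coordinate `x`. -/
def IsDualTo {U : Chart C} (ξ : T U) (x : U.A) : Prop := IsCoord x ∧ ξ.toDer x = 1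

/-! ## Crystalline differential operators -/

/-- The defining relations of the ring of crystalline differential operators, generated by
functions (`inl`) and vector fields (`inr`). -/
inductive DRel (U : Chart C) : FreeAlgebra ℤ (U.A ⊕ T U) → FreeAlgebra ℤ (U.A ⊕ T U) → Prop
  | one : DRel U (FreeAlgebra.ι ℤ (Sum.inl 1)) 1
  | add (a b : U.A) : DRel U (FreeAlgebra.ι ℤ (Sum.inl (a + b)))
      (FreeAlgebra.ι ℤ (Sum.inl a) + FreeAlgebra.ι ℤ (Sum.inl b))
  | mul (a b : U.A) : DRel U (FreeAlgebra.ι ℤ (Sum.inl a) * FreeAlgebra.ι ℤ (Sum.inl b))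
      (FreeAlgebra.ι ℤ (Sum.inl (a * b)))
  | add_vec (ξ η : T U) : DRel U (FreeAlgebra.ι ℤ (Sum.inr (ξ + η)))
      (FreeAlgebra.ι ℤ (Sum.inr ξ) + FreeAlgebra.ι ℤ (Sum.inr η))
  | smul_vec (a : U.A) (ξ : T U) :
      DRel U (FreeAlgebra.ι ℤ (Sum.inl a) * FreeAlgebra.ι ℤ (Sum.inr ξ))
        (FreeAlgebra.ι ℤ (Sum.inr (a • ξ)))
  | bracket (ξ η : T U) :
      DRel U (FreeAlgebra.ι ℤ (Sum.inr ξ) * FreeAlgebra.ι ℤ (Sum.inr η)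
        - FreeAlgebra.ι ℤ (Sum.inr η) * FreeAlgebra.ι ℤ (Sum.inr ξ))
        (FreeAlgebra.ι ℤ (Sum.inr ⁅ξ, η⁆))
  | leibniz (ξ : T U) (a : U.A) :
      DRel U (FreeAlgebra.ι ℤ (Sum.inr ξ) * FreeAlgebra.ι ℤ (Sum.inl a)
        - FreeAlgebra.ι ℤ (Sum.inl a) * FreeAlgebra.ι ℤ (Sum.inr ξ))
        (FreeAlgebra.ι ℤ (Sum.inl (ξ.toDer a)))

/-- The ring `D_{C/S}` of crystalline differential operators on a chart. -/
def DOp (U : Chart C) : Type (u + 1) := RingQuot (DRel U)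

instance (U : Chart C) : Ring (DOp U) := inferInstanceAs (Ring (RingQuot (DRel U)))

/-- The quotient map onto `D_{C/S}`. -/
def DOp.mk (U : Chart C) : FreeAlgebra ℤ (U.A ⊕ T U) →+* DOp U := RingQuot.mkRingHom (DRel U)

/-- A function as a differential operator. -/
def fn {U : Chart C} : U.A →+* DOp U where
  toFun a := DOp.mk U (FreeAlgebra.ι ℤ (Sum.inl a))
  map_one' := (RingQuot.mkRingHom_rel DRel.one).trans (map_one (DOp.mk U))
  map_mul' a b := ((map_mul (DOp.mk U) _ _).symm.trans
    (RingQuot.mkRingHom_rel (DRel.mul a b))).symm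
  map_zero' := by
    have h := (RingQuot.mkRingHom_rel (DRel.add (U := U) 0 0)).trans (map_add (DOp.mk U) _ _)
    rw [add_zero] at h
    exact left_eq_add.mp h
  map_add' a b := (RingQuot.mkRingHom_rel (DRel.add a b)).trans (map_add (DOp.mk U) _ _)

/-- A vector field as a differential operator. -/
def vec {U : Chart C} (ξ : T U) : DOp U := DOp.mk U (FreeAlgebra.ι ℤ (Sum.inr ξ))

lemma vec_add {U : Chart C} (ξ η : T U) : vec (ξ + η) = vec ξ + vec η :=
  (RingQuot.mkRingHom_rel (DRel.add_vec ξ η)).trans (map_add (DOp.mk U) _ _)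

lemma fn_mul_vec {U : Chart C} (a : U.A) (ξ : T U) : fn a * vec ξ = vec (a • ξ) :=
  (map_mul (DOp.mk U) _ _).symm.trans (RingQuot.mkRingHom_rel (DRel.smul_vec a ξ))

lemma vec_bracket {U : Chart C} (ξ η : T U) :
    vec ξ * vec η - vec η * vec ξ = vec ⁅ξ, η⁆ := by
  have h := RingQuot.mkRingHom_rel (DRel.bracket ξ η)
  change DOp.mk U _ = DOp.mk U _ at h
  rwa [map_sub, map_mul, map_mul] at h

lemma vec_leibniz {U : Chart C} (ξ : T U) (a : U.A) :
    vec ξ * fn a - fn a * vec ξ = fn (ξ.toDer a) := by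
  have h := RingQuot.mkRingHom_rel (DRel.leibniz ξ a)
  change DOp.mk U _ = DOp.mk U _ at h
  rwa [map_sub, map_mul, map_mul] at h

/-- `^l D`: the `O`-module structure by left multiplication. -/
instance (U : Chart C) : Module U.A (DOp U) := Module.compHom (DOp U) (fn (U := U))

lemma smul_DOp {U : Chart C} (a : U.A) (P : DOp U) : a • P = fn a * P := rfl

/-- Restriction of differential operators. -/
def resD {V U : Chart C} (f : V ⟶ U) : DOp U →+* DOp V :=
  RingQuot.lift ⟨((FreeAlgebra.lift ℤ
      (Sum.elim (fun a => fn (res f a)) (fun ξ => vec (resT f ξ))) :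
      FreeAlgebra ℤ (U.A ⊕ T U) →ₐ[ℤ] DOp V) : FreeAlgebra ℤ (U.A ⊕ T U) →+* DOp V), by
    intro x y h
    induction h with
    | one => simp
    | add a b => simp
    | mul a b => simp
    | add_vec ξ η => simp [vec_add]
    | smul_vec a ξ =>
      have : resT f (a • ξ) = res f a • resT f ξ := by ext W g : 3; simp
      simp [fn_mul_vec, this]
    | bracket ξ η =>
      have : resT f ⁅ξ, η⁆ = ⁅resT f ξ, resT f η⁆ := by ext W g : 3; simp
      simp [vec_bracket, this]
    | leibniz ξ a =>
      have : (resT f ξ).toDer (res f a) = res f (ξ.toDer a) := by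
        have := ξ.2 U V (𝟙 U) f a
        simpa [T.toDer] using this
      simp [vec_leibniz, this]⟩

@[simp] lemma resD_fn {V U : Chart C} (f : V ⟶ U) (a : U.A) : resD f (fn a) = fn (res f a) := by
  refine (RingQuot.lift_mkRingHom_apply _ _ _).trans ?_
  simp

@[simp] lemma resD_vec {V U : Chart C} (f : V ⟶ U) (ξ : T U) :
    resD f (vec ξ) = vec (resT f ξ) := by
  refine (RingQuot.lift_mkRingHom_apply _ _ _).trans ?_
  simp

lemma DOp.hom_ext {U : Chart C} {B : Type*} [Ring B] {φ ψ : DOp U →+* B}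
    (h₁ : ∀ a, φ (fn a) = ψ (fn a)) (h₂ : ∀ ξ, φ (vec ξ) = ψ (vec ξ)) : φ = ψ := by
  apply RingQuot.ringQuot_ext
  have : ((φ.comp (DOp.mk U)).toIntAlgHom : FreeAlgebra ℤ (U.A ⊕ T U) →ₐ[ℤ] B)
      = (ψ.comp (DOp.mk U)).toIntAlgHom := by
    apply FreeAlgebra.hom_ext
    funext x
    cases x with
    | inl a => exact h₁ a
    | inr ξ => exact h₂ ξ
  exact congrArg (fun F : FreeAlgebra ℤ (U.A ⊕ T U) →ₐ[ℤ] B => F.toRingHom) this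

lemma resD_id (U : Chart C) (P : DOp U) : resD (𝟙 U) P = P := by
  have : resD (𝟙 U) = RingHom.id (DOp U) := by
    apply DOp.hom_ext
    · intro a; simp
    · intro ξ
      rw [resD_vec]
      congr 1
      ext V f : 3
      simp
  rw [this]; rfl

lemma resD_comp {W V U : Chart C} (g : W ⟶ V) (f : V ⟶ U) (P : DOp U) :
    resD (g ≫ f) P = resD g (resD f P) := by
  have : resD (g ≫ f) = (resD g).comp (resD f) := by
    apply DOp.hom_ext
    · intro a; simp
    · intro ξ
      rw [RingHom.comp_apply, resD_vec, resD_vec, resD_vec]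
      congr 1
      ext X h : 3
      simp
  rw [this]; rfl

/-- `D^{≤ j}`: operators of order at most `j`. -/
def DOp.order (U : Chart C) (j : ℕ) : Submodule U.A (DOp U) :=
  Submodule.span U.A {P | ∃ l : List (T U), l.length ≤ j ∧ P = (l.map vec).prod}

/-- Right multiplication by a function, as a map of left `O`-modules. -/
def mulRightFn {U : Chart C} (a : U.A) : DOp U →ₗ[U.A] DOp U where
  toFun P := P * fn a
  map_add' P Q := add_mul P Q _
  map_smul' _ _ := mul_assoc _ _ _

/-- `^r D`: the left `D`-module `D` with the `O`-module structure by right multiplication. -/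
def DOpR (U : Chart C) : Type (u + 1) := DOp U

/-- An operator as an element of `^r D`. -/
def DOp.toR {U : Chart C} (P : DOp U) : DOpR U := P

/-- An element of `^r D` as an operator. -/
def DOpR.toD {U : Chart C} (P : DOpR U) : DOp U := P

instance (U : Chart C) : AddCommGroup (DOpR U) := inferInstanceAs (AddCommGroup (DOp U))

instance (U : Chart C) : Module (DOp U) (DOpR U) := inferInstanceAs (Module (DOp U) (DOp U))

instance (U : Chart C) : Module U.A (DOpR U) where
  smul a P := (P.toD * fn a).toR
  one_smul P := by change P.toD * fn 1 = P.toD; rw [map_one, mul_one]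
  mul_smul a b P := by
    change P.toD * fn (a * b) = P.toD * fn b * fn a
    rw [mul_comm a b, map_mul, mul_assoc]
  smul_zero a := zero_mul (fn a)
  smul_add a P Q := add_mul P.toD Q.toD (fn a)
  add_smul a b P := by
    change P.toD * fn (a + b) = P.toD * fn a + P.toD * fn b
    rw [map_add, mul_add]
  zero_smul P := by change P.toD * fn 0 = 0; rw [map_zero, mul_zero]

instance (U : Chart C) : SMulCommClass U.A (DOp U) (DOpR U) where
  smul_comm a P Q := mul_assoc P Q.toD (fn a)

/-! ## `B`-torsors -/

/-- Invertible upper triangular matrices; `B = UT / 𝔾_m ⊆ GL₂ / 𝔾_m = PGL₂ = G`. -/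
def UT (A : Type u) [CommRing A] : Subgroup (GL (Fin 2) A) where
  carrier := {g | (g : Matrix (Fin 2) (Fin 2) A) 1 0 = 0}
  one_mem' := by simp
  mul_mem' := by
    intro g h hg hh
    simp only [Set.mem_ofPred_eq] at *
    simp [Matrix.mul_apply, Fin.sum_univ_two, hg, hh]
  inv_mem' := by
    intro g hg
    simp only [Set.mem_ofPred_eq] at *
    simp [Matrix.inv_def, Matrix.adjugate_fin_two, hg]

/-- Restriction of matrices of functions. -/
def mapUT {A A' : Type u} [CommRing A] [CommRing A'] (φ : A →+* A') (b : UT A) : UT A' :=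
  ⟨Matrix.GeneralLinearGroup.map φ b.1, by
    have := b.2
    change (b.1 : Matrix (Fin 2) (Fin 2) A) 1 0 = 0 at this
    change φ ((b.1 : Matrix (Fin 2) (Fin 2) A) 1 0) = 0
    rw [this, map_zero]⟩

/-- A presheaf on the charts with a right action of the sheaf of groups `B`, the latter being
written as an action of `UT` that is trivial on scalar matrices. -/
structure BPresheaf (C : RelCurve S) where
  obj : Chart C → Type (u + 1)
  map : ∀ {V U : Chart C}, (V ⟶ U) → obj U → obj V
  map_id : ∀ {U : Chart C} (p : obj U), map (𝟙 U) p = p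
  map_comp : ∀ {W V U : Chart C} (g : W ⟶ V) (f : V ⟶ U) (p : obj U),
    map (g ≫ f) p = map g (map f p)
  act : ∀ {U : Chart C}, obj U → UT U.A → obj U
  act_map : ∀ {V U : Chart C} (f : V ⟶ U) (p : obj U) (b : UT U.A),
    map f (act p b) = act (map f p) (mapUT (res f) b)
  act_mul : ∀ {U : Chart C} (p : obj U) (b b' : UT U.A), act p (b * b') = act (act p b) b'
  act_scalar : ∀ {U : Chart C} (p : obj U) (b : UT U.A) (c : U.A),
    (b.1 : Matrix (Fin 2) (Fin 2) U.A) = c • 1 → act p b = p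

/-- The underlying presheaf of sets. -/
def BPresheaf.functor (P : BPresheaf C) : (Chart C)ᵒᵖ ⥤ Type (u + 1) where
  obj U := P.obj U.unop
  map f := ↾ (P.map f.unop)
  map_id U := by ext p; exact P.map_id p
  map_comp f g := by ext p; exact P.map_comp g.unop f.unop p

/-- `P` is a `B`-torsor for the étale topology: a sheaf, locally nonempty, on which `B` acts
simply transitively. -/
structure BPresheaf.IsTorsor (P : BPresheaf C) : Prop where
  sheaf : ∀ (U : Chart C) (J : Sieve U), IsCovering J → Presieve.IsSheafFor P.functor J.arrows
  locally_nonempty : ∀ U : Chart C, ∃ J : Sieve U, IsCovering J ∧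
    ∀ (V : Chart C) (f : V ⟶ U), J f → Nonempty (P.obj V)
  transitive : ∀ (U : Chart C) (p q : P.obj U), ∃ b : UT U.A, P.act p b = q
  free : ∀ (U : Chart C) (p : P.obj U) (b : UT U.A), P.act p b = p →
    ∃ c : U.A, (b.1 : Matrix (Fin 2) (Fin 2) U.A) = c • 1

/-! ## The Atiyah algebroid and connections -/

/-- The value of a derivation on the entries of a matrix. -/
def derMat {U : Chart C} (δ : Derivation U.k U.A U.A) (M : Matrix (Fin 2) (Fin 2) U.A) :
    Matrix (Fin 2) (Fin 2) U.A := M.map δ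

/-- The sections over `U` of the Atiyah algebroid of `P_G = P ×^B G`, `G = PGL₂`.

A `G`-invariant vector field on `P_G` lifting the vector field `ξ` is the same as a function
`X` on the frames of `P_G` (over all `V ⟶ U`) with values in `𝔤 = 𝔰𝔩₂`, compatible with
restriction, such that the first order operators `ξ + X(e)` transform as
`X(e g) = g⁻¹ X(e) g + g⁻¹ ξ(g)` in `𝔤 = 𝔤𝔩₂ / scalars`.  The frames of `P_G` are, locally,
the pairs `(p, g)` of a section `p` of `P` and an invertible matrix `g`, subject to
`(p b, g) ∼ (p, b g)` for `b` in `B`. -/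
def atiyah (P : BPresheaf C) (U : Chart C) :
    AddSubgroup (T U × (∀ (V : Chart C) (_ : V ⟶ U), P.obj V → GL (Fin 2) V.A →
      Matrix (Fin 2) (Fin 2) V.A)) where
  carrier := {t |
    (∀ (V : Chart C) (f : V ⟶ U) (p : P.obj V) (g : GL (Fin 2) V.A),
      (t.2 V f p g).trace = 0) ∧
    (∀ (V W : Chart C) (f : V ⟶ U) (h : W ⟶ V) (p : P.obj V) (g : GL (Fin 2) V.A),
      t.2 W (h ≫ f) (P.map h p) (Matrix.GeneralLinearGroup.map (res h) g)
        = (t.2 V f p g).map (res h)) ∧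
    (∀ (V : Chart C) (f : V ⟶ U) (p : P.obj V) (b : UT V.A) (g : GL (Fin 2) V.A),
      t.2 V f (P.act p b) g = t.2 V f p (b.1 * g)) ∧
    (∀ (V : Chart C) (f : V ⟶ U) (p : P.obj V) (g g' : GL (Fin 2) V.A), ∃ c : V.A,
      t.2 V f p (g * g') = (g'⁻¹).1 * t.2 V f p g * g'.1
        + (g'⁻¹).1 * derMat (t.1.1 V f) g'.1 + c • (1 : Matrix (Fin 2) (Fin 2) V.A))}
  zero_mem' := by
    refine ⟨?_, ?_, ?_, ?_⟩
    · intros; simp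
    · intros; ext; simp
    · intros; rfl
    · intro V f p g g'
      refine ⟨0, ?_⟩
      have : derMat (0 : Derivation V.k V.A V.A) g'.1 = 0 := by ext; simp [derMat]
      simp [this]
  add_mem' := by
    rintro s t ⟨h1, h2, h3, h4⟩ ⟨k1, k2, k3, k4⟩
    refine ⟨?_, ?_, ?_, ?_⟩
    · intro V f p g
      simp [h1 V f p g, k1 V f p g]
    · intro V W f h p g
      simp only [Prod.snd_add, Pi.add_apply, h2 V W f h p g, k2 V W f h p g]
      ext i j
      simp
    · intro V f p b g
      simp [h3 V f p b g, k3 V f p b g]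
    · intro V f p g g'
      obtain ⟨c, hc⟩ := h4 V f p g g'
      obtain ⟨c', hc'⟩ := k4 V f p g g'
      refine ⟨c + c', ?_⟩
      have : derMat ((s + t).1.1 V f) g'.1
          = derMat (s.1.1 V f) g'.1 + derMat (t.1.1 V f) g'.1 := by
        ext; simp [derMat]
      rw [this]
      simp only [Prod.snd_add, Pi.add_apply, hc, hc', mul_add, add_mul, add_smul]
      abel
  neg_mem' := by
    rintro s ⟨h1, h2, h3, h4⟩
    refine ⟨?_, ?_, ?_, ?_⟩
    · intro V f p g
      simp [h1 V f p g]
    · intro V W f h p g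
      simp only [Prod.snd_neg, Pi.neg_apply, h2 V W f h p g]
      ext i j
      simp
    · intro V f p b g
      simp [h3 V f p b g]
    · intro V f p g g'
      obtain ⟨c, hc⟩ := h4 V f p g g'
      refine ⟨-c, ?_⟩
      have : derMat ((-s).1.1 V f) g'.1 = - derMat (s.1.1 V f) g'.1 := by
        ext; simp [derMat]
      rw [this]
      simp only [Prod.snd_neg, Pi.neg_apply, hc, mul_neg, neg_mul, neg_smul]
      abel

/-- The sections over `U` of the Atiyah algebroid of `P_G`. -/
abbrev At (P : BPresheaf C) (U : Chart C) : Type (u + 1) := atiyah P U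

/-- The anchor: the vector field under a section of the Atiyah algebroid. -/
def At.anchor {P : BPresheaf C} {U : Chart C} (t : At P U) : T U := t.1.1

/-- The matrix of a section of the Atiyah algebroid in the frame of `P_G` defined by a section
`p` of `P`. -/
def At.mat {P : BPresheaf C} {U : Chart C} (t : At P U) {V : Chart C} (f : V ⟶ U) (p : P.obj V) :
    Matrix (Fin 2) (Fin 2) V.A := t.1.2 V f p 1

instance (P : BPresheaf C) (U : Chart C) : SMul U.A (At P U) where
  smul a t := ⟨(a • t.1.1, fun V f p g => res f a • t.1.2 V f p g), by
    obtain ⟨h1, h2, h3, h4⟩ := t.2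
    refine ⟨?_, ?_, ?_, ?_⟩
    · intro V f p g
      simp [h1 V f p g]
    · intro V W f h p g
      simp only [h2 V W f h p g]
      ext i j
      simp
    · intro V f p b g
      simp [h3 V f p b g]
    · intro V f p g g'
      obtain ⟨c, hc⟩ := h4 V f p g g'
      refine ⟨res f a * c, ?_⟩
      have : derMat ((a • t.1.1).1 V f) g'.1 = res f a • derMat (t.1.1.1 V f) g'.1 := by
        ext; simp [derMat]
      simp only [this, hc, mul_smul, smul_add, Matrix.mul_smul, Matrix.smul_mul]⟩

@[simp] lemma smul_At_fst {P : BPresheaf C} {U : Chart C} (a : U.A) (t : At P U) :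
    (a • t).1.1 = a • t.1.1 := rfl

@[simp] lemma smul_At_snd {P : BPresheaf C} {U : Chart C} (a : U.A) (t : At P U) {V : Chart C}
    (f : V ⟶ U) (p : P.obj V) (g : GL (Fin 2) V.A) :
    (a • t).1.2 V f p g = res f a • t.1.2 V f p g := rfl

lemma At.ext' {P : BPresheaf C} {U : Chart C} {s t : At P U} (h₁ : s.1.1 = t.1.1)
    (h₂ : ∀ (V : Chart C) (f : V ⟶ U) (p : P.obj V) (g : GL (Fin 2) V.A),
      s.1.2 V f p g = t.1.2 V f p g) : s = t := by
  apply Subtype.ext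
  apply Prod.ext h₁
  funext V f p g
  exact h₂ V f p g

instance (P : BPresheaf C) (U : Chart C) : Module U.A (At P U) where
  one_smul t := At.ext' (one_smul _ t.1.1) (fun V f p g => by
    change res f 1 • t.1.2 V f p g = t.1.2 V f p g
    rw [map_one, one_smul])
  mul_smul a b t := At.ext' (mul_smul a b t.1.1) (fun V f p g => by
    change res f (a * b) • t.1.2 V f p g = res f a • res f b • t.1.2 V f p g
    rw [map_mul, mul_smul])
  smul_zero a := At.ext' (smul_zero a) (fun V f p g =>
    smul_zero (A := Matrix (Fin 2) (Fin 2) V.A) (res f a))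
  smul_add a s t := At.ext' (smul_add a s.1.1 t.1.1) (fun V f p g =>
    smul_add (res f a) (s.1.2 V f p g) (t.1.2 V f p g))
  add_smul a b t := At.ext' (add_smul a b t.1.1) (fun V f p g => by
    change res f (a + b) • t.1.2 V f p g = res f a • t.1.2 V f p g + res f b • t.1.2 V f p g
    rw [map_add, add_smul])
  zero_smul t := At.ext' (zero_smul _ t.1.1) (fun V f p g => by
    change res f 0 • t.1.2 V f p g = 0
    rw [map_zero, zero_smul])

/-- Restriction of sections of the Atiyah algebroid. -/
def resAt {P : BPresheaf C} {V U : Chart C} (f : V ⟶ U) (t : At P U) : At P V :=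
  ⟨(resT f t.1.1, fun W g p => t.1.2 W (g ≫ f) p), by
    obtain ⟨h1, h2, h3, h4⟩ := t.2
    refine ⟨fun W g => h1 W (g ≫ f), ?_, fun W g => h3 W (g ≫ f), fun W g => h4 W (g ≫ f)⟩
    intro W W' g h p x
    have := h2 W W' (g ≫ f) h p x
    rwa [← Category.assoc] at this⟩

/-- The image in the Atiyah algebroid of `P_G` of the Atiyah algebroid of `P_B = P`: the matrices
in the frames coming from `P` are upper triangular. -/
def atiyahB (P : BPresheaf C) (U : Chart C) : Set (At P U) :=
  {t | ∀ (V : Chart C) (f : V ⟶ U) (p : P.obj V), t.mat f p 1 0 = 0}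

/-- An `S`-connection on `P_G`: an `O`-linear splitting of the anchor. -/
structure Connection (P : BPresheaf C) where
  toFun : ∀ U : Chart C, T U →ₗ[U.A] At P U
  split : ∀ (U : Chart C) (ξ : T U), (toFun U ξ).anchor = ξ
  natural : ∀ {V U : Chart C} (f : V ⟶ U) (ξ : T U),
    toFun V (resT f ξ) = resAt f (toFun U ξ)

/-! ## Indigenous bundles -/

/-- `(P, ∇)` is an indigenous bundle: `P` is a `B`-torsor and the composite of `∇` with the
projection of the Atiyah algebroid of `P_G` to its (sheaf) quotient by the Atiyah algebroid
of `P_B` is an isomorphism, i.e. injective and locally surjective. -/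
structure IsIndigenous (P : BPresheaf C) (D : Connection P) : Prop where
  torsor : P.IsTorsor
  injective : ∀ (U : Chart C) (ξ : T U), D.toFun U ξ ∈ atiyahB P U → ξ = 0
  surjective : ∀ (U : Chart C) (t : At P U), ∃ J : Sieve U, IsCovering J ∧
    ∀ (V : Chart C) (f : V ⟶ U), J f →
      ∃ ξ : T V, resAt f t - D.toFun V ξ ∈ atiyahB P V

/-- Indigenous bundles on `C / S`. -/
structure IndigenousBundle (C : RelCurve S) where
  P : BPresheaf C
  conn : Connection P
  indigenous : IsIndigenous P conn

/-- Isomorphisms of indigenous bundles: isomorphisms of `B`-torsors such that the induced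
isomorphism of `G`-torsors `(p, g) ↦ (φ p, g)` is compatible with the connections. -/
structure IndigenousBundle.Iso (E F : IndigenousBundle C) where
  equiv : ∀ U : Chart C, E.P.obj U ≃ F.P.obj U
  natural : ∀ {V U : Chart C} (f : V ⟶ U) (p : E.P.obj U),
    equiv V (E.P.map f p) = F.P.map f (equiv U p)
  equivariant : ∀ {U : Chart C} (p : E.P.obj U) (b : UT U.A),
    equiv U (E.P.act p b) = F.P.act (equiv U p) b
  compatible : ∀ (U : Chart C) (ξ : T U) (V : Chart C) (f : V ⟶ U) (p : E.P.obj V)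
    (g : GL (Fin 2) V.A),
    (F.conn.toFun U ξ).1.2 V f (equiv V p) g = (E.conn.toFun U ξ).1.2 V f p g

/-- Isomorphism classes of indigenous bundles on `C / S`. -/
instance indigenousSetoid (C : RelCurve S) : Setoid (IndigenousBundle C) where
  r E F := Nonempty (E.Iso F)
  iseqv :=
    { refl := fun E => ⟨⟨fun _ => Equiv.refl _, fun _ _ => rfl, fun _ _ => rfl,
        fun _ _ _ _ _ _ => rfl⟩⟩
      symm := by
        rintro E F ⟨φ⟩
        refine ⟨⟨fun U => (φ.equiv U).symm, ?_, ?_, ?_⟩⟩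
        · intro V U f p
          rw [Equiv.symm_apply_eq, φ.natural, Equiv.apply_symm_apply]
        · intro U p b
          rw [Equiv.symm_apply_eq, φ.equivariant, Equiv.apply_symm_apply]
        · intro U ξ V f p g
          rw [← φ.compatible, Equiv.apply_symm_apply]
      trans := by
        rintro E F G ⟨φ⟩ ⟨ψ⟩
        refine ⟨⟨fun U => (φ.equiv U).trans (ψ.equiv U), ?_, ?_, ?_⟩⟩
        · intro V U f p
          simp [φ.natural, ψ.natural]
        · intro U p b
          simp [φ.equivariant, ψ.equivariant]
        · intro U ξ V f p g
          simp [φ.compatible, ψ.compatible] }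

/-! ## The canonical `B`-torsor and canonical type -/

/-- `(1, w)` is a basis of the right `O`-module `D^{≤ 1}` on `U`. -/
def IsFrame {U : Chart C} (w : DOp U) : Prop :=
  (∀ P : DOp U, P ∈ DOp.order U 1 ↔ ∃ a b : U.A, P = fn a + w * fn b) ∧
  (∀ a b : U.A, fn a + w * fn b = 0 → a = 0 ∧ b = 0)

lemma IsFrame.act {U : Chart C} {w : DOp U} (hw : IsFrame w) {c d e : U.A} (hd : IsUnit d)
    (he : IsUnit e) : IsFrame ((fn c + w * fn d) * fn e) := by
  obtain ⟨d', rfl⟩ := hd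
  obtain ⟨e', rfl⟩ := he
  have key : ∀ a b : U.A, fn a + (fn c + w * fn (d' : U.A)) * fn (e' : U.A) * fn b
      = fn (a + c * (e' : U.A) * b) + w * fn ((d' : U.A) * (e' : U.A) * b) := by
    intro a b
    simp only [map_add, map_mul, add_mul, mul_assoc, add_assoc]
  refine ⟨fun P => ?_, fun a b h => ?_⟩
  · rw [hw.1 P]
    constructor
    · rintro ⟨a, b, rfl⟩
      refine ⟨a - c * (e' : U.A) * ((↑d'⁻¹ : U.A) * (↑e'⁻¹ : U.A) * b),
        (↑d'⁻¹ : U.A) * (↑e'⁻¹ : U.A) * b, ?_⟩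
      rw [key]
      have h2 : (d' : U.A) * (e' : U.A) * ((↑d'⁻¹ : U.A) * (↑e'⁻¹ : U.A) * b) = b := by
        have : (d' : U.A) * (e' : U.A) * ((↑d'⁻¹ : U.A) * (↑e'⁻¹ : U.A) * b)
          = ((d' : U.A) * (↑d'⁻¹ : U.A)) * ((e' : U.A) * (↑e'⁻¹ : U.A)) * b := by ring
        rw [this, Units.mul_inv, Units.mul_inv, one_mul, one_mul]
      rw [h2, sub_add_cancel]
    · rintro ⟨a, b, rfl⟩
      exact ⟨_, _, key a b⟩
  · rw [key] at h
    obtain ⟨h1, h2⟩ := hw.2 _ _ h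
    have hb : b = 0 := by
      rw [mul_assoc] at h2
      exact e'.mul_right_eq_zero.mp (d'.mul_right_eq_zero.mp h2)
    subst hb
    exact ⟨by simpa using h1, rfl⟩

/-- The entries of an upper triangular matrix are what they should be. -/
lemma utEntries {A : Type u} [CommRing A] (b : UT A) :
    (b.1.1 1 0 = 0) ∧ b.1.1 0 0 * (b⁻¹).1.1 0 0 = 1 ∧ IsUnit (b.1.1 1 1) := by
  have h0 : b.1.1 1 0 = 0 := b.2
  have h0' : (b⁻¹).1.1 1 0 = 0 := (b⁻¹).2
  have h : b.1.1 * (b⁻¹).1.1 = 1 := congrArg (fun g => g.1.1) (mul_inv_cancel b)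
  have h00 := congrFun (congrFun h 0) 0
  have h11 := congrFun (congrFun h 1) 1
  simp only [Matrix.mul_apply, Fin.sum_univ_two, h0, h0', mul_zero, add_zero, zero_mul, zero_add,
    Matrix.one_apply_eq] at h00 h11
  exact ⟨h0, h00, IsUnit.of_mul_eq_one _ h11⟩

/-- The `B`-torsor `P^†` of the filtered rank two bundle `O = D^{≤ 0} ⊆ D^{≤ 1}` (with the
`O`-module structure of `^r D`).  A section is a basis of `D^{≤ 1}` with first vector in
`D^{≤ 0}`, up to scalars; it has a unique representative of the form `(1, w)`. -/
def canonicalTorsor (C : RelCurve S) : BPresheaf C where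
  obj U := {w : DOp U // ∀ (V : Chart C) (f : V ⟶ U), IsFrame (resD f w)}
  map {V U} f w := ⟨resD f w.1, fun W g => by rw [← resD_comp]; exact w.2 W (g ≫ f)⟩
  map_id w := Subtype.ext (resD_id _ _)
  map_comp g f w := Subtype.ext (resD_comp g f _)
  act {U} w b := ⟨(fn (b.1.1 0 1) + w.1 * fn (b.1.1 1 1)) * fn ((b⁻¹).1.1 0 0), fun V f => by
    simp only [map_mul, map_add, resD_fn]
    exact (w.2 V f).act ((utEntries b).2.2.map _)
      ((IsUnit.of_mul_eq_one _ (by rw [mul_comm]; exact (utEntries b).2.1)).map _)⟩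
  act_map {V U} f w b := Subtype.ext (by
    have h : ((mapUT (res f) b)⁻¹).1.1 0 0 = res f ((b⁻¹).1.1 0 0) := by
      have h1 := (utEntries (mapUT (res f) b)).2.1
      have h2 : (mapUT (res f) b).1.1 0 0 * res f ((b⁻¹).1.1 0 0) = 1 := by
        change res f (b.1.1 0 0) * _ = 1
        rw [← map_mul, (utEntries b).2.1, map_one]
      have hu : IsUnit ((mapUT (res f) b).1.1 0 0) := IsUnit.of_mul_eq_one _ h1
      exact hu.mul_left_cancel (h1.trans h2.symm)
    simp only [map_mul, map_add, resD_fn, h]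
    rfl)
  act_mul {U} w b b' := Subtype.ext (by
    have e := (utEntries b)
    have e' := (utEntries b')
    have hinv : ((b * b')⁻¹).1.1 0 0 = (b⁻¹).1.1 0 0 * (b'⁻¹).1.1 0 0 := by
      have h1 := (utEntries (b * b')).2.1
      have h2 : (b * b').1.1 0 0 * ((b⁻¹).1.1 0 0 * (b'⁻¹).1.1 0 0) = 1 := by
        have : (b * b').1.1 0 0 = b.1.1 0 0 * b'.1.1 0 0 := by
          change (b.1.1 * b'.1.1) 0 0 = _
          simp [Matrix.mul_apply, Fin.sum_univ_two, e'.1]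
        rw [this, mul_mul_mul_comm, e.2.1, e'.2.1, one_mul]
      have hu : IsUnit ((b * b').1.1 0 0) := IsUnit.of_mul_eq_one _ h1
      exact hu.mul_left_cancel (h1.trans h2.symm)
    have h01 : (b * b').1.1 0 1 = b.1.1 0 0 * b'.1.1 0 1 + b.1.1 0 1 * b'.1.1 1 1 := by
      change (b.1.1 * b'.1.1) 0 1 = _
      simp [Matrix.mul_apply, Fin.sum_univ_two]
    have h11 : (b * b').1.1 1 1 = b.1.1 1 1 * b'.1.1 1 1 := by
      change (b.1.1 * b'.1.1) 1 1 = _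
      simp [Matrix.mul_apply, Fin.sum_univ_two, e.1]
    have hc : (b.1.1 0 0 * b'.1.1 0 1 + b.1.1 0 1 * b'.1.1 1 1)
        * ((b⁻¹).1.1 0 0 * (b'⁻¹).1.1 0 0)
        = (b'.1.1 0 1 + b.1.1 0 1 * ((b⁻¹).1.1 0 0 * b'.1.1 1 1)) * (b'⁻¹).1.1 0 0 := by
      linear_combination (b'.1.1 0 1 * (b'⁻¹).1.1 0 0) * e.2.1
    simp only [hinv, h01, h11]
    rw [add_mul, ← map_mul, hc]
    simp only [add_mul, map_add, map_mul, mul_assoc, add_assoc]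
    congr 3
    simp only [← map_mul]
    congr 1
    ring)
  act_scalar {U} w b c h := Subtype.ext (by
    have e := (utEntries b)
    have h00 : b.1.1 0 0 = c := by rw [h]; simp
    have h01 : b.1.1 0 1 = 0 := by rw [h]; simp
    have h11 : b.1.1 1 1 = c := by rw [h]; simp
    have e2 := e.2.1
    rw [h00] at e2
    simp only [h01, h11, map_zero, zero_add]
    rw [mul_assoc, ← map_mul, e2, map_one, mul_one])

/-- A connection on `P^†_G` is of canonical type if, for every local coordinate `x`, it is
`∂_x + (0 a; 1 0)` in the frame `(1, ½ ∂_x)`, for some function `a`. -/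
def IsCanonical (D : Connection (canonicalTorsor C)) : Prop :=
  ∀ (U : Chart C) (x : U.A) (ξ : T U) (w : (canonicalTorsor C).obj U),
    IsDualTo ξ x → w.1 + w.1 = vec ξ →
      ∃ a : U.A, (D.toFun U ξ).mat (𝟙 U) w = !![0, a; 1, 0]

/-! ## Theta characteristics and differential operators -/

/-- A line bundle on `C`: a cartesian family of invertible modules on the charts.  (A surjection
`O(V) ⊗ L(U) ⟶ L(V)` of invertible modules is an isomorphism.) -/
structure LineBundle (C : RelCurve S) where
  obj : Chart C → Type u
  [addCommGroup : ∀ U, AddCommGroup (obj U)]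
  [module : ∀ U, Module U.A (obj U)]
  [invertible : ∀ U, Module.Invertible U.A (obj U)]
  map : ∀ {V U : Chart C} (f : V ⟶ U), obj U →ₛₗ[res f] obj V
  map_id : ∀ {U : Chart C} (l : obj U), map (𝟙 U) l = l
  map_comp : ∀ {W V U : Chart C} (g : W ⟶ V) (f : V ⟶ U) (l : obj U),
    map (g ≫ f) l = map g (map f l)
  cartesian : ∀ {V U : Chart C} (f : V ⟶ U), Submodule.span V.A (Set.range (map f)) = ⊤

attribute [instance] LineBundle.addCommGroup LineBundle.module LineBundle.invertible

/-- A theta characteristic of `C / S`: a line bundle `L` with an isomorphism `L ⊗ L ≅ Ω`. -/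
structure Theta (C : RelCurve S) extends LineBundle C where
  sq : ∀ U : Chart C, obj U ⊗[U.A] obj U ≃ₗ[U.A] Om U
  sq_natural : ∀ {V U : Chart C} (f : V ⟶ U) (l m : obj U),
    sq V (map f l ⊗ₜ map f m) = resOm f (sq U (l ⊗ₜ m))

variable (L : Theta C)

/-- `L^∨` on a chart. -/
abbrev Theta.Dual (U : Chart C) : Type u := Module.Dual U.A (L.obj U)

/-- `L^∨ ⊗ Ω^{⊗ 2}` on a chart. -/
abbrev Theta.Target (U : Chart C) : Type u := L.Dual U ⊗[U.A] (Om U ⊗[U.A] Om U)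

/-- The pairing of `L^∨ ⊗ Ω^{⊗ 2}` with `l ⊗ (ξ ⊗ η)` in `L ⊗ T^{⊗ 2}`. -/
def Theta.pair {U : Chart C} (l : L.obj U) (ξ η : T U) : L.Target U →ₗ[U.A] U.A :=
  LinearMap.mul' U.A U.A ∘ₗ TensorProduct.map (Module.Dual.eval U.A (L.obj U) l)
    (LinearMap.mul' U.A U.A ∘ₗ TensorProduct.map ξ.toDer.liftKaehlerDifferential
      η.toDer.liftKaehlerDifferential)

/-- The induced contraction `L^∨ ⊗ Ω^{⊗ 2} ⊗ D ⟶ D`. -/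
def Theta.contract {U : Chart C} (l : L.obj U) (ξ η : T U) :
    L.Target U ⊗[U.A] DOp U →ₗ[U.A] DOp U :=
  TensorProduct.lid U.A (DOp U) ∘ₗ LinearMap.rTensor (DOp U) (L.pair l ξ η)

/-- Second order differential operators `L^∨ ⟶ L^∨ ⊗ Ω^{⊗ 2}`, i.e. global sections of
`Hom_O (L^∨, L^∨ ⊗ Ω^{⊗ 2} ⊗ D^{≤ 2})`, where the `O`-module structure of the target comes from
right multiplication on `D^{≤ 2}`. -/
@[ext]
structure DiffOp where
  toFun : ∀ U : Chart C, L.Dual U →+ L.Target U ⊗[U.A] DOp U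
  order_two : ∀ (U : Chart C) (μ : L.Dual U), toFun U μ ∈
    LinearMap.range (LinearMap.lTensor (L.Target U) (DOp.order U 2).subtype)
  linear : ∀ (U : Chart C) (a : U.A) (μ : L.Dual U),
    toFun U (a • μ) = LinearMap.lTensor (L.Target U) (mulRightFn a) (toFun U μ)
  /-- Compatibility with restriction to `V`, tested by contracting with `L ⊗ T^{⊗ 2}`;
  `ν` is the restriction of `μ`. -/
  natural : ∀ {V U : Chart C} (f : V ⟶ U) (μ : L.Dual U) (ν : L.Dual V),
    (∀ l : L.obj U, ν (L.map f l) = res f (μ l)) → ∀ (l : L.obj U) (ξ η : T U),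
      L.contract (L.map f l) (resT f ξ) (resT f η) (toFun V ν)
        = resD f (L.contract l ξ η (toFun U μ))

/-- `l = (dx)^{1/2}`. -/
def Theta.IsSqrt {U : Chart C} (l : L.obj U) (x : U.A) : Prop := L.sq U (l ⊗ₜ l) = dd x

/-- Principal symbol `1` and subprincipal symbol `0`: for every chart with a coordinate `x` and
a square root `l` of `dx`, with dual `μ = (dx)^{-1/2}`, the operator is
`μ ↦ μ ⊗ dx² ⊗ ∂_x² + μ ⊗ a ⊗ 1` for some `a` in `Ω^{⊗ 2}`. -/
def DiffOp.IsStar {L : Theta C} (D : DiffOp L) : Prop :=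
  ∀ (U : Chart C) (x : U.A) (ξ : T U) (l : L.obj U) (μ : L.Dual U),
    IsDualTo ξ x → L.IsSqrt l x → μ l = 1 →
      ∃ a : Om U ⊗[U.A] Om U,
        D.toFun U μ = (μ ⊗ₜ (dd x ⊗ₜ dd x)) ⊗ₜ (vec ξ * vec ξ) + (μ ⊗ₜ a) ⊗ₜ 1

/-! ## The indigenous bundle of a differential operator -/

/-- The left `D`-module `D ⊗ L`. -/
abbrev Theta.DL (U : Chart C) : Type (u + 1) := DOpR U ⊗[U.A] L.obj U

/-- The map `D ⊗ L ⟶ D`, `P ⊗ l ↦ P ∘ μ(l)`, for `μ` in `L^∨`. -/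
def Theta.evalDL {U : Chart C} (μ : L.Dual U) : L.DL U →ₗ[U.A] DOpR U :=
  (TensorProduct.rid U.A (DOpR U)).toLinearMap ∘ₗ LinearMap.lTensor (DOpR U) μ

/-- The left `D`-submodule of `D ⊗ L` generated by the image of the transpose
`T^{⊗ 2} ⊗ L ⟶ D ⊗ L` of `D`, which is characterised by the equality of
the two ways of evaluating at `l ⊗ (ξ ⊗ η)` and `μ`. -/
def DiffOp.submodule {L : Theta C} (D : DiffOp L) (U : Chart C) : Submodule (DOp U) (L.DL U) :=
  Submodule.span (DOp U) {y | ∃ (l : L.obj U) (ξ η : T U), ∀ μ : L.Dual U,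
    (L.evalDL μ y).toD = L.contract l ξ η (D.toFun U μ)}

/-- The frame `((dx)^{1/2}, ∂_x ⊗ (dx)^{1/2})` of `D^{≤ 1} ⊗ L`. -/
def Theta.frame {U : Chart C} (l : L.obj U) (ξ : T U) : Fin 2 → L.DL U :=
  ![(1 : DOp U).toR ⊗ₜ l, (vec ξ).toR ⊗ₜ l]

/-- `∇` is the connection on `P^†_G` defined by the connection `∇_D` on `D^{≤ 1} ⊗ L`, the latter
being the `D`-module structure transported from the quotient of `D ⊗ L` by `D.submodule`.
The `PGL₂`-torsor of `D^{≤ 1} ⊗ L` is identified with `P^†_G` in such a way that, for every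
coordinate `x`, the frame `((dx)^{1/2}, ∂_x ⊗ (dx)^{1/2})` corresponds to `(1, ½ ∂_x)`.
Thus the matrix of `∇` in the latter frame and the matrix `M` of `∇_D` in the former one
have the same image in `𝔤𝔩₂ / scalars`. -/
def DiffOp.IsAssociated {L : Theta C} (D : DiffOp L) (N : Connection (canonicalTorsor C)) : Prop :=
  ∀ (U : Chart C) (x : U.A) (ξ : T U) (l : L.obj U) (w : (canonicalTorsor C).obj U),
    IsDualTo ξ x → L.IsSqrt l x → w.1 + w.1 = vec ξ → ∀ η : T U,
      ∃ (M : Matrix (Fin 2) (Fin 2) U.A) (c : U.A),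
        (∀ j, vec η • L.frame l ξ j - ∑ i, fn (M i j) • L.frame l ξ i ∈ D.submodule U) ∧
        (N.toFun U η).mat (𝟙 U) w = M + c • (1 : Matrix (Fin 2) (Fin 2) U.A)

end Site

end IndigenousBundles

end

/-!
Every chart of `C` has a coordinate `x`, and smoothness of relative dimension one makes `Ω` free on
`dx` (`smul_D_eq_zero`), so that there is a dual vector field `∂_x` (`IsCoord.exists_dual`) and the
torsor `P^†` has the section `(1, ½ ∂_x)` (`halfSection`).

*Canonical type.* Let `(P, ∇)` be an indigenous bundle. In a frame `p` of `P` the connection is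
`∂_x + M` with `M` trace free, and the lower left entry of `M` is the Kodaira-Spencer map, hence a
unit (`IsIndigenous.isUnit_entry`). An upper triangular change of frame scales this entry to `1`
and then removes the diagonal, in exactly one way modulo scalars. So there is a unique *normal*
section `p_x`, for which the connection is `∂_x + (0 a; 1 0)` (`IsNormal.unique`,
`IsIndigenous.exists_normal`). If the coordinate changes to `y`, where `∂_y = u ∂_x`, then the
normal sections `p_x` and the sections `(1, ½ ∂_x)` are multiplied by the *same* matrix
`transition` (`At.mat_transition`, `halfSection_transition`), and `a` changes by a Schwarzian
derivative (`schwarz`). Therefore `p_x ↦ (1, ½ ∂_x)` is an isomorphism of `B`-torsors `P ≅ P^†`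
(`IsIndigenous.exists_iso`), which carries `∇` to a connection of canonical type
(`IndigenousBundle.exists_isCanonical`). For a connection of canonical type the normal sections are
the `(1, ½ ∂_x)`, so isomorphisms between such bundles fix them, and isomorphic connections of
canonical type are equal (`IsCanonical.eq_of_iso`). This is the second part.

*Operators.* For the first part, connections of canonical type and differential operators are both
compared with projective structures, that is, with families `a(∂_x)` that are compatible with
restriction and transform by the Schwarzian rule (`IsProj`). For connections, `a` is the upper
right entry of the matrix (`HasCoeff.isProj`, `IsCanonical.exists_hasCoeff`,
`IsProj.exists_hasCoeff`). For an operator, where `dx` has a square root, `(dx)^{-1/2}` is sent to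
`(dx)^{-1/2} ⊗ dx² ⊗ (∂_x² - a)`, and the identity
`∂_y² - a(∂_y) = ρ³ (∂_x² - a(∂_x)) ρ`, where `ρ² = ∂_y x` (`sturm_change`), shows that `a` obeys
the same rule (`DiffOp.IsStar.exists_hasPotential`) and that conversely a projective structure
defines an operator (`IsProj.exists_hasPotential`). As `2` is invertible, square roots of `dx`
exist étale locally (`isCovering_sqrtSieve`), and functions and operators of order at most two can
be glued (`IsCovering.exists_glue`, `IsCovering.exists_glue_order_two`). Finally, in the quotient of
`D ⊗ L` the vector field `∂_x` has the matrix `(0 a; 1 0)` in the frame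
`((dx)^{1/2}, ∂_x ⊗ (dx)^{1/2})`, and no other: the quotient maps to the `D`-module `O²` defined
by this matrix (`HasPotential.exists_functional`). So the connection associated with an operator is
the connection of canonical type with the same projective structure (`HasPotential.isAssociated`,
`HasPotential.hasCoeff`).
-/

noncomputable section

namespace IndigenousBundles

open Limits

/-! ### The groupoid action and étale restriction maps -/

section Groupoid

variable {R : Type u} [CommRing R] {S : EtaleGroupoid R} {C : RelCurve S}

lemma EtaleGroupoid.comp_congr {T : Scheme.{u}} {a a' b b' : T ⟶ S.mor} (ha : a = a') (hb : b = b')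
    (h : a ≫ S.tgt = b ≫ S.src) (h' : a' ≫ S.tgt = b' ≫ S.src) :
    S.comp a b h = S.comp a' b' h' := by
  subst ha hb; rfl

lemma RelCurve.act_congr {T : Scheme.{u}} {c c' : T ⟶ C.total} {a a' : T ⟶ S.mor} (hc : c = c')
    (ha : a = a') (h : c ≫ C.proj = a ≫ S.src) (h' : c' ≫ C.proj = a' ≫ S.src) :
    C.act c a h = C.act c' a' h' := by
  subst hc ha; rfl

lemma EtaleGroupoid.one_comp' {T : Scheme.{u}} (e a : T ⟶ S.mor) (he : e = (a ≫ S.src) ≫ S.one)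
    (h : e ≫ S.tgt = a ≫ S.src) : S.comp e a h = a := by
  subst he; exact S.one_comp a h

lemma EtaleGroupoid.comp_one' {T : Scheme.{u}} (a e : T ⟶ S.mor) (he : e = (a ≫ S.tgt) ≫ S.one)
    (h : a ≫ S.tgt = e ≫ S.src) : S.comp a e h = a := by
  subst he; exact S.comp_one a h

lemma EtaleGroupoid.inv_inv : S.inv ≫ S.inv = 𝟙 S.mor := by
  have h1 : (S.inv ≫ S.inv) ≫ S.tgt = S.inv ≫ S.src := by rw [Category.assoc, S.inv_tgt]
  have h2 : S.inv ≫ S.tgt = 𝟙 _ ≫ S.src := by rw [S.inv_tgt, Category.id_comp]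
  have h2' : (𝟙 S.mor ≫ S.inv) ≫ S.tgt = 𝟙 _ ≫ S.src := by simpa using h2
  have e1 : S.comp S.inv (𝟙 _) h2 = S.tgt ≫ S.one := by
    have := S.inv_comp (𝟙 S.mor) h2'
    simpa using this
  have e2 : S.comp (S.inv ≫ S.inv) S.inv h1 = (S.inv ≫ S.inv ≫ S.src) ≫ S.one := by
    have := S.inv_comp S.inv h1
    rw [this]
    simp [S.inv_tgt, S.inv_src]
  have h3 : S.comp (S.inv ≫ S.inv) S.inv h1 ≫ S.tgt = 𝟙 _ ≫ S.src := by
    rw [S.comp_tgt]; exact h2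
  have h4 : (S.inv ≫ S.inv) ≫ S.tgt = S.comp S.inv (𝟙 _) h2 ≫ S.src := by
    rw [S.comp_src]; exact h1
  have key := S.comp_assoc (S.inv ≫ S.inv) S.inv (𝟙 _) h1 h2 h3 h4
  rw [S.one_comp' _ _ _ h3, S.comp_one' _ _ _ h4] at key
  · exact key.symm
  · rw [e1]; simp [S.inv_tgt, S.inv_src]
  · rw [e2]; simp [S.inv_tgt, S.inv_src]

/-- Acting by the groupoid preserves étale points: the action map is the composite of an
involution of the étale `C`-scheme `C ×_S mor` with its projection to `C`. -/
lemma RelCurve.etale_act {T : Scheme.{u}} (c : T ⟶ C.total) (a : T ⟶ S.mor)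
    (hca : c ≫ C.proj = a ≫ S.src) [Etale c] : Etale (C.act c a hca) := by
  have := S.src_etale
  let P := pullback C.proj S.src
  let p : P ⟶ C.total := pullback.fst C.proj S.src
  let q : P ⟶ S.mor := pullback.snd C.proj S.src
  have hpq : p ≫ C.proj = q ≫ S.src := pullback.condition
  have : Etale p := inferInstanceAs (Etale (pullback.fst C.proj S.src))
  let m : P ⟶ C.total := C.act p q hpq
  have hm : m ≫ C.proj = (q ≫ S.inv) ≫ S.src := by
    rw [C.act_proj, Category.assoc, S.inv_src]
  let σ : P ⟶ P := pullback.lift m (q ≫ S.inv) hm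
  have σp : σ ≫ p = m := pullback.lift_fst _ _ _
  have σq : σ ≫ q = q ≫ S.inv := pullback.lift_snd _ _ _
  have hσσ : σ ≫ σ = 𝟙 P := by
    apply pullback.hom_ext
    · change (σ ≫ σ) ≫ p = 𝟙 P ≫ p
      rw [Category.assoc, σp, Category.id_comp]
      have h1 : (σ ≫ p) ≫ C.proj = (σ ≫ q) ≫ S.src := by rw [σp, σq]; exact hm
      have h2 : q ≫ S.tgt = (q ≫ S.inv) ≫ S.src := by rw [Category.assoc, S.inv_src]
      have h3 : p ≫ C.proj = S.comp q (q ≫ S.inv) h2 ≫ S.src := by rw [S.comp_src]; exact hpq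
      have h4 : p ≫ C.proj = ((p ≫ C.proj) ≫ S.one) ≫ S.src := by simp [S.one_src]
      rw [C.act_natural σ p q hpq h1, C.act_congr σp σq h1 hm, C.act_comp p q _ hpq h2 hm h3,
        C.act_congr rfl (S.comp_inv q h2) h3 (by simp [S.one_src, hpq])]
      exact (C.act_congr rfl (by rw [hpq]) _ h4).trans (C.act_one p h4)
    · change (σ ≫ σ) ≫ q = 𝟙 P ≫ q
      rw [Category.assoc, σq, ← Category.assoc, σq, Category.assoc, S.inv_inv]
      simp
  have : IsIso σ := ⟨σ, hσσ, hσσ⟩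
  have : Etale m := by rw [← σp]; infer_instance
  let l : T ⟶ P := pullback.lift c a hca
  have lp : l ≫ p = c := pullback.lift_fst _ _ _
  have lq : l ≫ q = a := pullback.lift_snd _ _ _
  have : Etale (l ≫ p) := by rw [lp]; infer_instance
  have : Etale l := Etale.of_comp l p
  have h1 : (l ≫ p) ≫ C.proj = (l ≫ q) ≫ S.src := by rw [lp, lq]; exact hca
  have : C.act c a hca = l ≫ m := by
    rw [C.act_natural l p q hpq h1]
    exact C.act_congr lp.symm lq.symm _ _
  rw [this]; infer_instance

end Groupoid

section Restriction

variable {R : Type u} [CommRing R] {S : EtaleGroupoid R} {C : RelCurve S}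

lemma res_etale {V U : Chart C} (f : V ⟶ U) : (res f).Etale := by
  have := V.toC_etale
  have := U.toC_etale
  have h := C.etale_act V.toC (Spec.map V.str ≫ Chart.Hom.iso f)
    (by rw [V.comm, Category.assoc, Chart.Hom.iso_src f])
  rw [Chart.Hom.act_eq f] at h
  have := Etale.of_comp (Spec.map (Chart.Hom.ring f)) U.toC
  exact (HasRingHomProperty.Spec_iff (P := @Etale)).mp this

lemma resBase_etale {V U : Chart C} (f : V ⟶ U) : (resBase f).Etale := by
  have := V.toS_etale
  have := U.toS_etale
  have := S.src_etale
  have := S.tgt_etale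
  have : Etale (Chart.Hom.iso f ≫ S.src) := by rw [Chart.Hom.iso_src f]; infer_instance
  have := Etale.of_comp (Chart.Hom.iso f) S.src
  have : Etale (Spec.map (Chart.Hom.base f) ≫ U.toS) := by
    rw [← Chart.Hom.iso_tgt f]; infer_instance
  have := Etale.of_comp (Spec.map (Chart.Hom.base f)) U.toS
  exact (HasRingHomProperty.Spec_iff (P := @Etale)).mp this

/-- The form of `span_D_eq_top` with algebra instances. -/
lemma span_D_eq_top_aux (k k' A A' : Type u) [CommRing k] [CommRing k'] [CommRing A]
    [CommRing A'] [Algebra k A] [Algebra k' A'] [Algebra k k'] [Algebra A A'] [Algebra k A']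
    [IsScalarTower k k' A'] [IsScalarTower k A A'] [Algebra.FormallyUnramified A A']
    {x : A} (hx : Submodule.span A {KaehlerDifferential.D k A x} = ⊤) :
    Submodule.span A' {KaehlerDifferential.D k' A' (algebraMap A A' x)} = ⊤ := by
  set M := Submodule.span A' {KaehlerDifferential.D k' A' (algebraMap A A' x)} with hM
  -- modulo `dx`, the universal derivation kills `A`, hence vanishes
  have key : ∀ a : A, KaehlerDifferential.D k' A' (algebraMap A A' a) ∈ M := by
    intro a
    have h1 : KaehlerDifferential.D k A a ∈ Submodule.span A {KaehlerDifferential.D k A x} := by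
      rw [hx]; trivial
    obtain ⟨b, hb⟩ := Submodule.mem_span_singleton.mp h1
    have h2 := congrArg (KaehlerDifferential.map k k' A A') hb
    rw [map_smul, KaehlerDifferential.map_D, KaehlerDifferential.map_D] at h2
    rw [← h2, ← algebraMap_smul A' b]
    exact M.smul_mem _ (Submodule.mem_span_singleton_self _)
  have h0 : ∀ b : A', M.mkQ (KaehlerDifferential.D k' A' b) = 0 := by
    let δ : Derivation A A' (Ω[A'⁄k'] ⧸ M) := Derivation.mk'
      { toFun := fun b => M.mkQ (KaehlerDifferential.D k' A' b)
        map_add' := fun a b => by rw [map_add, map_add]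
        map_smul' := fun a b => by
          have : M.mkQ (KaehlerDifferential.D k' A' (algebraMap A A' a)) = 0 :=
            (Submodule.Quotient.mk_eq_zero M).mpr (key a)
          rw [Algebra.smul_def, Derivation.leibniz, map_add, map_smul, map_smul, this, smul_zero,
            add_zero, algebraMap_smul, RingHom.id_apply] }
      (fun a b => by
        change M.mkQ (KaehlerDifferential.D k' A' (a * b)) = _
        rw [Derivation.leibniz, map_add, map_smul, map_smul]
        rfl)
    intro b
    have hδ : δ.liftKaehlerDifferential (KaehlerDifferential.D A A' b) = δ b :=
      δ.liftKaehlerDifferential_comp_D b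
    rw [Subsingleton.elim (KaehlerDifferential.D A A' b) 0, map_zero] at hδ
    exact hδ.symm
  rw [eq_top_iff, ← KaehlerDifferential.span_range_derivation k' A', Submodule.span_le]
  rintro _ ⟨b, rfl⟩
  exact (Submodule.Quotient.mk_eq_zero M).mp (h0 b)

/-- Along a formally unramified extension, the differentials of the source generate those of the
target. -/
lemma span_D_eq_top {k k' A A' : Type u} [CommRing k] [CommRing k'] [CommRing A] [CommRing A']
    [Algebra k A] [Algebra k' A'] (ρ : A →+* A') (β : k →+* k')
    (h : ∀ c, ρ (algebraMap k A c) = algebraMap k' A' (β c)) (hρ : ρ.FormallyUnramified)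
    {x : A} (hx : Submodule.span A {KaehlerDifferential.D k A x} = ⊤) :
    Submodule.span A' {KaehlerDifferential.D k' A' (ρ x)} = ⊤ :=
  letI : Algebra k k' := β.toAlgebra
  letI : Algebra A A' := ρ.toAlgebra
  letI : Algebra k A' := ((algebraMap k' A').comp β).toAlgebra
  haveI : IsScalarTower k k' A' := IsScalarTower.of_algebraMap_eq fun _ => rfl
  haveI : IsScalarTower k A A' := IsScalarTower.of_algebraMap_eq fun c => (h c).symm
  haveI : Algebra.FormallyUnramified A A' := hρ
  span_D_eq_top_aux k k' A A' hx

lemma IsCoord.restrict {V U : Chart C} (f : V ⟶ U) {x : U.A} (hx : IsCoord x) :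
    IsCoord (res f x) :=
  span_D_eq_top (res f) (resBase f) (res_algebraMap f)
    (res_etale f).formallyUnramified hx

end Restriction

/-! ### Differentials and vector fields -/

section Kaehler

/-- If `A / k` is smooth of relative dimension one and `dx` generates `Ω`, then `Ω` is free
on `dx`. -/
lemma smul_D_eq_zero {k A : Type u} [CommRing k] [CommRing A] [Algebra k A]
    (h : RingHom.Locally (RingHom.IsStandardSmoothOfRelativeDimension 1) (algebraMap k A))
    {x : A} (hx : Submodule.span A {KaehlerDifferential.D k A x} = ⊤) {a : A}
    (ha : a • KaehlerDifferential.D k A x = 0) : a = 0 := by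
  obtain ⟨s, hs, H⟩ := h
  refine Module.eq_of_isLocalized_span s hs (fun t => Localization.Away t.1)
    (fun t => Algebra.linearMap A (Localization.Away t.1)) a 0 fun t => ?_
  have ht := H t.1 t.2
  set B := Localization.Away t.1 with hB
  have hss : Algebra.IsStandardSmoothOfRelativeDimension 1 k B := by
    rw [← IsScalarTower.algebraMap_eq k A B] at ht
    exact (RingHom.isStandardSmoothOfRelativeDimension_algebraMap 1).mp ht
  rw [map_zero]
  rcases subsingleton_or_nontrivial B with hn | hn
  · exact Subsingleton.elim _ _
  have : Algebra.FormallyUnramified A B :=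
    Algebra.FormallyUnramified.of_isLocalization (Submonoid.powers t.1)
  have hx' : Submodule.span B {KaehlerDifferential.D k B (algebraMap A B x)} = ⊤ :=
    span_D_eq_top_aux k k A B hx
  have ha' : algebraMap A B a • KaehlerDifferential.D k B (algebraMap A B x) = 0 := by
    have := congrArg (KaehlerDifferential.map k k A B) ha
    rw [map_smul, KaehlerDifferential.map_D, map_zero] at this
    rwa [algebraMap_smul]
  have hrank := Algebra.IsStandardSmoothOfRelativeDimension.rank_kaehlerDifferential
    (R := k) (S := B) 1
  have : Algebra.IsStandardSmooth k B :=
    Algebra.IsStandardSmoothOfRelativeDimension.isStandardSmooth 1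
  have hfin : Module.finrank B (Ω[B⁄k]) = 1 := by
    simp [Module.finrank, hrank]
  -- under `Ω ≅ B` the generator `dx` corresponds to a unit
  obtain ⟨e⟩ := Module.nonempty_linearEquiv_of_finrank_eq_one hfin
  have hu : IsUnit (e.symm (KaehlerDifferential.D k B (algebraMap A B x))) := by
    have h1 : e 1 ∈ Submodule.span B {KaehlerDifferential.D k B (algebraMap A B x)} := by
      rw [hx']; trivial
    obtain ⟨b, hb⟩ := Submodule.mem_span_singleton.mp h1
    have h2 := congrArg e.symm hb
    rw [map_smul, e.symm_apply_apply, smul_eq_mul] at h2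
    exact IsUnit.of_mul_eq_one b (by rw [mul_comm]; exact h2)
  have h3 := congrArg e.symm ha'
  rw [map_smul, map_zero, smul_eq_mul] at h3
  exact hu.mul_left_eq_zero.mp h3

end Kaehler

section VectorFields

variable {R : Type u} [CommRing R] {S : EtaleGroupoid R} {C : RelCurve S}

/-- The map from a chart to the fibre product of `C` with its base is étale, so that charts are
smooth of relative dimension one over their base. -/
lemma Chart.locally_standardSmooth (U : Chart C) :
    RingHom.Locally (RingHom.IsStandardSmoothOfRelativeDimension 1) (algebraMap U.k U.A) := by
  have := U.toC_etale
  have := U.toS_etale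
  have := C.smooth
  let P := pullback C.proj U.toS
  have hp : Etale (pullback.fst C.proj U.toS) := inferInstance
  have hq : SmoothOfRelativeDimension 1 (pullback.snd C.proj U.toS) :=
    have : MorphismProperty.IsStableUnderBaseChange (@SmoothOfRelativeDimension.{u} 1) :=
      smoothOfRelativeDimension_isStableUnderBaseChange 1
    MorphismProperty.of_isPullback (P := @SmoothOfRelativeDimension.{u} 1)
      (IsPullback.of_hasPullback C.proj U.toS) C.smooth
  let l : Spec U.A ⟶ P := pullback.lift U.toC (Spec.map U.str) U.comm
  have lp : l ≫ pullback.fst C.proj U.toS = U.toC := pullback.lift_fst _ _ _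
  have lq : l ≫ pullback.snd C.proj U.toS = Spec.map U.str := pullback.lift_snd _ _ _
  have : Etale (l ≫ pullback.fst C.proj U.toS) := by rw [lp]; infer_instance
  have : Etale l := Etale.of_comp l (pullback.fst C.proj U.toS)
  have : SmoothOfRelativeDimension (0 + 1) (l ≫ pullback.snd C.proj U.toS) := inferInstance
  rw [lq, zero_add] at this
  exact (HasRingHomProperty.Spec_iff (P := @SmoothOfRelativeDimension 1)).mp this

@[simp] lemma resOm_dd {V U : Chart C} (f : V ⟶ U) (a : U.A) :
    resOm f (dd a) = dd (res f a) := by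
  let : Algebra U.k V.k := (resBase f).toAlgebra
  let : Algebra U.A V.A := (res f).toAlgebra
  let : Algebra U.k V.A := ((algebraMap V.k V.A).comp (resBase f)).toAlgebra
  have : IsScalarTower U.k V.k V.A := IsScalarTower.of_algebraMap_eq fun _ => rfl
  have : IsScalarTower U.k U.A V.A := IsScalarTower.of_algebraMap_eq fun c =>
    (res_algebraMap f c).symm
  exact KaehlerDifferential.map_D U.k V.k U.A V.A a

@[simp] lemma resOm_smul {V U : Chart C} (f : V ⟶ U) (a : U.A) (ω : Om U) :
    resOm f (a • ω) = res f a • resOm f ω := by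
  let : Algebra U.k V.k := (resBase f).toAlgebra
  let : Algebra U.A V.A := (res f).toAlgebra
  let : Algebra U.k V.A := ((algebraMap V.k V.A).comp (resBase f)).toAlgebra
  have : IsScalarTower U.k V.k V.A := IsScalarTower.of_algebraMap_eq fun _ => rfl
  have : IsScalarTower U.k U.A V.A := IsScalarTower.of_algebraMap_eq fun c =>
    (res_algebraMap f c).symm
  change KaehlerDifferential.map U.k V.k U.A V.A (a • ω) = _
  rw [map_smul]
  exact algebra_compatible_smul V.A a _

lemma IsCoord.exists_smul {U : Chart C} {x : U.A} (hx : IsCoord x) (ω : Om U) :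
    ∃ b : U.A, ω = b • dd x := by
  have h1 : ω ∈ Submodule.span U.A {dd x} := by
    have h : Submodule.span U.A {dd x} = ⊤ := hx
    rw [h]; trivial
  obtain ⟨b, hb⟩ := Submodule.mem_span_singleton.mp h1
  exact ⟨b, hb.symm⟩

lemma IsCoord.smul_eq_zero {U : Chart C} {x : U.A} (hx : IsCoord x) {a : U.A}
    (ha : a • dd x = 0) : a = 0 :=
  smul_D_eq_zero U.locally_standardSmooth hx ha

/-- A derivation is determined by its value on a coordinate, compatibly with restriction. -/
lemma IsCoord.der_res {V U : Chart C} (f : V ⟶ U) {x : U.A} (hx : IsCoord x)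
    {δ : Derivation U.k U.A U.A} {δ' : Derivation V.k V.A V.A}
    (h : δ' (res f x) = res f (δ x)) (a : U.A) : δ' (res f a) = res f (δ a) := by
  obtain ⟨b, hb⟩ := hx.exists_smul (dd a)
  have h1 := congrArg δ.liftKaehlerDifferential hb
  rw [map_smul, Derivation.liftKaehlerDifferential_comp_D,
    Derivation.liftKaehlerDifferential_comp_D, smul_eq_mul] at h1
  have h2 := congrArg δ'.liftKaehlerDifferential (congrArg (resOm f) hb)
  rw [resOm_smul, resOm_dd, resOm_dd, map_smul, Derivation.liftKaehlerDifferential_comp_D,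
    Derivation.liftKaehlerDifferential_comp_D, smul_eq_mul, h] at h2
  rw [h1, h2, map_mul]

lemma IsCoord.der_ext {U : Chart C} {x : U.A} (hx : IsCoord x) {δ δ' : Derivation U.k U.A U.A}
    (h : δ x = δ' x) : δ = δ' := by
  ext a
  have := hx.der_res (𝟙 U) (δ := δ) (δ' := δ') (by simp [h]) a
  simpa using this.symm

lemma IsCoord.exists_der {U : Chart C} {x : U.A} (hx : IsCoord x) :
    ∃ δ : Derivation U.k U.A U.A, δ x = 1 := by
  have hinj : Function.Injective (LinearMap.toSpanSingleton U.A (Om U) (dd x)) := by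
    rw [← LinearMap.ker_eq_bot, LinearMap.ker_eq_bot']
    intro a ha
    exact hx.smul_eq_zero ha
  have hsurj : Function.Surjective (LinearMap.toSpanSingleton U.A (Om U) (dd x)) := fun ω => by
    obtain ⟨b, hb⟩ := hx.exists_smul ω
    exact ⟨b, hb.symm⟩
  let e := LinearEquiv.ofBijective _ ⟨hinj, hsurj⟩
  refine ⟨e.symm.toLinearMap.compDer (KaehlerDifferential.D U.k U.A), ?_⟩
  change e.symm (dd x) = 1
  rw [LinearEquiv.symm_apply_eq]
  exact (one_smul U.A (dd x)).symm

/-- Every coordinate has a dual vector field. -/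
lemma IsCoord.exists_dual {U : Chart C} {x : U.A} (hx : IsCoord x) :
    ∃ ξ : T U, IsDualTo ξ x := by
  choose δ hδ using fun (V : Chart C) (f : V ⟶ U) => (hx.restrict f).exists_der
  refine ⟨⟨δ, fun V W f g a => ?_⟩, hx, ?_⟩
  · refine (hx.restrict f).der_res g ?_ a
    rw [hδ V f, map_one, ← res_comp, hδ]
  · exact hδ U (𝟙 U)

lemma Chart.exists_dual (U : Chart C) : ∃ (x : U.A) (ξ : T U), IsDualTo ξ x := by
  obtain ⟨x, hx⟩ := U.exists_coord
  have hx' : IsCoord x := hx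
  obtain ⟨ξ, hξ⟩ := hx'.exists_dual
  exact ⟨x, ξ, hξ⟩

lemma toDer_resT {V U : Chart C} (f : V ⟶ U) (ξ : T U) (a : U.A) :
    (resT f ξ).toDer (res f a) = res f (ξ.toDer a) := by
  have := ξ.2 U V (𝟙 U) f a
  simpa [T.toDer] using this

lemma toDer_resT' {V U : Chart C} (f : V ⟶ U) (ξ : T U) : ξ.1 V f = (resT f ξ).toDer := by
  simp [T.toDer]

@[simp] lemma toDer_smul {U : Chart C} (a : U.A) (ξ : T U) (b : U.A) :
    (a • ξ).toDer b = a * ξ.toDer b := by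
  simp [T.toDer]

@[simp] lemma toDer_add {U : Chart C} (ξ η : T U) (b : U.A) :
    (ξ + η).toDer b = ξ.toDer b + η.toDer b := rfl

lemma resT_smul {V U : Chart C} (f : V ⟶ U) (a : U.A) (ξ : T U) :
    resT f (a • ξ) = res f a • resT f ξ := by
  ext W g : 3; simp

lemma resT_comp {W V U : Chart C} (g : W ⟶ V) (f : V ⟶ U) (ξ : T U) :
    resT (g ≫ f) ξ = resT g (resT f ξ) := by
  ext X h : 3
  simp [Category.assoc]

lemma resT_id {U : Chart C} (ξ : T U) : resT (𝟙 U) ξ = ξ := by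
  ext X h : 3
  simp

/-- A vector field is determined by its value on a coordinate. -/
lemma IsCoord.T_ext {U : Chart C} {x : U.A} (hx : IsCoord x) {ξ η : T U}
    (h : ξ.toDer x = η.toDer x) : ξ = η := by
  apply Subtype.ext
  funext V f
  rw [toDer_resT', toDer_resT']
  refine (hx.restrict f).der_ext ?_
  rw [toDer_resT, toDer_resT, h]

lemma IsDualTo.restrict {V U : Chart C} (f : V ⟶ U) {x : U.A} {ξ : T U} (h : IsDualTo ξ x) :
    IsDualTo (resT f ξ) (res f x) :=
  ⟨h.1.restrict f, by rw [toDer_resT, h.2, map_one]⟩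

lemma IsDualTo.eq_smul {U : Chart C} {x : U.A} {ξ : T U} (h : IsDualTo ξ x) (η : T U) :
    η = η.toDer x • ξ :=
  h.1.T_ext (by rw [toDer_smul, h.2, mul_one])

lemma IsDualTo.isUnit {U : Chart C} {x y : U.A} {ξ η : T U} (h : IsDualTo ξ x)
    (h' : IsDualTo η y) : η.toDer x * ξ.toDer y = 1 := by
  have h1 := congrArg (fun ζ : T U => ζ.toDer y) (h.eq_smul η)
  simpa [h'.2] using h1.symm

lemma IsDualTo.dd_eq {U : Chart C} {x : U.A} {ξ : T U} (h : IsDualTo ξ x) (a : U.A) :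
    dd a = ξ.toDer a • dd x := by
  obtain ⟨b, hb⟩ := h.1.exists_smul (dd a)
  have h1 := congrArg ξ.toDer.liftKaehlerDifferential hb
  rw [map_smul, Derivation.liftKaehlerDifferential_comp_D,
    Derivation.liftKaehlerDifferential_comp_D, smul_eq_mul, h.2, mul_one] at h1
  rw [h1, ← hb]

end VectorFields

/-! ### Étale charts and fibre products of charts -/

section Charts

variable {R : Type u} [CommRing R] {S : EtaleGroupoid R} {C : RelCurve S}

/-- A morphism of charts for which the two maps to `C` and the two maps to `S.ob` agree strictly,
so that the `2`-isomorphism is an identity. -/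
def Chart.Hom.ofStrict {V U : Chart C} (base : U.k ⟶ V.k) (ring : U.A ⟶ V.A)
    (comm : U.str ≫ ring = base ≫ V.str) (hS : V.toS = Spec.map base ≫ U.toS)
    (hC : V.toC = Spec.map ring ≫ U.toC) : V ⟶ U where
  base := base
  ring := ring
  iso := V.toS ≫ S.one
  comm := comm
  iso_src := by rw [Category.assoc, S.one_src, Category.comp_id]
  iso_tgt := by rw [Category.assoc, S.one_tgt, Category.comp_id, hS]
  act_eq := by
    have h : V.toC ≫ C.proj = ((V.toC ≫ C.proj) ≫ S.one) ≫ S.src := by simp [S.one_src]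
    rw [← hC]
    refine Eq.trans ?_ (C.act_one V.toC h)
    exact C.act_congr rfl (by rw [V.comm, Category.assoc]) _ _

/-- The chart of an étale algebra over a chart. -/
def Chart.ofEtale (U : Chart C) {B : CommRingCat.{u}} (φ : U.A ⟶ B) (hφ : φ.hom.Etale) :
    Chart C where
  k := U.k
  A := B
  str := U.str ≫ φ
  toS := U.toS
  toC := Spec.map φ ≫ U.toC
  toS_etale := U.toS_etale
  toC_etale := by
    have := U.toC_etale
    have : Etale (Spec.map φ) := (HasRingHomProperty.Spec_iff (P := @Etale)).mpr hφ
    infer_instance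
  comm := by rw [Category.assoc, U.comm, Spec.map_comp, Category.assoc]
  exists_coord := by
    obtain ⟨x, hx⟩ := U.exists_coord
    let _ := (U.str ≫ φ).hom.toAlgebra
    exact ⟨φ.hom x, span_D_eq_top φ.hom (RingHom.id U.k) (fun _ => rfl)
      hφ.formallyUnramified hx⟩

/-- The projection of the chart of an étale algebra. -/
def Chart.ofEtaleHom (U : Chart C) {B : CommRingCat.{u}} (φ : U.A ⟶ B) (hφ : φ.hom.Etale) :
    U.ofEtale φ hφ ⟶ U :=
  Chart.Hom.ofStrict (𝟙 U.k) φ (Category.id_comp _).symm (by simp [Chart.ofEtale]) rfl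

section FibreProduct

variable {U V W : Chart C} (f : V ⟶ U) (g : W ⟶ U)

lemma etale_specMap_inl :
    Etale (Spec.map (pushout.inl (Chart.Hom.ring f) (Chart.Hom.ring g))) := by
  have h : Etale (Spec.map (Chart.Hom.ring g)) :=
    (HasRingHomProperty.Spec_iff (P := @Etale)).mpr (res_etale g)
  exact MorphismProperty.of_isPullback (P := @Etale)
    (isPullback_SpecMap_pushout (Chart.Hom.ring f) (Chart.Hom.ring g)).flip h

lemma etale_specMap_inl_base :
    Etale (Spec.map (pushout.inl (Chart.Hom.base f) (Chart.Hom.base g))) := by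
  have h : Etale (Spec.map (Chart.Hom.base g)) :=
    (HasRingHomProperty.Spec_iff (P := @Etale)).mpr (resBase_etale g)
  exact MorphismProperty.of_isPullback (P := @Etale)
    (isPullback_SpecMap_pushout (Chart.Hom.base f) (Chart.Hom.base g)).flip h

/-- The structure map of the fibre product of two charts. -/
def fibreProductStr : pushout (Chart.Hom.base f) (Chart.Hom.base g) ⟶
    pushout (Chart.Hom.ring f) (Chart.Hom.ring g) :=
  pushout.desc (V.str ≫ pushout.inl _ _) (W.str ≫ pushout.inr _ _) (by
    rw [← Category.assoc, ← Chart.Hom.comm f, ← Category.assoc, ← Chart.Hom.comm g,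
      Category.assoc, Category.assoc, pushout.condition])

lemma inl_fibreProductStr : pushout.inl _ _ ≫ fibreProductStr f g = V.str ≫ pushout.inl _ _ :=
  pushout.inl_desc _ _ _

lemma inr_fibreProductStr : pushout.inr _ _ ≫ fibreProductStr f g = W.str ≫ pushout.inr _ _ :=
  pushout.inr_desc _ _ _

/-- The fibre product of two charts over a third one. -/
def fibreProduct : Chart C where
  k := pushout (Chart.Hom.base f) (Chart.Hom.base g)
  A := pushout (Chart.Hom.ring f) (Chart.Hom.ring g)
  str := fibreProductStr f g
  toS := Spec.map (pushout.inl _ _) ≫ V.toS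
  toC := Spec.map (pushout.inl _ _) ≫ V.toC
  toS_etale := by
    have := V.toS_etale
    have := etale_specMap_inl_base f g
    infer_instance
  toC_etale := by
    have := V.toC_etale
    have := etale_specMap_inl f g
    infer_instance
  comm := by
    rw [Category.assoc, V.comm, ← Category.assoc, ← Spec.map_comp, ← inl_fibreProductStr,
      Spec.map_comp, Category.assoc]
  exists_coord := by
    obtain ⟨x, hx⟩ := V.exists_coord
    let _ := (fibreProductStr f g).hom.toAlgebra
    have h : (pushout.inl (Chart.Hom.ring f) (Chart.Hom.ring g)).hom.Etale :=
      (HasRingHomProperty.Spec_iff (P := @Etale)).mp (etale_specMap_inl f g)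
    exact ⟨(pushout.inl (Chart.Hom.ring f) (Chart.Hom.ring g)).hom x,
      span_D_eq_top (pushout.inl (Chart.Hom.ring f) (Chart.Hom.ring g)).hom
        (pushout.inl (Chart.Hom.base f) (Chart.Hom.base g)).hom
        (fun c => (congrArg (fun φ => φ.hom c) (inl_fibreProductStr f g)).symm)
        h.formallyUnramified hx⟩

/-- The first projection of a fibre product of charts. -/
def fibreProduct.fst : fibreProduct f g ⟶ V :=
  Chart.Hom.ofStrict (pushout.inl _ _) (pushout.inl _ _) (inl_fibreProductStr f g).symm rfl rfl

lemma inl_iso_tgt : (Spec.map (pushout.inl (Chart.Hom.base f) (Chart.Hom.base g)) ≫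
    Chart.Hom.iso f) ≫ S.tgt =
    (Spec.map (pushout.inr (Chart.Hom.base f) (Chart.Hom.base g)) ≫ Chart.Hom.iso g) ≫ S.tgt := by
  rw [Category.assoc, Category.assoc, Chart.Hom.iso_tgt f, Chart.Hom.iso_tgt g,
    ← Category.assoc, ← Category.assoc, ← Spec.map_comp, ← Spec.map_comp, pushout.condition]

lemma inl_iso_tgt_inv : (Spec.map (pushout.inl (Chart.Hom.base f) (Chart.Hom.base g)) ≫
    Chart.Hom.iso f) ≫ S.tgt =
    ((Spec.map (pushout.inr (Chart.Hom.base f) (Chart.Hom.base g)) ≫ Chart.Hom.iso g) ≫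
      S.inv) ≫ S.src := by
  rw [inl_iso_tgt, Category.assoc (_ ≫ _), S.inv_src]

/-- The `2`-isomorphism of the second projection of a fibre product: the composite of the one of
`f` with the inverse of the one of `g`. -/
def fibreProductIso : Spec (pushout (Chart.Hom.base f) (Chart.Hom.base g)) ⟶ S.mor :=
  S.comp (Spec.map (pushout.inl _ _) ≫ Chart.Hom.iso f)
    ((Spec.map (pushout.inr _ _) ≫ Chart.Hom.iso g) ≫ S.inv) (inl_iso_tgt_inv f g)

lemma fibreProductIso_src :
    fibreProductIso f g ≫ S.src = Spec.map (pushout.inl _ _) ≫ V.toS := by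
  rw [fibreProductIso, S.comp_src, Category.assoc, Chart.Hom.iso_src f]

lemma fibreProductIso_tgt :
    fibreProductIso f g ≫ S.tgt = Spec.map (pushout.inr _ _) ≫ W.toS := by
  rw [fibreProductIso, S.comp_tgt, Category.assoc, S.inv_tgt, Category.assoc, Chart.Hom.iso_src g]

lemma fibreProductIso_comp :
    S.comp (fibreProductIso f g) (Spec.map (pushout.inr _ _) ≫ Chart.Hom.iso g)
      (by rw [fibreProductIso_tgt, Category.assoc, Chart.Hom.iso_src g]) =
    Spec.map (pushout.inl _ _) ≫ Chart.Hom.iso f := by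
  have h0 := inl_iso_tgt f g
  have h1 := inl_iso_tgt_inv f g
  simp only [fibreProductIso]
  set b := Spec.map (pushout.inr (Chart.Hom.base f) (Chart.Hom.base g)) ≫ Chart.Hom.iso g
  have h2 : (b ≫ S.inv) ≫ S.tgt = b ≫ S.src := by rw [Category.assoc, S.inv_tgt]
  refine (S.comp_assoc _ (b ≫ S.inv) b h1 h2 (by rw [S.comp_tgt]; exact h2)
    (by rw [S.comp_src]; exact h1)).trans ?_
  refine S.comp_one' _ _ ?_ _
  rw [S.inv_comp, h0]

/-- The second projection of a fibre product of charts. -/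
def fibreProduct.snd : fibreProduct f g ⟶ W where
  base := pushout.inr _ _
  ring := pushout.inr _ _
  iso := fibreProductIso f g
  comm := (inr_fibreProductStr f g).symm
  iso_src := fibreProductIso_src f g
  iso_tgt := fibreProductIso_tgt f g
  act_eq := by
    set a := Spec.map (pushout.inl (Chart.Hom.base f) (Chart.Hom.base g)) ≫ Chart.Hom.iso f with ha
    set b := Spec.map (pushout.inr (Chart.Hom.base f) (Chart.Hom.base g)) ≫ Chart.Hom.iso g with hb
    set s := Spec.map (fibreProductStr f g) with hs
    set c := Spec.map (pushout.inl (Chart.Hom.ring f) (Chart.Hom.ring g)) ≫ V.toC with hc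
    set d := Spec.map (pushout.inr (Chart.Hom.ring f) (Chart.Hom.ring g)) ≫ W.toC with hd
    -- `c` and `d` are the maps of the fibre product to `C` through `V` and `W`; they agree after
    -- the action of `s ≫ a` and `s ≫ b`, so the quotient of these arrows moves `c` to `d`
    have hsl : s ≫ Spec.map (pushout.inl _ _) = Spec.map (pushout.inl _ _) ≫ Spec.map V.str := by
      rw [hs, ← Spec.map_comp, inl_fibreProductStr, Spec.map_comp]
    have hsr : s ≫ Spec.map (pushout.inr _ _) = Spec.map (pushout.inr _ _) ≫ Spec.map W.str := by
      rw [hs, ← Spec.map_comp, inr_fibreProductStr, Spec.map_comp]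
    have hV : V.toC ≫ C.proj = (Spec.map V.str ≫ Chart.Hom.iso f) ≫ S.src := by
      rw [V.comm, Category.assoc, Chart.Hom.iso_src f]
    have hW : W.toC ≫ C.proj = (Spec.map W.str ≫ Chart.Hom.iso g) ≫ S.src := by
      rw [W.comm, Category.assoc, Chart.Hom.iso_src g]
    have hca' : s ≫ a = Spec.map (pushout.inl _ _) ≫ Spec.map V.str ≫ Chart.Hom.iso f := by
      rw [ha, ← Category.assoc, hsl, Category.assoc]
    have hdb' : s ≫ b = Spec.map (pushout.inr _ _) ≫ Spec.map W.str ≫ Chart.Hom.iso g := by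
      rw [hb, ← Category.assoc, hsr, Category.assoc]
    have hca : c ≫ C.proj = (s ≫ a) ≫ S.src := by
      rw [hca', hc, Category.assoc, hV]; simp only [Category.assoc]
    have hdb : d ≫ C.proj = (s ≫ b) ≫ S.src := by
      rw [hdb', hd, Category.assoc, hW]; simp only [Category.assoc]
    have e1 : C.act c (s ≫ a) hca = Spec.map (pushout.inl _ _) ≫ Spec.map (Chart.Hom.ring f)
        ≫ U.toC := by
      rw [← Chart.Hom.act_eq f, C.act_natural _ _ _ _ (by rw [← hca']; exact hca)]
      exact C.act_congr rfl hca' _ _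
    have e2 : C.act d (s ≫ b) hdb = Spec.map (pushout.inr _ _) ≫ Spec.map (Chart.Hom.ring g)
        ≫ U.toC := by
      rw [← Chart.Hom.act_eq g, C.act_natural _ _ _ _ (by rw [← hdb']; exact hdb)]
      exact C.act_congr rfl hdb' _ _
    have e3 : C.act c (s ≫ a) hca = C.act d (s ≫ b) hdb := by
      rw [e1, e2, ← Category.assoc, ← Category.assoc, ← Spec.map_comp, ← Spec.map_comp,
        pushout.condition]
    have hab : (s ≫ a) ≫ S.tgt = ((s ≫ b) ≫ S.inv) ≫ S.src := by
      rw [Category.assoc (s ≫ b), S.inv_src]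
      have := congrArg (fun t => t ≫ C.proj) e3
      simpa only [C.act_proj] using this
    have h1 : C.act c (s ≫ a) hca ≫ C.proj = ((s ≫ b) ≫ S.inv) ≫ S.src := by
      rw [C.act_proj]; exact hab
    have h1' : C.act d (s ≫ b) hdb ≫ C.proj = ((s ≫ b) ≫ S.inv) ≫ S.src := by
      rw [← e3]; exact h1
    have h2 : c ≫ C.proj = S.comp (s ≫ a) ((s ≫ b) ≫ S.inv) hab ≫ S.src := by
      rw [S.comp_src]; exact hca
    have hbb : (s ≫ b) ≫ S.tgt = ((s ≫ b) ≫ S.inv) ≫ S.src := by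
      rw [Category.assoc (s ≫ b), S.inv_src]
    have h3 : d ≫ C.proj = S.comp (s ≫ b) ((s ≫ b) ≫ S.inv) hbb ≫ S.src := by
      rw [S.comp_src]; exact hdb
    have h4 : d ≫ C.proj = ((d ≫ C.proj) ≫ S.one) ≫ S.src := by simp [S.one_src]
    have e4 : C.act c _ h2 = d := by
      rw [← C.act_comp c _ _ hca hab h1 h2, C.act_congr e3 rfl h1 h1',
        C.act_comp d _ _ hdb hbb h1' h3]
      refine Eq.trans ?_ (C.act_one d h4)
      exact C.act_congr rfl (by rw [S.comp_inv _ hbb, hdb]) _ _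
    refine Eq.trans (C.act_congr rfl ?_ _ _) e4
    have h5 : (s ≫ a) ≫ S.tgt = (s ≫ b ≫ S.inv) ≫ S.src := by
      simpa only [Category.assoc] using hab
    change s ≫ S.comp a (b ≫ S.inv) _ = _
    rw [S.comp_natural _ _ _ _ h5]
    exact S.comp_congr rfl (Category.assoc _ _ _).symm _ _

lemma fibreProduct.condition : fibreProduct.fst f g ≫ f = fibreProduct.snd f g ≫ g := by
  apply Chart.Hom.ext
  · exact pushout.condition
  · exact pushout.condition
  · refine Eq.trans (S.one_comp' _ _ ?_ _) (fibreProductIso_comp f g).symm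
    exact congrArg (fun t => t ≫ S.one) (by
      rw [Category.assoc, Chart.Hom.iso_src f]
      rfl)

end FibreProduct

end Charts

/-! ### Étale gluing of functions -/

section Gluing

/-- The map to the affine line (over `ℤ`) defined by a function. -/
def toLine {A : CommRingCat.{u}} (a : A) :
    Spec A ⟶ Spec (CommRingCat.of (Polynomial (ULift.{u} ℤ))) :=
  Spec.map (CommRingCat.ofHom
    (Polynomial.eval₂RingHom ((Int.castRingHom A).comp ULift.ringEquiv.toRingHom) a))

lemma specMap_toLine {A B : CommRingCat.{u}} (φ : A ⟶ B) (a : A) :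
    Spec.map φ ≫ toLine a = toLine (φ.hom a) := by
  rw [toLine, toLine, ← Spec.map_comp]
  congr 1
  ext : 1
  refine Polynomial.ringHom_ext (fun n => ?_) ?_
  · simp
  · simp

lemma toLine_injective {A : CommRingCat.{u}} {a b : A} (h : toLine a = toLine b) : a = b := by
  have := congrArg (fun φ => φ.hom Polynomial.X) (Spec.map_injective h)
  simpa using this

lemma toLine_surjective {A : CommRingCat.{u}}
    (t : Spec A ⟶ Spec (CommRingCat.of (Polynomial (ULift.{u} ℤ)))) : ∃ a : A, toLine a = t := by
  obtain ⟨φ, rfl⟩ : ∃ φ, Spec.map φ = t := ⟨Spec.preimage t, Spec.map_preimage t⟩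
  refine ⟨φ.hom Polynomial.X, congrArg Spec.map ?_⟩
  ext : 1
  refine Polynomial.ringHom_ext (fun n => ?_) ?_
  · have : ∀ f g : ULift.{u} ℤ →+* A, f = g := by
      intro f g
      ext n
      have h := RingHom.congr_fun (Subsingleton.elim
        (f.comp ULift.ringEquiv.symm.toRingHom) (g.comp ULift.ringEquiv.symm.toRingHom)) n.down
      exact h
    have h := RingHom.congr_fun (this ((Int.castRingHom A).comp ULift.ringEquiv.toRingHom)
      (φ.hom.comp Polynomial.C)) n
    simpa using h
  · simp

variable {R : Type u} [CommRing R] {S : EtaleGroupoid R} {C : RelCurve S}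

/-- Descent of functions along a surjective family of étale maps of charts: functions are maps to
the affine line, and representable presheaves are sheaves for the fppf topology. -/
lemma existsUnique_glue_family {U : Chart C} (V : PrimeSpectrum U.A → Chart C)
    (f : ∀ x, V x ⟶ U) (hf : ∀ x, ∃ y, PrimeSpectrum.comap (res (f x)) y = x)
    (a : ∀ x, (V x).A)
    (ha : ∀ x y, res (fibreProduct.fst (f x) (f y)) (a x)
      = res (fibreProduct.snd (f x) (f y)) (a y)) :
    ∃! b : U.A, ∀ x, res (f x) b = a x := by
  choose y hy using hf
  have key : (Presieve.ofArrows (fun x => Spec (V x).A)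
      (fun x => Spec.map (Chart.Hom.ring (f x)))).IsSheafFor
      (yoneda.obj (Spec (CommRingCat.of (Polynomial (ULift.{u} ℤ))))) := by
    rw [Presieve.isSheafFor_iff_generate]
    refine (GrothendieckTopology.Subcanonical.isSheaf_of_isRepresentable
      (J := Scheme.fppfTopology.{u}) _) _ ?_
    refine Precoverage.generate_mem_toGrothendieck ?_
    refine (Scheme.ofArrows_mem_precoverage_iff _).mpr ⟨fun x => ⟨x, y x, hy x⟩, fun x => ?_⟩
    have h : Etale (Spec.map (Chart.Hom.ring (f x))) :=
      (HasRingHomProperty.Spec_iff (P := @Etale)).mpr (res_etale (f x))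
    exact ⟨inferInstance, inferInstance⟩
  rw [Presieve.isSheafFor_arrows_iff] at key
  obtain ⟨t, ht, htu⟩ := key (fun x => toLine (a x)) (by
    intro i j Z gi gj hij
    have hp := isPullback_SpecMap_pushout (Chart.Hom.ring (f i)) (Chart.Hom.ring (f j))
    change gi ≫ toLine _ = gj ≫ toLine _
    have e1 := congrArg (fun t => t ≫ toLine (a i)) (hp.lift_fst gi gj hij)
    have e2 := congrArg (fun t => t ≫ toLine (a j)) (hp.lift_snd gi gj hij)
    rw [← e1, ← e2, Category.assoc, Category.assoc, specMap_toLine, specMap_toLine]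
    exact congrArg (fun z => hp.lift gi gj hij ≫ toLine z) (ha i j))
  obtain ⟨b, rfl⟩ := toLine_surjective t
  refine ⟨b, fun x => ?_, fun b' hb' => ?_⟩
  · apply toLine_injective
    rw [← ht x]
    exact (specMap_toLine (Chart.Hom.ring (f x)) b).symm
  · apply toLine_injective
    refine htu (toLine b') fun x => ?_
    rw [← hb' x]
    exact specMap_toLine (Chart.Hom.ring (f x)) b'

/-- A function is determined by its restrictions to a covering. -/
lemma IsCovering.ext {U : Chart C} {J : Sieve U} (hJ : IsCovering J) {b b' : U.A}
    (h : ∀ (V : Chart C) (f : V ⟶ U), J f → res f b = res f b') : b = b' := by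
  choose V f hf hy using hJ
  refine (existsUnique_glue_family V f hy (fun x => res (f x) b') fun x y => ?_).unique
    (fun x => h _ _ (hf x)) (fun x => rfl)
  rw [← res_comp, ← res_comp, fibreProduct.condition]

lemma IsCovering.pullback {U W : Chart C} {J : Sieve U} (hJ : IsCovering J) (h : W ⟶ U) :
    IsCovering (J.pullback h) := by
  intro w
  obtain ⟨V, f, hf, y, hy⟩ := hJ (PrimeSpectrum.comap (res h) w)
  refine ⟨fibreProduct h f, fibreProduct.fst h f, ?_, ?_⟩
  · change J (fibreProduct.fst h f ≫ h)
    rw [fibreProduct.condition]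
    exact J.downward_closed hf _
  · have hp := isPullback_SpecMap_pushout (Chart.Hom.ring h) (Chart.Hom.ring f)
    obtain ⟨z, hz, -⟩ := Scheme.Pullback.exists_preimage_pullback
      (f := Spec.map (Chart.Hom.ring h)) (g := Spec.map (Chart.Hom.ring f)) w y hy.symm
    refine ⟨hp.isoPullback.inv z, ?_⟩
    change Spec.map (pushout.inl (Chart.Hom.ring h) (Chart.Hom.ring f)) _ = w
    rw [← hz, ← Scheme.Hom.comp_apply, hp.isoPullback_inv_fst]

/-- Functions on the charts form a sheaf for the étale topology. -/
lemma IsCovering.exists_glue {U : Chart C} {J : Sieve U} (hJ : IsCovering J)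
    (a : ∀ (V : Chart C) (f : V ⟶ U), J f → V.A)
    (ha : ∀ (V W : Chart C) (f : V ⟶ U) (g : W ⟶ V) (hf : J f),
      res g (a V f hf) = a W (g ≫ f) (J.downward_closed hf g)) :
    ∃ b : U.A, ∀ (V : Chart C) (f : V ⟶ U) (hf : J f), res f b = a V f hf := by
  have hJ' := hJ
  choose V f hf hy using hJ'
  have hcongr : ∀ {W : Chart C} {p q : W ⟶ U} (h : p = q) (hp : J p) (hq : J q),
      a W p hp = a W q hq := by rintro W p q rfl _ _; rfl
  have hmatch : ∀ (V W : Chart C) (p : V ⟶ U) (q : W ⟶ U) (hp : J p) (hq : J q),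
      res (fibreProduct.fst p q) (a V p hp) = res (fibreProduct.snd p q) (a W q hq) := by
    intro V W p q hp hq
    rw [ha, ha]
    exact hcongr (fibreProduct.condition p q) _ _
  -- the family `V` may be smaller than `J`; its restriction along `h` still covers `W`
  obtain ⟨b, hb, -⟩ := existsUnique_glue_family V f hy (fun x => a (V x) (f x) (hf x))
    (fun x y => hmatch _ _ _ _ _ _)
  refine ⟨b, fun W h hh => ?_⟩
  have hK : IsCovering ((Sieve.generate (Presieve.ofArrows V f)).pullback h) := by
    refine IsCovering.pullback (fun x => ?_) h
    obtain ⟨y, hy⟩ := hy x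
    exact ⟨V x, f x, Sieve.le_generate _ _ _ ⟨x⟩, y, hy⟩
  refine hK.ext fun X p hp => ?_
  obtain ⟨Y, q, r, ⟨x⟩, hq⟩ := hp
  rw [← res_comp, ← hq, res_comp, hb x, ha, ha]
  exact hcongr hq _ _

/-- A function that is invertible on a covering is invertible. -/
lemma IsCovering.isUnit {U : Chart C} {J : Sieve U} (hJ : IsCovering J) {a : U.A}
    (h : ∀ (V : Chart C) (f : V ⟶ U), J f → IsUnit (res f a)) : IsUnit a := by
  by_contra ha
  obtain ⟨m, hm, ham⟩ := exists_max_ideal_of_mem_nonunits ha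
  obtain ⟨V, f, hf, y, hy⟩ := hJ ⟨m, hm.isPrime⟩
  have h1 : res f a ∈ y.asIdeal := by
    have h2 : a ∈ (PrimeSpectrum.comap (res f) y).asIdeal := by rw [hy]; exact ham
    exact h2
  exact y.isPrime.ne_top (Ideal.eq_top_of_isUnit_mem _ h1 (h V f hf))

lemma isCovering_top (U : Chart C) : IsCovering (⊤ : Sieve U) :=
  fun x => ⟨U, 𝟙 U, trivial, x, by ext; rfl⟩

lemma Chart.isUnit_two (h2 : IsUnit (2 : R)) (U : Chart C) : IsUnit (2 : U.A) := by
  have h := h2.map ((algebraMap U.k U.A).comp (Spec.preimage (U.toS ≫ S.base)).hom)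
  rwa [map_ofNat] at h

end Gluing

/-! ### Differential operators on a chart -/

section Operators

variable {R : Type u} [CommRing R] {S : EtaleGroupoid R} {C : RelCurve S} {U : Chart C}

lemma vec_mul_fn (ξ : T U) (a : U.A) : vec ξ * fn a = fn a * vec ξ + fn (ξ.toDer a) := by
  rw [← vec_leibniz]; abel

lemma IsDualTo.vec_eq {ξ : T U} {x : U.A} (h : IsDualTo ξ x) (η : T U) :
    vec η = fn (η.toDer x) * vec ξ := by
  rw [fn_mul_vec, ← h.eq_smul]

lemma endMul_apply {M : Type*} [AddCommGroup M] (e f : AddMonoid.End M) (m : M) :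
    (e * f) m = e (f m) := rfl

lemma endAdd_apply {M : Type*} [AddCommGroup M] (e f : AddMonoid.End M) (m : M) :
    (e + f) m = e m + f m := rfl

lemma endSub_apply {M : Type*} [AddCommGroup M] (e f : AddMonoid.End M) (m : M) :
    (e - f) m = e m - f m := rfl

/-- A module over the functions with an additive operator satisfying the Leibniz rule for a
coordinate vector field is a module over the ring of differential operators: on a curve there is
no integrability condition. -/
lemma IsDualTo.exists_action {ξ : T U} {x : U.A} (h : IsDualTo ξ x) {M : Type*} [AddCommGroup M]
    [Module U.A M] (D : M →+ M)
    (hD : ∀ (a : U.A) (m : M), D (a • m) = a • D m + ξ.toDer a • m) :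
    ∃ φ : DOp U →+* AddMonoid.End M, (∀ a m, φ (fn a) m = a • m) ∧ ∀ m, φ (vec ξ) m = D m := by
  let sm : U.A →+* AddMonoid.End M := Module.toAddMonoidEnd U.A M
  have hsm : ∀ a m, sm a m = a • m := fun a m => rfl
  let E : AddMonoid.End M := D
  have hE : ∀ m, E m = D m := fun m => rfl
  let F : FreeAlgebra ℤ (U.A ⊕ T U) →ₐ[ℤ] AddMonoid.End M :=
    FreeAlgebra.lift ℤ (Sum.elim (fun a => sm a) (fun η => sm (η.toDer x) * E))
  have F1 : ∀ a, F (FreeAlgebra.ι ℤ (Sum.inl a)) = sm a := fun a => by simp [F]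
  have F2 : ∀ η, F (FreeAlgebra.ι ℤ (Sum.inr η)) = sm (η.toDer x) * E := fun η => by simp [F]
  have hF : ∀ ⦃p q⦄, DRel U p q → (F : _ →+* AddMonoid.End M) p = (F : _ →+* _) q := by
    intro p q hpq
    change F p = F q
    induction hpq with
    | one => rw [F1, map_one, map_one]
    | add a b => rw [map_add, F1, F1, F1, map_add]
    | mul a b => rw [map_mul, F1, F1, F1, map_mul]
    | add_vec η ζ => rw [map_add, F2, F2, F2, toDer_add, map_add, add_mul]
    | smul_vec a η => rw [map_mul, F1, F2, F2, toDer_smul, map_mul, mul_assoc]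
    | bracket η ζ =>
      rw [map_sub, map_mul, map_mul, F2, F2, F2]
      ext m
      have e : (⁅η, ζ⁆ : T U).toDer x
          = η.toDer x * ξ.toDer (ζ.toDer x) - ζ.toDer x * ξ.toDer (η.toDer x) := by
        have e0 : (⁅η, ζ⁆ : T U).toDer x = η.toDer (ζ.toDer x) - ζ.toDer (η.toDer x) :=
          Derivation.commutator_apply (D1 := η.1 U (𝟙 U)) (D2 := ζ.1 U (𝟙 U)) x
        rw [e0]
        conv_lhs => rw [h.eq_smul η, h.eq_smul ζ]
        simp only [toDer_smul, h.2, mul_one]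
      rw [e]
      simp only [endSub_apply, endMul_apply, hsm, hE, hD]
      module
    | leibniz η a =>
      rw [map_sub, map_mul, map_mul, F1, F1, F2]
      ext m
      have e : η.toDer a = η.toDer x * ξ.toDer a := by
        conv_lhs => rw [h.eq_smul η, toDer_smul]
      rw [e]
      simp only [endSub_apply, endMul_apply, hsm, hE, hD]
      module
  refine ⟨RingQuot.lift ⟨(F : _ →+* AddMonoid.End M), hF⟩, fun a m => ?_, fun m => ?_⟩
  · have : RingQuot.lift ⟨(F : _ →+* AddMonoid.End M), hF⟩ (fn a) = sm a :=
      (RingQuot.lift_mkRingHom_apply _ _ _).trans (F1 a)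
    exact congrArg (fun e : AddMonoid.End M => e m) this
  · have : RingQuot.lift ⟨(F : _ →+* AddMonoid.End M), hF⟩ (vec ξ) = sm (ξ.toDer x) * E :=
      (RingQuot.lift_mkRingHom_apply _ _ _).trans (F2 ξ)
    rw [h.2, map_one, one_mul] at this
    exact congrArg (fun e : AddMonoid.End M => e m) this

/-- The operators `1, ∂, ∂²` are linearly independent over the functions. -/
lemma IsDualTo.coeff_eq_zero {ξ : T U} {x : U.A} (h : IsDualTo ξ x) {a b c : U.A}
    (h0 : fn a + fn b * vec ξ + fn c * (vec ξ * vec ξ) = 0) : a = 0 ∧ b = 0 ∧ c = 0 := by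
  -- the action of `∂ + t` on `A[t] / t³`
  let D : U.A × U.A × U.A →+ U.A × U.A × U.A :=
    { toFun := fun p => (ξ.toDer p.1, ξ.toDer p.2.1 + p.1, ξ.toDer p.2.2 + p.2.1)
      map_zero' := by simp
      map_add' := fun p q => by
        ext <;> simp
        · abel
        · abel }
  obtain ⟨φ, hφ, hφ'⟩ := h.exists_action D (fun a m => by
    ext <;> simp [D, Derivation.leibniz] <;> ring)
  -- the operators `1, ∂, ∂²` send `1` to `1, t, t²`
  have h1 := congrArg (fun P => φ P (1, 0, 0)) h0
  simp only [map_add, map_mul, map_zero, endAdd_apply, endMul_apply, hφ,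
    hφ'] at h1
  simpa [D, Prod.ext_iff] using h1

lemma IsDualTo.coeff_eq {ξ : T U} {x : U.A} (h : IsDualTo ξ x) {a b c a' b' c' : U.A}
    (h0 : fn a + fn b * vec ξ + fn c * (vec ξ * vec ξ)
      = fn a' + fn b' * vec ξ + fn c' * (vec ξ * vec ξ)) : a = a' ∧ b = b' ∧ c = c' := by
  have h1 : fn (a - a') + fn (b - b') * vec ξ + fn (c - c') * (vec ξ * vec ξ) = 0 := by
    simp only [map_sub, sub_mul]
    rw [← sub_eq_zero] at h0
    rw [← h0]; abel
  obtain ⟨ha, hb, hc⟩ := h.coeff_eq_zero h1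
  exact ⟨sub_eq_zero.mp ha, sub_eq_zero.mp hb, sub_eq_zero.mp hc⟩

lemma IsDualTo.fn_injective {ξ : T U} {x : U.A} (h : IsDualTo ξ x) {a b : U.A}
    (h0 : fn a = fn b) : a = b := by
  refine (h.coeff_eq (b := 0) (c := 0) (b' := 0) (c' := 0) ?_).1
  simp [h0]

lemma fn_mem_order (a : U.A) (j : ℕ) : fn a ∈ DOp.order U j := by
  have h1 : (1 : DOp U) ∈ DOp.order U j :=
    Submodule.subset_span ⟨[], Nat.zero_le _, by simp⟩
  have h2 := Submodule.smul_mem _ a h1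
  rwa [smul_DOp, mul_one] at h2

lemma vec_mem_order (ξ : T U) {j : ℕ} (hj : 1 ≤ j) : vec ξ ∈ DOp.order U j :=
  Submodule.subset_span ⟨[ξ], by simpa using hj, by simp⟩

lemma fn_mul_mem_order (a : U.A) {j : ℕ} {P : DOp U} (hP : P ∈ DOp.order U j) :
    fn a * P ∈ DOp.order U j :=
  Submodule.smul_mem _ a hP

/-- The operators of order at most one are `O ⊕ ∂ O`, with coefficients on the right. -/
lemma IsDualTo.mem_order_one {ξ : T U} {x : U.A} (h : IsDualTo ξ x) {P : DOp U} :
    P ∈ DOp.order U 1 ↔ ∃ a b : U.A, P = fn a + vec ξ * fn b := by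
  constructor
  · intro hP
    suffices hs : ∃ a b : U.A, P = fn a + fn b * vec ξ by
      obtain ⟨a, b, rfl⟩ := hs
      refine ⟨a - ξ.toDer b, b, ?_⟩
      rw [vec_mul_fn, map_sub]; abel
    refine Submodule.span_induction ?_ ?_ ?_ ?_ hP
    · rintro _ ⟨l, hl, rfl⟩
      rcases l with _ | ⟨η, l⟩
      · exact ⟨1, 0, by simp⟩
      · have : l = [] := by
          rw [List.length_cons] at hl
          exact List.eq_nil_of_length_eq_zero (by omega)
        subst this
        refine ⟨0, η.toDer x, ?_⟩
        simpa using h.vec_eq η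
    · exact ⟨0, 0, by simp⟩
    · rintro _ _ _ _ ⟨a, b, rfl⟩ ⟨a', b', rfl⟩
      refine ⟨a + a', b + b', ?_⟩
      simp only [map_add, add_mul]; abel
    · rintro c _ _ ⟨a, b, rfl⟩
      refine ⟨c * a, c * b, ?_⟩
      simp only [smul_DOp, map_mul, mul_add, mul_assoc]
  · rintro ⟨a, b, rfl⟩
    rw [vec_mul_fn]
    exact add_mem (fn_mem_order _ _) (add_mem (fn_mul_mem_order _ (vec_mem_order _ le_rfl))
      (fn_mem_order _ _))

lemma IsDualTo.exists_coeff_of_mem_order_two {ξ : T U} {x : U.A} (h : IsDualTo ξ x) {P : DOp U}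
    (hP : P ∈ DOp.order U 2) :
    ∃ a b c : U.A, P = fn a + fn b * vec ξ + fn c * (vec ξ * vec ξ) := by
  refine Submodule.span_induction ?_ ?_ ?_ ?_ hP
  · rintro _ ⟨l, hl, rfl⟩
    rcases l with _ | ⟨η, _ | ⟨ζ, l⟩⟩
    · exact ⟨1, 0, 0, by simp⟩
    · refine ⟨0, η.toDer x, 0, ?_⟩
      simpa using h.vec_eq η
    · have : l = [] := by
        simp only [List.length_cons] at hl
        exact List.eq_nil_of_length_eq_zero (by omega)
      subst this
      refine ⟨0, η.toDer x * ξ.toDer (ζ.toDer x), η.toDer x * ζ.toDer x, ?_⟩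
      simp only [List.map_cons, List.map_nil, List.prod_cons, List.prod_nil, mul_one, map_zero,
        zero_add]
      rw [h.vec_eq η, h.vec_eq ζ]
      simp only [map_mul, mul_assoc]
      rw [← mul_assoc (vec ξ), vec_mul_fn]
      simp only [add_mul, mul_add, mul_assoc]
      abel
  · exact ⟨0, 0, 0, by simp⟩
  · rintro _ _ _ _ ⟨a, b, c, rfl⟩ ⟨a', b', c', rfl⟩
    refine ⟨a + a', b + b', c + c', ?_⟩
    simp only [map_add, add_mul]; abel
  · rintro d _ _ ⟨a, b, c, rfl⟩
    refine ⟨d * a, d * b, d * c, ?_⟩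
    simp only [smul_DOp, map_mul, mul_add, mul_assoc]

lemma resD_mem_order {V : Chart C} (f : V ⟶ U) {j : ℕ} {P : DOp U} (hP : P ∈ DOp.order U j) :
    resD f P ∈ DOp.order V j := by
  refine Submodule.span_induction ?_ ?_ ?_ ?_ hP
  · rintro _ ⟨l, hl, rfl⟩
    refine Submodule.subset_span ⟨l.map (resT f), by simpa using hl, ?_⟩
    rw [map_list_prod, List.map_map, List.map_map]
    congr 2
    funext ξ
    exact resD_vec f ξ
  · rw [map_zero]
    exact zero_mem _
  · intro P Q _ _ hP hQ
    rw [map_add]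
    exact add_mem hP hQ
  · intro a P _ hP
    rw [smul_DOp, map_mul, resD_fn]
    exact fn_mul_mem_order _ hP

lemma mul_fn_mem_order_two {P : DOp U} (hP : P ∈ DOp.order U 2) (d : U.A) :
    P * fn d ∈ DOp.order U 2 := by
  obtain ⟨x, ξ, h⟩ := U.exists_dual
  obtain ⟨a, b, c, rfl⟩ := h.exists_coeff_of_mem_order_two hP
  have hv : vec ξ * vec ξ ∈ DOp.order U 2 := Submodule.subset_span ⟨[ξ, ξ], le_rfl, by simp⟩
  have h1 : vec ξ ∈ DOp.order U 2 := vec_mem_order _ (by norm_num)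
  have h3 : ∀ e : U.A, vec ξ * fn e ∈ DOp.order U 2 := fun e => by
    rw [vec_mul_fn]
    exact add_mem (fn_mul_mem_order _ h1) (fn_mem_order _ _)
  have h4 : vec ξ * vec ξ * (fn d : DOp U) ∈ DOp.order U 2 := by
    rw [mul_assoc, vec_mul_fn, mul_add, ← mul_assoc, vec_mul_fn, add_mul, mul_assoc]
    exact add_mem (add_mem (fn_mul_mem_order _ hv) (fn_mul_mem_order _ h1)) (h3 _)
  rw [add_mul, add_mul, mul_assoc, mul_assoc, ← map_mul]
  exact add_mem (add_mem (fn_mem_order _ _) (fn_mul_mem_order _ (h3 _))) (fn_mul_mem_order _ h4)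

/-- Operators of order at most two are determined by their restrictions to a covering. -/
lemma IsCovering.ext_order_two {J : Sieve U} (hJ : IsCovering J) {P Q : DOp U}
    (hP : P ∈ DOp.order U 2) (hQ : Q ∈ DOp.order U 2)
    (h : ∀ (V : Chart C) (f : V ⟶ U), J f → resD f P = resD f Q) : P = Q := by
  obtain ⟨x, ξ, hξ⟩ := U.exists_dual
  obtain ⟨a, b, c, rfl⟩ := hξ.exists_coeff_of_mem_order_two hP
  obtain ⟨a', b', c', rfl⟩ := hξ.exists_coeff_of_mem_order_two hQ
  have key := fun (V : Chart C) (f : V ⟶ U) (hf : J f) =>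
    (hξ.restrict f).coeff_eq (by simpa using h V f hf)
  rw [hJ.ext fun V f hf => (key V f hf).1, hJ.ext fun V f hf => (key V f hf).2.1,
    hJ.ext fun V f hf => (key V f hf).2.2]

/-- Operators of order at most two glue. -/
lemma IsCovering.exists_glue_order_two {J : Sieve U} (hJ : IsCovering J)
    (P : ∀ (V : Chart C) (f : V ⟶ U), J f → DOp V)
    (h2 : ∀ V f hf, P V f hf ∈ DOp.order V 2)
    (hP : ∀ (V W : Chart C) (f : V ⟶ U) (g : W ⟶ V) (hf : J f),
      resD g (P V f hf) = P W (g ≫ f) (J.downward_closed hf g)) :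
    ∃ Q ∈ DOp.order U 2, ∀ (V : Chart C) (f : V ⟶ U) (hf : J f), resD f Q = P V f hf := by
  obtain ⟨x, ξ, hξ⟩ := U.exists_dual
  choose a b c habc using fun V f hf =>
    (hξ.restrict f).exists_coeff_of_mem_order_two (h2 V f hf)
  have key := fun (V W : Chart C) (f : V ⟶ U) (g : W ⟶ V) (hf : J f) =>
    (hξ.restrict (g ≫ f)).coeff_eq (a := res g (a V f hf)) (b := res g (b V f hf))
      (c := res g (c V f hf)) (by
        rw [← habc, ← hP V W f g hf, habc V f hf, resT_comp]; simp)
  obtain ⟨a₀, ha₀⟩ := hJ.exists_glue a (fun V W f g hf => (key V W f g hf).1)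
  obtain ⟨b₀, hb₀⟩ := hJ.exists_glue b (fun V W f g hf => (key V W f g hf).2.1)
  obtain ⟨c₀, hc₀⟩ := hJ.exists_glue c (fun V W f g hf => (key V W f g hf).2.2)
  refine ⟨fn a₀ + fn b₀ * vec ξ + fn c₀ * (vec ξ * vec ξ), ?_, fun V f hf => ?_⟩
  · refine add_mem (add_mem (fn_mem_order _ _) (fn_mul_mem_order _ (vec_mem_order _ ?_)))
      (fn_mul_mem_order _ (Submodule.subset_span ⟨[ξ, ξ], le_rfl, by simp⟩))
    norm_num
  · rw [habc V f hf]
    simp [ha₀ V f hf, hb₀ V f hf, hc₀ V f hf]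

end Operators

/-! ### Upper triangular matrices and the canonical torsor -/

section Half

/-- `1/2`, for a ring in which `2` is invertible (junk otherwise). -/
def half (A : Type u) [CommRing A] : A := Ring.inverse 2

variable {A : Type u} [CommRing A]

lemma half_add_half (h : IsUnit (2 : A)) : half A + half A = 1 := by
  rw [← two_mul]; exact Ring.mul_inverse_cancel _ h

lemma two_mul_half (h : IsUnit (2 : A)) : 2 * half A = 1 := Ring.mul_inverse_cancel _ h

lemma map_half {B : Type u} [CommRing B] (φ : A →+* B) (h : IsUnit (2 : A)) :
    φ (half A) = half B := by
  have h' : IsUnit (2 : B) := by rw [← map_ofNat φ 2]; exact h.map φ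
  refine h'.mul_left_cancel ?_
  rw [two_mul_half h']
  have := congrArg φ (two_mul_half h)
  rwa [map_mul, map_ofNat, map_one] at this

lemma der_half {k : Type u} [CommRing k] [Algebra k A] (h : IsUnit (2 : A))
    (δ : Derivation k A A) : δ (half A) = 0 := by
  refine h.mul_left_cancel ?_
  have := congrArg δ (two_mul_half h)
  rw [Derivation.leibniz, Derivation.map_one_eq_zero] at this
  have h2 : δ 2 = 0 := by
    rw [← one_add_one_eq_two, map_add, Derivation.map_one_eq_zero, add_zero]
  simpa [h2] using this

end Half

section UpperTriangular

variable {A : Type u} [CommRing A]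

/-- The upper triangular matrix with diagonal `(1, v)` and upper right entry `β`. -/
def utOf (β : A) (v : Aˣ) : UT A :=
  ⟨⟨!![1, β; 0, v], !![1, -(β * ↑v⁻¹); 0, ↑v⁻¹],
    by ext i j; fin_cases i <;> fin_cases j <;> simp [Matrix.mul_apply, Fin.sum_univ_two],
    by ext i j; fin_cases i <;> fin_cases j <;> simp [Matrix.mul_apply, Fin.sum_univ_two]⟩, rfl⟩

lemma utOf_val (β : A) (v : Aˣ) : (utOf β v).1.1 = !![1, β; 0, (v : A)] := rfl

lemma utOf_inv (β : A) (v : Aˣ) :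
    ((utOf β v).1⁻¹).1 = !![1, -(β * ↑v⁻¹); 0, (↑v⁻¹ : A)] := rfl

/-- Modulo scalars, every upper triangular matrix has upper left entry `1`. -/
lemma UT.exists_eq_mul_scalar (b : UT A) : ∃ (β : A) (v : Aˣ) (z : UT A) (c : A),
    z.1.1 = c • (1 : Matrix (Fin 2) (Fin 2) A) ∧ b = utOf β v * z := by
  obtain ⟨h10, h00, h11⟩ := utEntries b
  obtain ⟨d, hd⟩ := h11
  let e : Aˣ := ⟨b.1.1 0 0, (b⁻¹).1.1 0 0, h00, by rw [mul_comm]; exact h00⟩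
  let z : UT A := ⟨⟨(e : A) • 1, (↑e⁻¹ : A) • 1, by simp [smul_smul], by simp [smul_smul]⟩, by
    change ((e : A) • (1 : Matrix (Fin 2) (Fin 2) A)) 1 0 = 0
    simp⟩
  refine ⟨b.1.1 0 1 * ↑e⁻¹, d * e⁻¹, z, e, rfl, ?_⟩
  apply Subtype.ext
  apply Units.ext
  change b.1.1 = (utOf _ _).1.1 * ((e : A) • 1)
  rw [utOf_val]
  have he : (e : A) = b.1.1 0 0 := rfl
  ext i j
  fin_cases i <;> fin_cases j <;>
    simp [he.symm, h10, hd.symm, mul_left_comm (e : A)]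

end UpperTriangular

section CanonicalTorsor

variable {R : Type u} [CommRing R] {S : EtaleGroupoid R} {C : RelCurve S} {U : Chart C}

lemma BPresheaf.IsTorsor.exists_utOf {P : BPresheaf C} (hP : P.IsTorsor) (p q : P.obj U) :
    ∃ (β : U.A) (v : U.Aˣ), P.act p (utOf β v) = q := by
  obtain ⟨b, rfl⟩ := hP.transitive U p q
  obtain ⟨β, v, z, c, hz, rfl⟩ := UT.exists_eq_mul_scalar b
  exact ⟨β, v, by rw [P.act_mul, P.act_scalar _ z c hz]⟩

lemma IsDualTo.coeff_eq_right {ξ : T U} {x : U.A} (h : IsDualTo ξ x) {a b a' b' : U.A}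
    (h0 : fn a + vec ξ * fn b = fn a' + vec ξ * fn b') : a = a' ∧ b = b' := by
  obtain ⟨h1, h2, -⟩ := h.coeff_eq (a := a + ξ.toDer b) (b := b) (c := 0)
    (a' := a' + ξ.toDer b') (b' := b') (c' := 0) (by
      rw [vec_mul_fn, vec_mul_fn] at h0
      simp only [map_add, map_zero, zero_mul, add_zero]
      rw [add_assoc, add_comm (fn (ξ.toDer b)), h0]
      abel)
  subst h2
  exact ⟨add_right_cancel h1, rfl⟩

lemma IsDualTo.isFrame_vec {ξ : T U} {x : U.A} (h : IsDualTo ξ x) : IsFrame (vec ξ) :=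
  ⟨fun _ => h.mem_order_one, fun a b h0 =>
    h.coeff_eq_right (a' := 0) (b' := 0) (by simpa using h0)⟩

lemma IsFrame.coeff_eq {w : DOp U} (hw : IsFrame w) {a b a' b' : U.A}
    (h0 : fn a + w * fn b = fn a' + w * fn b') : a = a' ∧ b = b' := by
  have h1 : fn (a - a') + w * fn (b - b') = 0 := by
    simp only [map_sub, mul_sub]
    rw [← sub_eq_zero] at h0
    rw [← h0]; abel
  obtain ⟨h2, h3⟩ := hw.2 _ _ h1
  exact ⟨sub_eq_zero.mp h2, sub_eq_zero.mp h3⟩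

/-- The second vectors of two frames differ by an affine transformation. -/
lemma IsFrame.exists_unit {w w' : DOp U} (hw : IsFrame w) (hw' : IsFrame w') :
    ∃ (a : U.A) (b : U.Aˣ), w' = fn a + w * fn (b : U.A) := by
  obtain ⟨a, b, hab⟩ := (hw.1 w').mp ((hw'.1 w').mpr ⟨0, 1, by simp⟩)
  obtain ⟨c, d, hcd⟩ := (hw'.1 w).mp ((hw.1 w).mpr ⟨0, 1, by simp⟩)
  have h1 : fn 0 + w * fn 1 = fn (c + a * d) + w * fn (b * d) := by
    conv_lhs => rw [map_zero, map_one, mul_one, zero_add, hcd, hab]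
    simp only [map_add, map_mul, add_mul, mul_assoc, add_assoc]
  have h2 : b * d = 1 := (hw.coeff_eq h1).2.symm
  exact ⟨a, ⟨b, d, h2, by rw [mul_comm]; exact h2⟩, hab⟩

lemma IsFrame.of_unit {w : DOp U} (hw : IsFrame w) (a : U.A) {b : U.A} (hb : IsUnit b) :
    IsFrame (fn a + w * fn b) := by
  have := hw.act (c := a) hb isUnit_one
  rwa [map_one, mul_one] at this

/-- The section of the canonical torsor given by the frame `(1, a + ∂ b)`. -/
def canonicalMk {ξ : T U} {x : U.A} (h : IsDualTo ξ x) (a : U.A) {b : U.A} (hb : IsUnit b) :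
    (canonicalTorsor C).obj U :=
  ⟨fn a + vec ξ * fn b, fun V f => by
    simp only [map_add, map_mul, resD_fn, resD_vec]
    exact (h.restrict f).isFrame_vec.of_unit _ (hb.map _)⟩

lemma canonicalTorsor_act_utOf (w : (canonicalTorsor C).obj U) (β : U.A) (v : U.Aˣ) :
    ((canonicalTorsor C).act w (utOf β v)).1 = fn β + w.1 * fn (v : U.A) := by
  change (fn ((utOf β v).1.1 0 1) + w.1 * fn ((utOf β v).1.1 1 1))
    * fn (((utOf β v).1⁻¹).1 0 0) = _
  rw [utOf_inv, utOf_val]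
  simp

lemma isFrame_of_obj (w : (canonicalTorsor C).obj U) : IsFrame w.1 := by
  have := w.2 U (𝟙 U)
  rwa [resD_id] at this

/-- The canonical torsor is a sheaf: with respect to a fixed `∂`, its sections are pairs of a
function and an invertible function. -/
lemma canonicalTorsor_isSheafFor (J : Sieve U) (hJ : IsCovering J) :
    Presieve.IsSheafFor (canonicalTorsor C).functor J.arrows := by
  obtain ⟨x, ξ, hξ⟩ := U.exists_dual
  intro w hw
  have hw' : ∀ (V W : Chart C) (f : V ⟶ U) (g : W ⟶ V) (hf : J f),
      resD g (w f hf).1 = (w (g ≫ f) (J.downward_closed hf g)).1 := by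
    intro V W f g hf
    have := hw g (𝟙 W) hf (J.downward_closed hf g) (by simp)
    have h1 := congrArg Subtype.val this
    refine h1.trans ?_
    exact resD_id _ _
  choose a b hab using fun (V : Chart C) (f : V ⟶ U) (hf : J f) =>
    (hξ.restrict f).isFrame_vec.exists_unit (isFrame_of_obj (w f hf))
  have key := fun (V W : Chart C) (f : V ⟶ U) (g : W ⟶ V) (hf : J f) =>
    (hξ.restrict (g ≫ f)).coeff_eq_right (a := res g (a V f hf)) (b := res g (b V f hf)) (by
        rw [← hab, ← hw' V W f g hf, hab V f hf, resT_comp]; simp)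
  obtain ⟨a₀, ha₀⟩ := hJ.exists_glue a (fun V W f g hf => (key V W f g hf).1)
  obtain ⟨b₀, hb₀⟩ := hJ.exists_glue (fun V f hf => (b V f hf : V.A))
    (fun V W f g hf => (key V W f g hf).2)
  have hu : IsUnit b₀ := hJ.isUnit fun V f hf => by
    rw [hb₀ V f hf]; exact (b V f hf).isUnit
  refine ⟨canonicalMk hξ a₀ hu, fun V f hf => Subtype.ext ?_, fun w' hw'' => Subtype.ext ?_⟩
  · change resD f (fn a₀ + vec ξ * fn b₀) = _
    rw [hab V f hf]
    simp [ha₀ V f hf, hb₀ V f hf]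
  · change w'.1 = fn a₀ + vec ξ * fn b₀
    obtain ⟨a₁, b₁, h₁⟩ := hξ.isFrame_vec.exists_unit (isFrame_of_obj w')
    have key' := fun (V : Chart C) (f : V ⟶ U) (hf : J f) => (hξ.restrict f).coeff_eq_right
      (a := res f a₁) (b := res f b₁) (a' := res f a₀) (b' := res f b₀) (by
        have h2 : resD f w'.1 = (w f hf).1 := congrArg Subtype.val (hw'' f hf)
        rw [ha₀ V f hf, hb₀ V f hf, ← hab V f hf, ← h2, h₁]
        simp)
    rw [h₁, hJ.ext fun V f hf => (key' V f hf).1, hJ.ext fun V f hf => (key' V f hf).2]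

lemma canonicalTorsor_isTorsor : (canonicalTorsor C).IsTorsor where
  sheaf U J hJ := canonicalTorsor_isSheafFor J hJ
  locally_nonempty U := by
    refine ⟨⊤, isCovering_top U, fun V f _ => ?_⟩
    obtain ⟨x, ξ, hξ⟩ := V.exists_dual
    exact ⟨canonicalMk hξ 0 isUnit_one⟩
  transitive U p q := by
    obtain ⟨a, b, hab⟩ := (isFrame_of_obj p).exists_unit (isFrame_of_obj q)
    exact ⟨utOf a b, Subtype.ext ((canonicalTorsor_act_utOf p a b).trans hab.symm)⟩
  free U p b hb := by
    obtain ⟨β, v, z, c, hz, rfl⟩ := UT.exists_eq_mul_scalar b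
    rw [BPresheaf.act_mul, BPresheaf.act_scalar _ _ z c hz] at hb
    have h1 := congrArg Subtype.val hb
    rw [canonicalTorsor_act_utOf] at h1
    obtain ⟨h2, h3⟩ := (isFrame_of_obj p).coeff_eq (a' := 0) (b' := 1)
      (h1.trans (by simp))
    refine ⟨c, ?_⟩
    change (utOf β v).1.1 * z.1.1 = _
    rw [hz, utOf_val, h2, h3, ← Matrix.one_fin_two, one_mul]

/-- The section `(1, ½ ∂)` of the canonical torsor. -/
def halfSection (h2 : IsUnit (2 : R)) {ξ : T U} {x : U.A} (h : IsDualTo ξ x) :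
    (canonicalTorsor C).obj U :=
  canonicalMk h 0 (b := half U.A)
    (IsUnit.of_mul_eq_one 2 (by rw [mul_comm]; exact two_mul_half (U.isUnit_two h2)))

lemma halfSection_add (h2 : IsUnit (2 : R)) {ξ : T U} {x : U.A} (h : IsDualTo ξ x) :
    (halfSection h2 h).1 + (halfSection h2 h).1 = vec ξ := by
  change fn 0 + vec ξ * fn (half U.A) + (fn 0 + vec ξ * fn (half U.A)) = vec ξ
  rw [map_zero, zero_add, ← mul_add, ← map_add, half_add_half (U.isUnit_two h2), map_one, mul_one]

lemma eq_of_add_self_eq (h2 : IsUnit (2 : R)) {w w' : DOp U} (h : w + w = w' + w') : w = w' := by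
  have key : ∀ v : DOp U, fn (half U.A) * (v + v) = v := by
    intro v
    rw [mul_add, ← add_mul, ← map_add, half_add_half (U.isUnit_two h2), map_one, one_mul]
  rw [← key w, h, key]

lemma eq_halfSection (h2 : IsUnit (2 : R)) {ξ : T U} {x : U.A} (h : IsDualTo ξ x)
    {w : (canonicalTorsor C).obj U} (hw : w.1 + w.1 = vec ξ) : w = halfSection h2 h :=
  Subtype.ext (eq_of_add_self_eq h2 (hw.trans (halfSection_add h2 h).symm))

end CanonicalTorsor

/-! ### Gauge transformations and the Atiyah algebroid -/

section Gauge

variable {k A : Type u} [CommRing k] [CommRing A] [Algebra k A]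

/-- The trace free part of a `2 × 2` matrix. -/
def traceFree (N : Matrix (Fin 2) (Fin 2) A) : Matrix (Fin 2) (Fin 2) A :=
  N - (half A * N.trace) • 1

/-- The gauge transform `h⁻¹ M h + h⁻¹ δ(h)`. -/
def gaugeGL (δ : Derivation k A A) (M : Matrix (Fin 2) (Fin 2) A) (h : GL (Fin 2) A) :
    Matrix (Fin 2) (Fin 2) A :=
  (h⁻¹).1 * M * h.1 + (h⁻¹).1 * h.1.map δ

/-- The gauge transform in `𝔤𝔩₂ / scalars`, represented by trace free matrices. -/
def gauge (δ : Derivation k A A) (M : Matrix (Fin 2) (Fin 2) A) (h : GL (Fin 2) A) :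
    Matrix (Fin 2) (Fin 2) A :=
  traceFree (gaugeGL δ M h)

lemma trace_traceFree (h2 : IsUnit (2 : A)) (N : Matrix (Fin 2) (Fin 2) A) :
    (traceFree N).trace = 0 := by
  simp only [traceFree, Matrix.trace_sub, Matrix.trace_smul, Matrix.trace_one, Fintype.card_fin,
    smul_eq_mul, Nat.cast_ofNat]
  linear_combination (- N.trace) * two_mul_half h2

lemma traceFree_of_trace {N : Matrix (Fin 2) (Fin 2) A} (h : N.trace = 0) : traceFree N = N := by
  simp [traceFree, h]

lemma traceFree_add_smul (h2 : IsUnit (2 : A)) (N : Matrix (Fin 2) (Fin 2) A) (c : A) :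
    traceFree (N + c • 1) = traceFree N := by
  have e : half A * (N + c • (1 : Matrix (Fin 2) (Fin 2) A)).trace = half A * N.trace + c := by
    simp only [Matrix.trace_add, Matrix.trace_smul, Matrix.trace_one, Fintype.card_fin,
      smul_eq_mul, Nat.cast_ofNat]
    linear_combination c * two_mul_half h2
  rw [traceFree, traceFree, e, add_smul]
  abel

lemma map_der_mul (δ : Derivation k A A) (M N : Matrix (Fin 2) (Fin 2) A) :
    (M * N).map δ = M.map δ * N + M * N.map δ := by
  ext i j
  simp [Matrix.mul_apply, Fin.sum_univ_two, Derivation.leibniz]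
  ring

lemma gaugeGL_mul (δ : Derivation k A A) (M : Matrix (Fin 2) (Fin 2) A) (g h : GL (Fin 2) A) :
    gaugeGL δ (gaugeGL δ M g) h = gaugeGL δ M (g * h) := by
  have e : ∀ N : Matrix (Fin 2) (Fin 2) A, (g⁻¹).1 * (g.1 * N) = N := fun N => by
    rw [← mul_assoc, Units.inv_mul, one_mul]
  simp only [gaugeGL, mul_inv_rev, Units.val_mul, map_der_mul, mul_add, add_mul, mul_assoc, e]
  abel

lemma gaugeGL_add_smul (δ : Derivation k A A) (M : Matrix (Fin 2) (Fin 2) A) (c : A)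
    (h : GL (Fin 2) A) : gaugeGL δ (M + c • 1) h = gaugeGL δ M h + c • 1 := by
  simp only [gaugeGL, mul_add, add_mul, Matrix.mul_smul, Matrix.smul_mul, mul_one, Units.inv_mul]
  abel

lemma gauge_add_smul (h2 : IsUnit (2 : A)) (δ : Derivation k A A) (M : Matrix (Fin 2) (Fin 2) A)
    (c : A) (h : GL (Fin 2) A) : gauge δ (M + c • 1) h = gauge δ M h := by
  rw [gauge, gaugeGL_add_smul, traceFree_add_smul h2, gauge]

lemma gauge_traceFree (h2 : IsUnit (2 : A)) (δ : Derivation k A A)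
    (M : Matrix (Fin 2) (Fin 2) A) (h : GL (Fin 2) A) : gauge δ (traceFree M) h = gauge δ M h := by
  rw [traceFree, sub_eq_add_neg, ← neg_smul, gauge_add_smul h2]

/-- Gauge transformations form a right action, also on trace free representatives. -/
lemma gauge_mul (h2 : IsUnit (2 : A)) (δ : Derivation k A A) (M : Matrix (Fin 2) (Fin 2) A)
    (g h : GL (Fin 2) A) : gauge δ (gauge δ M g) h = gauge δ M (g * h) := by
  rw [gauge, gauge, ← gauge, gauge_traceFree h2, gauge, gaugeGL_mul, gauge]

lemma gauge_scalar (h2 : IsUnit (2 : A)) (δ : Derivation k A A) {M : Matrix (Fin 2) (Fin 2) A}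
    (hM : M.trace = 0) {z : GL (Fin 2) A} {c : A}
    (hz : z.1 = c • (1 : Matrix (Fin 2) (Fin 2) A)) : gauge δ M z = M := by
  have h1 : z.1.map δ = δ c • (1 : Matrix (Fin 2) (Fin 2) A) := by
    rw [hz]
    ext i j
    fin_cases i <;> fin_cases j <;> simp
  have h3 : (z⁻¹).1 * M * z.1 = M := by
    have : M * z.1 = z.1 * M := by rw [hz]; simp
    rw [mul_assoc, this, ← mul_assoc, Units.inv_mul, one_mul]
  have h4 : (z⁻¹).1 = (z⁻¹).1 0 0 • (1 : Matrix (Fin 2) (Fin 2) A) := by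
    have h5 : (z⁻¹).1 * z.1 = 1 := Units.inv_mul z
    rw [hz, Matrix.mul_smul, mul_one] at h5
    have h00 := congrFun (congrFun h5 0) 0
    have h01 := congrFun (congrFun h5 0) 1
    have h10 := congrFun (congrFun h5 1) 0
    have h11 := congrFun (congrFun h5 1) 1
    simp only [Matrix.smul_apply, smul_eq_mul, Matrix.one_apply_eq] at h00 h11
    rw [Matrix.smul_apply, smul_eq_mul, Matrix.one_apply_ne (by decide)] at h01 h10
    have hc : IsUnit c := IsUnit.of_mul_eq_one _ h00
    ext i j
    fin_cases i <;> fin_cases j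
    · simp
    · simpa using hc.mul_left_cancel (h01.trans (mul_zero c).symm)
    · simpa using hc.mul_left_cancel (h10.trans (mul_zero c).symm)
    · simpa using hc.mul_left_cancel (h11.trans h00.symm)
  rw [gauge, gaugeGL, h3, h1, h4, Matrix.smul_mul, one_mul, smul_smul, traceFree_add_smul h2,
    traceFree_of_trace hM]

lemma gauge_one (h2 : IsUnit (2 : A)) (δ : Derivation k A A) {M : Matrix (Fin 2) (Fin 2) A}
    (hM : M.trace = 0) : gauge δ M 1 = M :=
  gauge_scalar h2 δ hM (c := 1) (by simp)

lemma gauge_map {k' A' : Type u} [CommRing k'] [CommRing A'] [Algebra k' A'] (ρ : A →+* A')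
    (h2 : IsUnit (2 : A)) (δ : Derivation k A A) (δ' : Derivation k' A' A')
    (h : ∀ a, δ' (ρ a) = ρ (δ a)) (M : Matrix (Fin 2) (Fin 2) A) (g : GL (Fin 2) A) :
    (gauge δ M g).map ρ = gauge δ' (M.map ρ) (Matrix.GeneralLinearGroup.map ρ g) := by
  have e1 : (Matrix.GeneralLinearGroup.map ρ g).1 = g.1.map ρ := rfl
  have e2 : ((Matrix.GeneralLinearGroup.map ρ g)⁻¹).1 = (g⁻¹).1.map ρ := by
    rw [← map_inv]; rfl
  have e3 : (g.1.map ρ).map δ' = (g.1.map δ).map ρ := by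
    ext i j
    simp [h]
  simp only [gauge, gaugeGL, traceFree, e1, e2, e3]
  rw [Matrix.map_sub _ (map_sub ρ), Matrix.map_add _ (map_add ρ), Matrix.map_mul, Matrix.map_mul,
    Matrix.map_mul]
  congr 1
  ext i j
  simp only [Matrix.map_apply, Matrix.smul_apply, smul_eq_mul, map_mul, map_half ρ h2,
    Matrix.trace_fin_two, Matrix.add_apply, map_add, Matrix.one_apply, Matrix.mul_apply,
    Fin.sum_univ_two]
  split_ifs <;> simp

/-- The gauge transform by an upper triangular matrix. -/
lemma gauge_utOf (h2 : IsUnit (2 : A)) (δ : Derivation k A A) (m n c β : A) (v : Aˣ) :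
    gauge δ !![m, n; c, -m] (utOf β v).1 =
      !![m - β * c * ↑v⁻¹ - half A * (↑v⁻¹ * δ v),
          2 * m * β + n * v - β ^ 2 * c * ↑v⁻¹ + δ β - β * ↑v⁻¹ * δ v;
        c * ↑v⁻¹, -(m - β * c * ↑v⁻¹ - half A * (↑v⁻¹ * δ v))] := by
  have h3 : half A * 2 = 1 := by rw [mul_comm]; exact two_mul_half h2
  have hv : (v : A) * ↑v⁻¹ = 1 := v.mul_inv
  have e1 : (!![1, β; 0, (v : A)] : Matrix (Fin 2) (Fin 2) A).map δ = !![0, δ β; 0, δ v] := by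
    ext i j
    fin_cases i <;> fin_cases j <;> simp
  rw [gauge, gaugeGL, utOf_inv, utOf_val, e1]
  simp only [Matrix.mul_fin_two, traceFree, Matrix.trace_fin_two, Matrix.add_apply]
  ext i j
  fin_cases i <;> fin_cases j <;> simp
  · linear_combination (half A * m) * hv
  · linear_combination (β * m) * hv
  · ring
  · linear_combination (-m + half A * m) * hv - (↑v⁻¹ * δ v) * h3

end Gauge

section Atiyah

variable {R : Type u} [CommRing R] {S : EtaleGroupoid R} {C : RelCurve S} {U : Chart C}
  {P : BPresheaf C}

/-- The gauge transform satisfies the compatibility, up to scalars, that is required of the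
sections of the Atiyah algebroid. -/
lemma exists_gauge_eq (δ : Derivation U.k U.A U.A) (M : Matrix (Fin 2) (Fin 2) U.A)
    (g : GL (Fin 2) U.A) : ∃ c : U.A, gauge δ M g = (g⁻¹).1 * M * g.1 + (g⁻¹).1 * derMat δ g.1
      + c • (1 : Matrix (Fin 2) (Fin 2) U.A) :=
  ⟨-(half U.A * (gaugeGL δ M g).trace), by
    rw [neg_smul, ← sub_eq_add_neg, gauge, traceFree]
    rfl⟩

lemma At.trace_mat (t : At P U) {V : Chart C} (f : V ⟶ U) (p : P.obj V) :
    (t.mat f p).trace = 0 :=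
  t.2.1 V f p 1

lemma At.mat_map (t : At P U) {V W : Chart C} (f : V ⟶ U) (h : W ⟶ V) (p : P.obj V) :
    t.mat (h ≫ f) (P.map h p) = (t.mat f p).map (res h) := by
  have := t.2.2.1 V W f h p 1
  rwa [map_one] at this

lemma At.mat_resAt {V W : Chart C} (f : V ⟶ U) (t : At P U) (g : W ⟶ V) (p : P.obj W) :
    (resAt f t).mat g p = t.mat (g ≫ f) p := rfl

lemma At.mat_resAt_id {V : Chart C} (f : V ⟶ U) (t : At P U) (p : P.obj V) :
    (resAt f t).mat (𝟙 V) p = t.mat f p := by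
  rw [At.mat_resAt, Category.id_comp]

lemma At.mat_smul (a : U.A) (t : At P U) {V : Chart C} (f : V ⟶ U) (p : P.obj V) :
    (a • t).mat f p = res f a • t.mat f p := rfl

lemma At.mat_sub (s t : At P U) {V : Chart C} (f : V ⟶ U) (p : P.obj V) :
    (s - t).mat f p = s.mat f p - t.mat f p := by
  change (s - t).1.2 V f p 1 = s.1.2 V f p 1 - t.1.2 V f p 1
  rw [AddSubgroup.coe_sub]
  rfl

/-- A section of the Atiyah algebroid is determined by its matrices in the frames of `P`. -/
lemma At.eq_gauge (h2 : IsUnit (2 : R)) (t : At P U) {V : Chart C} (f : V ⟶ U) (p : P.obj V)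
    (g : GL (Fin 2) V.A) : t.1.2 V f p g = gauge (t.1.1.1 V f) (t.mat f p) g := by
  obtain ⟨c, hc⟩ := t.2.2.2.2 V f p 1 g
  rw [one_mul] at hc
  have h3 : traceFree (t.1.2 V f p g) = t.1.2 V f p g := traceFree_of_trace (t.2.1 V f p g)
  rw [← h3, hc, traceFree_add_smul (V.isUnit_two h2)]
  rfl

lemma At.mat_act (h2 : IsUnit (2 : R)) (t : At P U) {V : Chart C} (f : V ⟶ U) (p : P.obj V)
    (b : UT V.A) : t.mat f (P.act p b) = gauge (t.1.1.1 V f) (t.mat f p) b.1 := by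
  have := t.2.2.2.1 V f p b 1
  rw [mul_one] at this
  rw [← At.eq_gauge h2]
  exact this

/-- A single frame suffices to determine a section of the Atiyah algebroid. -/
lemma At.ext_of_mat (h2 : IsUnit (2 : R)) (hP : P.IsTorsor) {s t : At P U} (p : P.obj U)
    (h₁ : s.anchor = t.anchor) (h : s.mat (𝟙 U) p = t.mat (𝟙 U) p) : s = t := by
  refine At.ext' h₁ fun V f q g => ?_
  have h₁' : s.1.1 = t.1.1 := h₁
  obtain ⟨b, rfl⟩ := hP.transitive V (P.map f p) q
  have hm : s.mat f (P.map f p) = t.mat f (P.map f p) := by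
    have e1 := s.mat_map (𝟙 U) f p
    have e2 := t.mat_map (𝟙 U) f p
    rw [Category.comp_id] at e1 e2
    rw [e1, e2, h]
  rw [At.eq_gauge h2, At.eq_gauge h2, At.mat_act h2, At.mat_act h2, hm, h₁']

/-- A section of the Atiyah algebroid with given anchor and given trace free matrix in a given
frame. -/
lemma At.exists_of_mat (h2 : IsUnit (2 : R)) (hP : P.IsTorsor) (p : P.obj U) (ξ : T U)
    {M : Matrix (Fin 2) (Fin 2) U.A} (hM : M.trace = 0) :
    ∃ t : At P U, t.anchor = ξ ∧ t.mat (𝟙 U) p = M := by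
  choose b hb using fun (V : Chart C) (f : V ⟶ U) (q : P.obj V) =>
    hP.transitive V (P.map f p) q
  have hMV : ∀ (V : Chart C) (f : V ⟶ U), (M.map (res f)).trace = 0 := fun V f => by
    rw [Matrix.trace_fin_two] at hM ⊢
    rw [Matrix.map_apply, Matrix.map_apply, ← map_add, hM, map_zero]
  -- the choice of `b` does not matter
  have key : ∀ (V : Chart C) (f : V ⟶ U) (q : P.obj V) (b' : UT V.A) (g : GL (Fin 2) V.A),
      P.act (P.map f p) b' = q →
      gauge (ξ.1 V f) (M.map (res f)) ((b V f q).1 * g)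
        = gauge (ξ.1 V f) (M.map (res f)) (b'.1 * g) := by
    intro V f q b' g hb'
    obtain ⟨c, hc⟩ := hP.free V (P.map f p) (b V f q * b'⁻¹) (by
      rw [P.act_mul, hb, ← hb', ← P.act_mul, mul_inv_cancel]
      exact P.act_scalar _ 1 1 (by simp))
    have e : (b V f q).1 * g = (b V f q * b'⁻¹).1 * (b'.1 * g) := by
      change _ = ((b V f q).1 * (b'.1)⁻¹) * (b'.1 * g)
      group
    rw [e, ← gauge_mul (V.isUnit_two h2), gauge_scalar (V.isUnit_two h2) _ (hMV V f) hc]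
  refine ⟨⟨(ξ, fun V f q g => gauge (ξ.1 V f) (M.map (res f)) ((b V f q).1 * g)),
    ?_, ?_, ?_, ?_⟩, rfl, ?_⟩
  · intro V f q g
    exact trace_traceFree (V.isUnit_two h2) _
  · intro V W f h q g
    change gauge (ξ.1 W (h ≫ f)) (M.map (res (h ≫ f))) _ = Matrix.map (gauge _ _ _) (res h)
    rw [key W (h ≫ f) (P.map h q) (mapUT (res h) (b V f q)) _ (by
      rw [P.map_comp, ← P.act_map, hb]),
      gauge_map (res h) (V.isUnit_two h2) (ξ.1 V f) (ξ.1 W (h ≫ f)) (ξ.2 V W f h), map_mul]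
    rfl
  · intro V f q b' g
    change gauge _ _ _ = gauge _ _ _
    rw [key V f (P.act q b') (b V f q * b') g (by rw [P.act_mul, hb])]
    congr 1
    change (b V f q).1 * b'.1 * g = _
    rw [mul_assoc]
  · intro V f q g g'
    change ∃ c, gauge (ξ.1 V f) (M.map (res f)) ((b V f q).1 * (g * g')) = _
    rw [← mul_assoc, ← gauge_mul (V.isUnit_two h2)]
    exact exists_gauge_eq (ξ.1 V f) _ g'
  · change gauge (ξ.1 U (𝟙 U)) (M.map (res (𝟙 U))) ((b U (𝟙 U) p).1 * 1) = M
    have e : M.map (res (𝟙 U)) = M := by ext i j; simp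
    rw [key U (𝟙 U) p 1 1 (by
      rw [P.map_id]
      exact P.act_scalar _ 1 1 (by simp)), e, mul_one, OneMemClass.coe_one]
    exact gauge_one (U.isUnit_two h2) _ hM

/-- A section of the Atiyah algebroid comes from the `B`-torsor as soon as its matrix in one frame
is upper triangular. -/
lemma mem_atiyahB_of_mat (h2 : IsUnit (2 : R)) (hP : P.IsTorsor) {t : At P U} (p : P.obj U)
    (h : t.mat (𝟙 U) p 1 0 = 0) : t ∈ atiyahB P U := by
  intro V f q
  obtain ⟨β, v, rfl⟩ := hP.exists_utOf (P.map f p) q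
  have e1 := t.mat_map (𝟙 U) f p
  rw [Category.comp_id] at e1
  have htr := t.trace_mat (𝟙 U) p
  rw [Matrix.trace_fin_two] at htr
  have e2 : (t.mat (𝟙 U) p).map (res f) = !![res f (t.mat (𝟙 U) p 0 0), res f (t.mat (𝟙 U) p 0 1);
      0, - res f (t.mat (𝟙 U) p 0 0)] := by
    rw [← map_neg, neg_eq_of_add_eq_zero_right htr]
    ext i j
    fin_cases i <;> fin_cases j <;> simp [h]
  rw [At.mat_act h2, e1, e2, gauge_utOf (V.isUnit_two h2)]
  simp

end Atiyah

/-! ### Normal sections of an indigenous bundle -/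

section Normal

variable {R : Type u} [CommRing R] {S : EtaleGroupoid R} {C : RelCurve S} {U V : Chart C}
  {P : BPresheaf C}

lemma Connection.mat_restrict (N : Connection P) (f : V ⟶ U) (ξ : T U) (p : P.obj U) :
    (N.toFun V (resT f ξ)).mat (𝟙 V) (P.map f p)
      = ((N.toFun U ξ).mat (𝟙 U) p).map (res f) := by
  have := (N.toFun U ξ).mat_map (𝟙 U) f p
  rw [Category.comp_id] at this
  rw [N.natural, At.mat_resAt_id, this]

lemma Connection.mat_smul (N : Connection P) (a : U.A) (ξ : T U) (p : P.obj U) :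
    (N.toFun U (a • ξ)).mat (𝟙 U) p = a • (N.toFun U ξ).mat (𝟙 U) p := by
  rw [map_smul, At.mat_smul, res_id]

lemma Connection.mat_act (h2 : IsUnit (2 : R)) (N : Connection P) (ξ : T U) (p : P.obj U)
    (b : UT U.A) :
    (N.toFun U ξ).mat (𝟙 U) (P.act p b) = gauge ξ.toDer ((N.toFun U ξ).mat (𝟙 U) p) b.1 := by
  have h : (N.toFun U ξ).1.1 = ξ := N.split U ξ
  rw [At.mat_act h2, h]
  rfl

/-- A section `p` of the `B`-torsor is normal for the vector field `ξ` if the connection sends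
`ξ` to `ξ + (0 a; 1 0)` in the frame defined by `p`. -/
def IsNormal (N : Connection P) (ξ : T U) (p : P.obj U) : Prop :=
  ∃ a : U.A, (N.toFun U ξ).mat (𝟙 U) p = !![0, a; 1, 0]

lemma IsNormal.restrict {N : Connection P} {ξ : T U} {p : P.obj U} (h : IsNormal N ξ p)
    (f : V ⟶ U) : IsNormal N (resT f ξ) (P.map f p) := by
  obtain ⟨a, ha⟩ := h
  refine ⟨res f a, ?_⟩
  rw [N.mat_restrict, ha]
  ext i j
  fin_cases i <;> fin_cases j <;> simp

/-- A nontrivial upper triangular change of frame destroys the normal form. -/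
lemma IsNormal.unique (h2 : IsUnit (2 : R)) (hP : P.IsTorsor) {N : Connection P} {ξ : T U}
    {p q : P.obj U} (hp : IsNormal N ξ p) (hq : IsNormal N ξ q) : p = q := by
  obtain ⟨β, v, rfl⟩ := hP.exists_utOf p q
  obtain ⟨a, ha⟩ := hp
  obtain ⟨a', ha'⟩ := hq
  have e : (!![0, a; 1, 0] : Matrix (Fin 2) (Fin 2) U.A) = !![0, a; 1, -0] := by rw [neg_zero]
  rw [N.mat_act h2, ha, e, gauge_utOf (U.isUnit_two h2)] at ha'
  have h10 := congrFun (congrFun ha' 1) 0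
  have h00 := congrFun (congrFun ha' 0) 0
  have hv : v = 1 := by
    rw [← inv_eq_one, Units.ext_iff]
    simpa using h10
  subst hv
  have hβ : β = 0 := by simpa using h00
  subst hβ
  refine (P.act_scalar p _ 1 ?_).symm
  rw [utOf_val, one_smul]
  ext i j
  fin_cases i <;> fin_cases j <;> simp

/-- The Kodaira-Spencer map of an indigenous bundle is invertible, which allows one to normalize
the lower left entry of the matrix of the connection. -/
lemma IsIndigenous.isUnit_entry (h2 : IsUnit (2 : R)) {N : Connection P} (hN : IsIndigenous P N)
    {ξ : T U} {x : U.A} (h : IsDualTo ξ x) (p : P.obj U) :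
    IsUnit ((N.toFun U ξ).mat (𝟙 U) p 1 0) := by
  -- the section `(0 0; 1 0)` of the quotient is locally in the image of the Kodaira-Spencer map
  obtain ⟨t, ht, htm⟩ := At.exists_of_mat h2 hN.torsor p 0 (M := !![0, 0; 1, 0])
    (by simp [Matrix.trace_fin_two])
  obtain ⟨J, hJ, hs⟩ := hN.surjective U t
  refine hJ.isUnit fun V f hf => ?_
  obtain ⟨η, hη⟩ := hs V f hf
  have h1 := hη V (𝟙 V) (P.map f p)
  have e1 := t.mat_map (𝟙 U) f p
  rw [Category.comp_id] at e1
  rw [At.mat_sub, At.mat_resAt_id, e1, htm, (h.restrict f).eq_smul η, N.mat_smul,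
    N.mat_restrict] at h1
  have h3 : 1 - η.toDer (res f x) * res f ((N.toFun U ξ).mat (𝟙 U) p 1 0) = 0 := by
    simpa using h1
  exact IsUnit.of_mul_eq_one (η.toDer (res f x))
    (by rw [mul_comm]; exact (sub_eq_zero.mp h3).symm)

lemma IsIndigenous.exists_normal_of_section (h2 : IsUnit (2 : R)) {N : Connection P}
    (hN : IsIndigenous P N) {ξ : T U} {x : U.A} (h : IsDualTo ξ x) (p : P.obj U) :
    ∃ q : P.obj U, IsNormal N ξ q := by
  obtain ⟨v, hv⟩ := hN.isUnit_entry h2 h p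
  have htr := (N.toFun U ξ).trace_mat (𝟙 U) p
  rw [Matrix.trace_fin_two] at htr
  set M := (N.toFun U ξ).mat (𝟙 U) p with hM
  have eM : M = !![M 0 0, M 0 1; (v : U.A), -M 0 0] := by
    rw [neg_eq_of_add_eq_zero_right htr, hv]
    ext i j
    fin_cases i <;> fin_cases j <;> rfl
  have hvv : (v : U.A) * ↑v⁻¹ = 1 := v.mul_inv
  -- the lower left entry becomes `1` after scaling by `v`, then `β` kills the diagonal
  obtain ⟨β, hβ⟩ : ∃ β, β = M 0 0 - half U.A * (↑v⁻¹ * ξ.toDer v) := ⟨_, rfl⟩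
  refine ⟨P.act p (utOf β v), 2 * M 0 0 * β + M 0 1 * v - β ^ 2 * v * ↑v⁻¹ + ξ.toDer β
    - β * ↑v⁻¹ * ξ.toDer v, ?_⟩
  have h00 : M 0 0 - β * v * ↑v⁻¹ - half U.A * (↑v⁻¹ * ξ.toDer v) = 0 := by
    linear_combination -hβ - β * hvv
  rw [N.mat_act h2, ← hM, eM, gauge_utOf (U.isUnit_two h2)]
  ext i j
  fin_cases i <;> fin_cases j <;> simp [-Units.mul_inv_cancel_right, h00]

/-- Normal sections exist: they exist locally, and glue because they are unique. -/
lemma IsIndigenous.exists_normal (h2 : IsUnit (2 : R)) {N : Connection P}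
    (hN : IsIndigenous P N) {ξ : T U} {x : U.A} (h : IsDualTo ξ x) :
    ∃ p : P.obj U, IsNormal N ξ p := by
  let J : Sieve U := ⟨fun V _ => Nonempty (P.obj V), fun ⟨p⟩ g => ⟨P.map g p⟩⟩
  have hJ : IsCovering J := by
    obtain ⟨J', hJ', hne⟩ := hN.torsor.locally_nonempty U
    intro y
    obtain ⟨V, f, hf, hy⟩ := hJ' y
    exact ⟨V, f, hne V f hf, hy⟩
  have hex : ∀ (V : Chart C) (f : V ⟶ U), J f → ∃ q : P.obj V, IsNormal N (resT f ξ) q :=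
    fun V f ⟨p⟩ => hN.exists_normal_of_section h2 (h.restrict f) p
  let s : Presieve.FamilyOfElements P.functor J.arrows := fun V f hf => (hex V f hf).choose
  have hs : ∀ (V : Chart C) (f : V ⟶ U) (hf : J f), IsNormal N (resT f ξ) (s f hf) :=
    fun V f hf => (hex V f hf).choose_spec
  have hcomp : s.SieveCompatible := by
    intro V W f g hf
    refine IsNormal.unique h2 hN.torsor (hs W (g ≫ f) (J.downward_closed hf g)) ?_
    rw [resT_comp]
    exact (hs V f hf).restrict g
  obtain ⟨p, hp⟩ : ∃ p : P.obj U, ∀ (V : Chart C) (f : V ⟶ U) (hf : J f),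
      P.map f p = s f hf := by
    obtain ⟨p, hp, -⟩ := hN.torsor.sheaf U J hJ s
      ((Presieve.compatible_iff_sieveCompatible _).mpr hcomp)
    exact ⟨p, fun V f hf => hp f hf⟩
  have hm : ∀ (V : Chart C) (f : V ⟶ U), J f → ∃ a : V.A,
      ((N.toFun U ξ).mat (𝟙 U) p).map (res f) = !![0, a; 1, 0] := by
    intro V f hf
    rw [← N.mat_restrict, hp V f hf]
    exact hs V f hf
  refine ⟨p, (N.toFun U ξ).mat (𝟙 U) p 0 1, ?_⟩
  have h00 : (N.toFun U ξ).mat (𝟙 U) p 0 0 = 0 := hJ.ext fun V f hf => by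
    obtain ⟨a, ha⟩ := hm V f hf
    simpa using congrFun (congrFun ha 0) 0
  have h10 : (N.toFun U ξ).mat (𝟙 U) p 1 0 = 1 := hJ.ext fun V f hf => by
    obtain ⟨a, ha⟩ := hm V f hf
    simpa using congrFun (congrFun ha 1) 0
  have h11 : (N.toFun U ξ).mat (𝟙 U) p 1 1 = 0 := hJ.ext fun V f hf => by
    obtain ⟨a, ha⟩ := hm V f hf
    simpa using congrFun (congrFun ha 1) 1
  ext i j
  fin_cases i <;> fin_cases j
  · exact h00
  · rfl
  · exact h10
  · exact h11

/-- The change of frame from the section `(1, ½ ∂_x)` to `(1, ½ ∂_y)`, where `∂_y = u ∂_x`. -/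
def transition (ξ : T U) (u : U.Aˣ) : UT U.A := utOf (-(half U.A * ξ.toDer u)) u

/-- The coefficient of a connection in normal form with respect to the vector field `u ξ`, if `a`
is its coefficient with respect to `ξ`. For `ξ = ∂_x` and `u = ∂_y x` it is `u² a - ½ {x, y}`, where
`{x, y}` is the Schwarzian derivative, with all derivatives expressed in terms of `∂_x`. -/
def schwarz (ξ : T U) (u a : U.A) : U.A :=
  u ^ 2 * a + half U.A ^ 2 * ξ.toDer u ^ 2 - half U.A * (u * ξ.toDer (ξ.toDer u))

/-- Passing from `ξ` to `u ξ` preserves the normal form in the frame changed by `transition`. -/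
lemma At.mat_transition (h2 : IsUnit (2 : R)) {t : At P U} {ξ : T U} (ht : t.anchor = ξ)
    {p : P.obj U} {a : U.A} (h : t.mat (𝟙 U) p = !![0, a; 1, 0]) (u : U.Aˣ) :
    ((u : U.A) • t).mat (𝟙 U) (P.act p (transition ξ u)) = !![0, schwarz ξ u a; 1, 0] := by
  have e : (u : U.A) • (!![0, a; 1, 0] : Matrix (Fin 2) (Fin 2) U.A)
      = !![0, u * a; (u : U.A), -0] := by
    ext i j
    fin_cases i <;> fin_cases j <;> simp
  have h3 : half U.A * 2 = 1 := by rw [mul_comm]; exact two_mul_half (U.isUnit_two h2)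
  have hu : (u : U.A) * ↑u⁻¹ = 1 := u.mul_inv
  have hd : ((u : U.A) • t).1.1.1 U (𝟙 U) = (u : U.A) • ξ.toDer := by
    rw [← ht]
    rfl
  rw [At.mat_act h2, hd, At.mat_smul, res_id, h, e, transition, gauge_utOf (U.isUnit_two h2)]
  ext i j
  fin_cases i <;> fin_cases j <;>
    simp [Derivation.leibniz, der_half (U.isUnit_two h2), schwarz]
  · linear_combination (half U.A * ξ.toDer u ^ 2) * hu - (half U.A * ξ.toDer u ^ 2) * h3

lemma Connection.mat_transition (h2 : IsUnit (2 : R)) (N : Connection P) {ξ : T U} {p : P.obj U}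
    {a : U.A} (h : (N.toFun U ξ).mat (𝟙 U) p = !![0, a; 1, 0]) (u : U.Aˣ) :
    (N.toFun U ((u : U.A) • ξ)).mat (𝟙 U) (P.act p (transition ξ u))
      = !![0, schwarz ξ u a; 1, 0] := by
  rw [map_smul]
  exact At.mat_transition h2 (N.split U ξ) h u

/-- The frame `(1, ½ ∂_y)` of the canonical torsor in terms of `(1, ½ ∂_x)`. -/
lemma halfSection_transition (h2 : IsUnit (2 : R)) {ξ η : T U} {x y : U.A} (h : IsDualTo ξ x)
    (h' : IsDualTo η y) (u : U.Aˣ) (hu : (u : U.A) = η.toDer x) :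
    (canonicalTorsor C).act (halfSection h2 h) (transition ξ u) = halfSection h2 h' := by
  refine eq_halfSection h2 h' ?_
  have h3 := half_add_half (U.isUnit_two h2)
  rw [transition, canonicalTorsor_act_utOf]
  have e : fn (-(half U.A * ξ.toDer u)) + fn (-(half U.A * ξ.toDer u))
      = -(fn (ξ.toDer u) : DOp U) := by
    rw [← map_add, ← map_neg]
    congr 1
    linear_combination (-ξ.toDer u) * h3
  rw [add_add_add_comm, e, ← add_mul, halfSection_add, vec_mul_fn, hu, h.vec_eq η]
  abel

end Normal

/-! ### Isomorphism with the canonical torsor -/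

section Transport

variable {R : Type u} [CommRing R] {S : EtaleGroupoid R} {C : RelCurve S} {U V : Chart C}
  {P Q : BPresheaf C}

/-- Isomorphisms of presheaves with an action of `B`. -/
structure BPresheaf.Iso (P Q : BPresheaf C) where
  equiv : ∀ U : Chart C, P.obj U ≃ Q.obj U
  natural : ∀ {V U : Chart C} (f : V ⟶ U) (p : P.obj U),
    equiv V (P.map f p) = Q.map f (equiv U p)
  equivariant : ∀ {U : Chart C} (p : P.obj U) (b : UT U.A),
    equiv U (P.act p b) = Q.act (equiv U p) b

/-- The inverse isomorphism. -/
def BPresheaf.Iso.symm (φ : P.Iso Q) : Q.Iso P where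
  equiv U := (φ.equiv U).symm
  natural f p := by rw [Equiv.symm_apply_eq, φ.natural, Equiv.apply_symm_apply]
  equivariant p b := by rw [Equiv.symm_apply_eq, φ.equivariant, Equiv.apply_symm_apply]

/-- Transport of sections of the Atiyah algebroid. -/
def At.transport (φ : P.Iso Q) (t : At P U) : At Q U :=
  ⟨(t.1.1, fun V f q g => t.1.2 V f (φ.symm.equiv V q) g), by
    obtain ⟨h1, h2, h3, h4⟩ := t.2
    refine ⟨fun V f q g => h1 V f _ g, fun V W f h q g => ?_, fun V f q b g => ?_,
      fun V f q g g' => h4 V f _ g g'⟩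
    · change t.1.2 W (h ≫ f) (φ.symm.equiv W (Q.map h q)) _ = _
      rw [φ.symm.natural]
      exact h2 V W f h _ g
    · change t.1.2 V f (φ.symm.equiv V (Q.act q b)) g = _
      rw [φ.symm.equivariant]
      exact h3 V f _ b g⟩

/-- Transport of connections. -/
def Connection.transport (φ : P.Iso Q) (N : Connection P) : Connection Q where
  toFun U :=
    { toFun := fun ξ => (N.toFun U ξ).transport φ
      map_add' := fun ξ η => by rw [map_add]; rfl
      map_smul' := fun a ξ => by rw [map_smul]; rfl }
  split U ξ := N.split U ξ
  natural f ξ := by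
    change (N.toFun _ (resT f ξ)).transport φ = _
    rw [N.natural]
    rfl

lemma At.transport_mat (φ : P.Iso Q) (t : At P U) (f : V ⟶ U) (q : Q.obj V) :
    (t.transport φ).mat f q = t.mat f ((φ.equiv V).symm q) := rfl

lemma IsIndigenous.transport (φ : P.Iso Q) (hQ : Q.IsTorsor) {N : Connection P}
    (hN : IsIndigenous P N) : IsIndigenous Q (N.transport φ) where
  torsor := hQ
  injective U ξ h := hN.injective U ξ fun V f p => by
    have := h V f (φ.equiv V p)
    change ((N.toFun U ξ).transport φ).mat f (φ.equiv V p) 1 0 = 0 at this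
    rwa [At.transport_mat, Equiv.symm_apply_apply] at this
  surjective U t := by
    obtain ⟨J, hJ, h⟩ := hN.surjective U (t.transport φ.symm)
    refine ⟨J, hJ, fun V f hf => ?_⟩
    obtain ⟨ξ, hξ⟩ := h V f hf
    refine ⟨ξ, fun W g q => ?_⟩
    have := hξ W g ((φ.equiv W).symm q)
    rw [At.mat_sub, At.mat_resAt, At.transport_mat] at this
    rw [At.mat_sub, At.mat_resAt]
    change (t.mat (g ≫ f) q - ((N.toFun V ξ).transport φ).mat g q) 1 0 = 0
    rw [At.transport_mat]
    change (t.mat (g ≫ f) (φ.equiv W ((φ.equiv W).symm q)) - _) 1 0 = 0 at this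
    rwa [Equiv.apply_symm_apply] at this

lemma BPresheaf.act_one (p : P.obj U) : P.act p 1 = p := P.act_scalar p 1 1 (by simp)

/-- The stabilizers in a torsor are the scalars, which act trivially on every presheaf with an
action of `B`. -/
lemma BPresheaf.IsTorsor.act_eq_act (hP : P.IsTorsor) (p : P.obj U) (q : Q.obj U) {b b' : UT U.A}
    (h : P.act p b = P.act p b') : Q.act q b = Q.act q b' := by
  obtain ⟨c, hc⟩ := hP.free U p (b * b'⁻¹) (by
    rw [P.act_mul, h, ← P.act_mul, mul_inv_cancel, P.act_one])
  have := Q.act_scalar q _ c hc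
  rw [← inv_mul_cancel_right b b', Q.act_mul, this]

/-- The isomorphism of `B`-torsors that sends the normal sections of an indigenous bundle to the
frames `(1, ½ ∂_x)` of the canonical torsor. -/
lemma IsIndigenous.exists_iso (h2 : IsUnit (2 : R)) {N : Connection P} (hN : IsIndigenous P N) :
    ∃ φ : P.Iso (canonicalTorsor C), ∀ (U : Chart C) (x : U.A) (ξ : T U) (h : IsDualTo ξ x)
      (p : P.obj U), IsNormal N ξ p → φ.equiv U p = halfSection h2 h := by
  have hP := hN.torsor
  choose x ξ hξ using fun U : Chart C => U.exists_dual
  choose p hp using fun U : Chart C => hN.exists_normal h2 (hξ U)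
  choose b hb using fun (U : Chart C) (q : P.obj U) => hP.transitive U (p U) q
  obtain ⟨φ, hφ⟩ : ∃ φ : ∀ U : Chart C, P.obj U → (canonicalTorsor C).obj U,
      ∀ U q, φ U q = (canonicalTorsor C).act (halfSection h2 (hξ U)) (b U q) := ⟨_, fun _ _ => rfl⟩
  -- `φ` does not depend on the coordinate chosen: `p` and `halfSection` have the same transition
  -- matrices
  have key : ∀ (U : Chart C) (y : U.A) (η : T U) (h : IsDualTo η y) (q : P.obj U)
      (_ : IsNormal N η q) (c : UT U.A),
      φ U (P.act q c) = (canonicalTorsor C).act (halfSection h2 h) c := by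
    intro U y η h q hq c
    let u : U.Aˣ := ⟨η.toDer (x U), (ξ U).toDer y, (hξ U).isUnit h, by
      rw [mul_comm]; exact (hξ U).isUnit h⟩
    have e : η = (u : U.A) • ξ U := (hξ U).eq_smul η
    have hq' : q = P.act (p U) (transition (ξ U) u) := by
      obtain ⟨a, ha⟩ := hp U
      have h3 := N.mat_transition h2 ha u
      rw [← e] at h3
      exact IsNormal.unique h2 hP hq ⟨_, h3⟩
    rw [hφ, ← halfSection_transition h2 (hξ U) h u rfl, ← BPresheaf.act_mul]
    refine hP.act_eq_act (p U) _ ?_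
    rw [hb, P.act_mul, hq']
  have key' : ∀ (U : Chart C) (c : UT U.A), φ U (P.act (p U) c)
      = (canonicalTorsor C).act (halfSection h2 (hξ U)) c := fun U c =>
    key U _ _ (hξ U) _ (hp U) c
  have hbij : ∀ U, Function.Bijective (φ U) := by
    intro U
    constructor
    · intro q q' h
      rw [hφ, hφ] at h
      rw [← hb U q, ← hb U q']
      exact canonicalTorsor_isTorsor.act_eq_act _ _ h
    · intro w
      obtain ⟨c, hc⟩ := canonicalTorsor_isTorsor.transitive U (halfSection h2 (hξ U)) w
      exact ⟨P.act (p U) c, by rw [key', hc]⟩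
  refine ⟨⟨fun U => Equiv.ofBijective (φ U) (hbij U), fun {V U} f q => ?_, fun {U} q c => ?_⟩,
    fun U y η h q hq => ?_⟩
  · change φ V (P.map f q) = (canonicalTorsor C).map f (φ U q)
    obtain ⟨c, rfl⟩ := hP.transitive U (p U) q
    rw [P.act_map, key', BPresheaf.act_map, key V _ _ ((hξ U).restrict f) _ ((hp U).restrict f)]
    congr 1
    refine (eq_halfSection h2 ((hξ U).restrict f) ?_).symm
    change resD f _ + resD f _ = _
    rw [← map_add, halfSection_add, resD_vec]
  · change φ U (P.act q c) = (canonicalTorsor C).act (φ U q) c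
    obtain ⟨c', rfl⟩ := hP.transitive U (p U) q
    rw [← P.act_mul, key', key', BPresheaf.act_mul]
  · change φ U q = _
    have := key U y η h q hq 1
    rwa [P.act_one, BPresheaf.act_one] at this

/-- Every indigenous bundle is isomorphic to one of canonical type. -/
lemma IndigenousBundle.exists_isCanonical (h2 : IsUnit (2 : R)) (E : IndigenousBundle C) :
    ∃ N : Connection (canonicalTorsor C), IsCanonical N ∧
      ∃ hN : IsIndigenous (canonicalTorsor C) N,
        Nonempty (E.Iso ⟨canonicalTorsor C, N, hN⟩) := by
  obtain ⟨φ, hφ⟩ := E.indigenous.exists_iso h2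
  refine ⟨E.conn.transport φ, ?_, E.indigenous.transport φ canonicalTorsor_isTorsor,
    ⟨⟨φ.equiv, φ.natural, φ.equivariant, fun U ξ V f p g => ?_⟩⟩⟩
  · intro U x ξ w h hw
    obtain ⟨p, hp⟩ := E.indigenous.exists_normal h2 h
    have e : (φ.equiv U).symm w = p := by
      rw [Equiv.symm_apply_eq, hφ U x ξ h p hp]
      exact eq_halfSection h2 h hw
    change ∃ a, ((E.conn.toFun U ξ).transport φ).mat (𝟙 U) w = _
    rw [At.transport_mat, e]
    exact hp
  · change (E.conn.toFun U ξ).1.2 V f ((φ.equiv V).symm (φ.equiv V p)) g = _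
    rw [Equiv.symm_apply_apply]

/-- An isomorphism between indigenous bundles of canonical type fixes the frames `(1, ½ ∂_x)`,
these being the normal sections. -/
lemma IsCanonical.eq_of_iso (h2 : IsUnit (2 : R)) {N N' : Connection (canonicalTorsor C)}
    (hN : IsCanonical N) (hN' : IsCanonical N') {hi : IsIndigenous (canonicalTorsor C) N}
    {hi' : IsIndigenous (canonicalTorsor C) N'}
    (ψ : IndigenousBundle.Iso ⟨canonicalTorsor C, N, hi⟩ ⟨canonicalTorsor C, N', hi'⟩) :
    N = N' := by
  have key : ∀ (U : Chart C) (η : T U), N.toFun U η = N'.toFun U η := by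
    intro U η
    obtain ⟨x, ξ, h⟩ := U.exists_dual
    obtain ⟨w, hw⟩ : ∃ w, w = halfSection h2 h := ⟨_, rfl⟩
    have hww : w.1 + w.1 = vec ξ := by rw [hw]; exact halfSection_add h2 h
    have hmat : ∀ ζ : T U, (N'.toFun U ζ).mat (𝟙 U) (ψ.equiv U w)
        = (N.toFun U ζ).mat (𝟙 U) w := fun ζ => ψ.compatible U ζ U (𝟙 U) w 1
    have hfix : ψ.equiv U w = w := by
      refine IsNormal.unique h2 canonicalTorsor_isTorsor (N := N') (ξ := ξ) ?_
        (hN' U x ξ w h hww)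
      obtain ⟨a, ha⟩ := hN U x ξ w h hww
      exact ⟨a, (hmat ξ).trans ha⟩
    refine At.ext_of_mat h2 canonicalTorsor_isTorsor w ?_ ?_
    · rw [N.split, N'.split]
    · rw [← hmat η, hfix]
  have : N.toFun = N'.toFun := by
    funext U
    exact LinearMap.ext (key U)
  cases N
  cases N'
  congr

end Transport

/-! ### Projective structures and connections of canonical type -/

section Projective

variable {R : Type u} [CommRing R] {S : EtaleGroupoid R} {C : RelCurve S} {U V : Chart C}

/-- A family of functions indexed by the vector fields `∂_x` dual to coordinates is a
projective structure if it is compatible with restriction and transforms by a Schwarzian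
derivative under a change of coordinates.  (The values at other vector fields are junk.) -/
structure IsProj (a : ∀ U : Chart C, T U → U.A) : Prop where
  restrict : ∀ {V U : Chart C} (f : V ⟶ U) {x : U.A} {ξ : T U}, IsDualTo ξ x →
    a V (resT f ξ) = res f (a U ξ)
  change : ∀ {U : Chart C} {x y : U.A} {ξ η : T U}, IsDualTo ξ x → IsDualTo η y →
    a U η = schwarz ξ (η.toDer x) (a U ξ)

/-- The connection `N` is `∂_x + (0 a(∂_x); 1 0)` in the frame `(1, ½ ∂_x)`, for every
coordinate `x`. -/
def HasCoeff (h2 : IsUnit (2 : R)) (N : Connection (canonicalTorsor C))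
    (a : ∀ U : Chart C, T U → U.A) : Prop :=
  ∀ (U : Chart C) (x : U.A) (ξ : T U) (h : IsDualTo ξ x),
    (N.toFun U ξ).mat (𝟙 U) (halfSection h2 h) = !![0, a U ξ; 1, 0]

lemma map_halfSection (h2 : IsUnit (2 : R)) (f : V ⟶ U) {ξ : T U} {x : U.A} (h : IsDualTo ξ x) :
    (canonicalTorsor C).map f (halfSection h2 h) = halfSection h2 (h.restrict f) := by
  refine eq_halfSection h2 (h.restrict f) ?_
  change resD f _ + resD f _ = _
  rw [← map_add, halfSection_add, resD_vec]

/-- The unit by which two dual vector fields differ. -/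
def IsDualTo.unit {ξ η : T U} {x y : U.A} (h : IsDualTo ξ x) (h' : IsDualTo η y) : U.Aˣ :=
  ⟨η.toDer x, ξ.toDer y, h.isUnit h', by rw [mul_comm]; exact h.isUnit h'⟩

lemma IsDualTo.unit_smul {ξ η : T U} {x y : U.A} (h : IsDualTo ξ x) (h' : IsDualTo η y) :
    (h.unit h' : U.A) • ξ = η :=
  (h.eq_smul η).symm

lemma map_normal {A B : Type*} [CommRing A] [CommRing B] (φ : A →+* B) (a : A) :
    (!![0, a; 1, 0] : Matrix (Fin 2) (Fin 2) A).map φ = !![0, φ a; 1, 0] := by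
  ext i j
  fin_cases i <;> fin_cases j <;> simp

lemma HasCoeff.isProj {h2 : IsUnit (2 : R)} {N : Connection (canonicalTorsor C)}
    {a : ∀ U : Chart C, T U → U.A} (h : HasCoeff h2 N a) : IsProj a where
  restrict {V U} f x ξ hξ := by
    have h1 := h V _ _ (hξ.restrict f)
    rw [← map_halfSection h2 f hξ, N.mat_restrict, h U x ξ hξ, map_normal] at h1
    simpa using (congrFun (congrFun h1 0) 1).symm
  change {U x y ξ η} hξ hη := by
    have h1 := N.mat_transition h2 (h U x ξ hξ) (hξ.unit hη)
    rw [halfSection_transition h2 hξ hη _ rfl, hξ.unit_smul hη, h U y η hη] at h1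
    exact congrFun (congrFun h1 0) 1

lemma HasCoeff.isCanonical {h2 : IsUnit (2 : R)} {N : Connection (canonicalTorsor C)}
    {a : ∀ U : Chart C, T U → U.A} (h : HasCoeff h2 N a) : IsCanonical N := by
  intro U x ξ w hξ hw
  rw [eq_halfSection h2 hξ hw]
  exact ⟨_, h U x ξ hξ⟩

/-- The lower left entry `1` is the Kodaira-Spencer map, which sends `∂_x` to a generator. -/
lemma HasCoeff.isIndigenous {h2 : IsUnit (2 : R)} {N : Connection (canonicalTorsor C)}
    {a : ∀ U : Chart C, T U → U.A} (h : HasCoeff h2 N a) :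
    IsIndigenous (canonicalTorsor C) N where
  torsor := canonicalTorsor_isTorsor
  injective U η hη := by
    obtain ⟨x, ξ, hξ⟩ := U.exists_dual
    have h1 := hη U (𝟙 U) (halfSection h2 hξ)
    rw [hξ.eq_smul η, N.mat_smul, h U x ξ hξ] at h1
    have h3 : η.toDer x = 0 := by simpa using h1
    rw [hξ.eq_smul η, h3, zero_smul]
  surjective U t := by
    refine ⟨⊤, isCovering_top U, fun V f _ => ?_⟩
    obtain ⟨x, ξ, hξ⟩ := V.exists_dual
    refine ⟨(resAt f t).mat (𝟙 V) (halfSection h2 hξ) 1 0 • ξ,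
      mem_atiyahB_of_mat h2 canonicalTorsor_isTorsor (halfSection h2 hξ) ?_⟩
    rw [At.mat_sub, N.mat_smul, h V x ξ hξ]
    simp

lemma HasCoeff.unique {h2 : IsUnit (2 : R)} {N N' : Connection (canonicalTorsor C)}
    {a : ∀ U : Chart C, T U → U.A} (h : HasCoeff h2 N a) (h' : HasCoeff h2 N' a) : N = N' := by
  have key : ∀ (U : Chart C) (η : T U), N.toFun U η = N'.toFun U η := by
    intro U η
    obtain ⟨x, ξ, hξ⟩ := U.exists_dual
    refine At.ext_of_mat h2 canonicalTorsor_isTorsor (halfSection h2 hξ) ?_ ?_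
    · rw [N.split, N'.split]
    · rw [hξ.eq_smul η, N.mat_smul, N'.mat_smul, h U x ξ hξ, h' U x ξ hξ]
  have : N.toFun = N'.toFun := by
    funext U
    exact LinearMap.ext (key U)
  cases N
  cases N'
  congr

/-- The frame `(1, ½ ∂_x)`, and hence the coefficient, depends only on `∂_x`, not on `x`. -/
lemma IsCanonical.exists_hasCoeff (h2 : IsUnit (2 : R)) {N : Connection (canonicalTorsor C)}
    (hN : IsCanonical N) : ∃ a, HasCoeff h2 N a := by
  classical
  refine ⟨fun U ξ => if h : ∃ x, IsDualTo ξ x then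
    (N.toFun U ξ).mat (𝟙 U) (halfSection h2 h.choose_spec) 0 1 else 0, fun U x ξ hξ => ?_⟩
  have h : ∃ x, IsDualTo ξ x := ⟨x, hξ⟩
  have e : halfSection h2 hξ = halfSection h2 h.choose_spec :=
    eq_halfSection h2 _ (halfSection_add h2 hξ)
  obtain ⟨a, ha⟩ := hN U x ξ _ hξ (halfSection_add h2 hξ)
  beta_reduce
  rw [dif_pos h, ← e, ha]
  simp

/-- A projective structure defines a connection of canonical type. -/
lemma IsProj.exists_hasCoeff (h2 : IsUnit (2 : R)) {a : ∀ U : Chart C, T U → U.A}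
    (ha : IsProj a) : ∃ N, HasCoeff h2 N a := by
  choose x ξ hξ using fun U : Chart C => U.exists_dual
  -- `t U` is the image of `∂_x`, and the connection sends `η` to `(η x) t U`
  choose t ht htm using fun U : Chart C => At.exists_of_mat h2 canonicalTorsor_isTorsor
    (halfSection h2 (hξ U)) (ξ U) (M := !![0, a U (ξ U); 1, 0]) (by simp [Matrix.trace_fin_two])
  have key : ∀ (U : Chart C) (y : U.A) (η : T U) (h : IsDualTo η y),
      (η.toDer (x U) • t U).mat (𝟙 U) (halfSection h2 h) = !![0, a U η; 1, 0] := by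
    intro U y η h
    have h1 := At.mat_transition h2 (ht U) (htm U) ((hξ U).unit h)
    rwa [halfSection_transition h2 (hξ U) h _ rfl, IsDualTo.unit,
      ← ha.change (hξ U) h] at h1
  refine ⟨⟨fun U => ⟨⟨fun η => η.toDer (x U) • t U, fun η ζ => ?_⟩, fun c η => ?_⟩,
    fun U η => ?_, fun {V U} f η => ?_⟩, key⟩
  · rw [toDer_add, ← add_smul]
  · change (c • η).toDer (x U) • t U = c • η.toDer (x U) • t U
    rw [toDer_smul, smul_smul]
  · change η.toDer (x U) • (t U).anchor = η
    rw [ht, ← (hξ U).eq_smul η]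
  · change (resT f η).toDer (x V) • t V = res f (η.toDer (x U)) • resAt f (t U)
    have h1 : (resT f (ξ U)).toDer (x V) • t V = resAt f (t U) := by
      refine At.ext_of_mat h2 canonicalTorsor_isTorsor
        (halfSection h2 ((hξ U).restrict f)) ?_ ?_
      · change (resT f (ξ U)).toDer (x V) • (t V).anchor = resT f (t U).anchor
        rw [ht, ht, ← (hξ V).eq_smul]
      · rw [key V _ _ ((hξ U).restrict f), At.mat_resAt_id, ← map_halfSection h2 f (hξ U)]
        have e1 := (t U).mat_map (𝟙 U) f (halfSection h2 (hξ U))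
        rw [Category.comp_id] at e1
        rw [e1, htm, map_normal, ha.restrict f (hξ U)]
    rw [← h1, smul_smul]
    congr 1
    have h3 := congrArg (fun ζ => (resT f ζ).toDer (x V)) ((hξ U).eq_smul η)
    simpa [resT_smul] using h3

end Projective

/-! ### The bilinear form of a theta characteristic -/

section Theta

variable {R : Type u} [CommRing R] {S : EtaleGroupoid R} {C : RelCurve S} {U V : Chart C}
  (L : Theta C)

/-- The evaluation of differential forms at a vector field. -/
def T.ev (ξ : T U) : Om U →ₗ[U.A] U.A := ξ.toDer.liftKaehlerDifferential

@[simp] lemma T.ev_dd (ξ : T U) (a : U.A) : ξ.ev (dd a) = ξ.toDer a :=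
  Derivation.liftKaehlerDifferential_comp_D _ _

lemma T.ev_smul (a : U.A) (ξ : T U) (ω : Om U) : (a • ξ).ev ω = a * ξ.ev ω := by
  obtain ⟨x, _, h⟩ := U.exists_dual
  obtain ⟨b, rfl⟩ := h.1.exists_smul ω
  rw [map_smul, map_smul, T.ev_dd, T.ev_dd, toDer_smul]
  simp
  ring

lemma IsDualTo.eq_ev_smul {ξ : T U} {x : U.A} (h : IsDualTo ξ x) (ω : Om U) :
    ω = ξ.ev ω • dd x := by
  obtain ⟨b, rfl⟩ := h.1.exists_smul ω
  rw [map_smul, T.ev_dd, h.2, smul_eq_mul, mul_one]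

lemma T.ev_resOm (f : V ⟶ U) (ξ : T U) (ω : Om U) :
    (resT f ξ).ev (resOm f ω) = res f (ξ.ev ω) := by
  obtain ⟨x, _, h⟩ := U.exists_dual
  obtain ⟨b, rfl⟩ := h.1.exists_smul ω
  rw [resOm_smul, resOm_dd, map_smul, map_smul, T.ev_dd, T.ev_dd, toDer_resT]
  simp

/-- The symmetric bilinear form on a theta characteristic with values in `Ω ≅ O`, where `Ω` is
trivialized by the vector field `ξ`. -/
def Theta.form (ξ : T U) : L.obj U →ₗ[U.A] L.obj U →ₗ[U.A] U.A :=
  TensorProduct.curry (ξ.ev ∘ₗ (L.sq U).toLinearMap)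

lemma Theta.form_apply (ξ : T U) (l m : L.obj U) : L.form ξ l m = ξ.ev (L.sq U (l ⊗ₜ m)) := rfl

lemma Theta.form_comm (ξ : T U) (l m : L.obj U) : L.form ξ l m = L.form ξ m l := by
  rw [L.form_apply, L.form_apply, Module.Invertible.tmul_comm]

/-- The module `L` has rank one: two arguments of the form can be exchanged with a coefficient. -/
lemma Theta.form_smul_comm (ξ : T U) (l m n : L.obj U) :
    L.form ξ m n • l = L.form ξ l n • m := by
  have h : l ⊗ₜ[U.A] m = m ⊗ₜ l := Module.Invertible.tmul_comm
  exact congrArg (TensorProduct.lift (LinearMap.lsmul U.A (L.obj U) ∘ₗ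
    (L.form ξ).flip n).flip) h

lemma Theta.form_smul (a : U.A) (ξ : T U) (l m : L.obj U) :
    L.form (a • ξ) l m = a * L.form ξ l m := T.ev_smul _ _ _

lemma Theta.form_map (f : V ⟶ U) (ξ : T U) (l m : L.obj U) :
    L.form (resT f ξ) (L.map f l) (L.map f m) = res f (L.form ξ l m) := by
  rw [L.form_apply, L.sq_natural, T.ev_resOm]
  rfl

/-- The form of a theta characteristic is nondegenerate. -/
lemma Theta.exists_form_eq_one {ξ : T U} {x : U.A} (h : IsDualTo ξ x) :
    ∃ (n : ℕ) (l m : Fin n → L.obj U), ∑ i, L.form ξ (l i) (m i) = 1 := by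
  suffices hs : ∀ z : L.obj U ⊗[U.A] L.obj U, ∃ (n : ℕ) (l m : Fin n → L.obj U),
      ∑ i, L.form ξ (l i) (m i) = ξ.ev (L.sq U z) by
    obtain ⟨n, l, m, hlm⟩ := hs ((L.sq U).symm (dd x))
    refine ⟨n, l, m, ?_⟩
    rw [hlm, LinearEquiv.apply_symm_apply, T.ev_dd, h.2]
  intro z
  induction z using TensorProduct.induction_on with
  | zero => exact ⟨0, Fin.elim0, Fin.elim0, by simp⟩
  | tmul l m => exact ⟨1, fun _ => l, fun _ => m, by simp [L.form_apply]⟩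
  | add z z' hz hz' =>
    obtain ⟨n, l, m, h1⟩ := hz
    obtain ⟨n', l', m', h1'⟩ := hz'
    refine ⟨n + n', Fin.append l l', Fin.append m m', ?_⟩
    rw [Fin.sum_univ_add, map_add, map_add, ← h1, ← h1']
    simp

variable {L}

/-- The form identifies `L` with its dual. -/
lemma Theta.exists_dual_eq_form {ξ : T U} {x : U.A} (h : IsDualTo ξ x) (μ : L.Dual U) :
    ∃ n : L.obj U, μ = L.form ξ n := by
  obtain ⟨k, l, m, hlm⟩ := L.exists_form_eq_one h
  refine ⟨∑ i, μ (l i) • m i, LinearMap.ext fun l' => ?_⟩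
  calc μ l' = ∑ i, μ (L.form ξ (l i) (m i) • l') := by
        simp only [map_smul, smul_eq_mul, ← Finset.sum_mul, hlm, one_mul]
    _ = L.form ξ (∑ i, μ (l i) • m i) l' := by
        rw [map_sum, LinearMap.sum_apply]
        refine Finset.sum_congr rfl fun i _ => ?_
        rw [L.form_smul_comm, map_smul, map_smul, LinearMap.smul_apply, L.form_comm ξ (m i),
          smul_eq_mul, smul_eq_mul, mul_comm]

/-- Restriction of sections of the dual line bundle. -/
lemma Theta.exists_dual_restrict (f : V ⟶ U) (μ : L.Dual U) :
    ∃ ν : L.Dual V, ∀ l, ν (L.map f l) = res f (μ l) := by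
  obtain ⟨x, ξ, h⟩ := U.exists_dual
  obtain ⟨n, rfl⟩ := Theta.exists_dual_eq_form h μ
  exact ⟨L.form (resT f ξ) (L.map f n), fun l => L.form_map f ξ n l⟩

lemma Theta.dual_restrict_unique (f : V ⟶ U) {ν ν' : L.Dual V}
    (h : ∀ l, ν (L.map f l) = ν' (L.map f l)) : ν = ν' :=
  LinearMap.ext_on (L.cartesian f) (by rintro _ ⟨l, rfl⟩; exact h l)

section Sqrt

variable {ξ η : T U} {x y : U.A} {e e' : L.obj U}

lemma Theta.isSqrt_iff (h : IsDualTo ξ x) : L.IsSqrt e x ↔ L.form ξ e e = 1 := by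
  constructor
  · intro he
    rw [L.form_apply, he, T.ev_dd, h.2]
  · intro he
    rw [L.form_apply] at he
    rw [Theta.IsSqrt, h.eq_ev_smul (L.sq U (e ⊗ₜ e)), he, one_smul]

lemma Theta.IsSqrt.restrict (he : L.IsSqrt e x) (f : V ⟶ U) : L.IsSqrt (L.map f e) (res f x) := by
  rw [Theta.IsSqrt, L.sq_natural, he, resOm_dd]

lemma Theta.IsSqrt.eq_smul (he : L.IsSqrt e x) (h : IsDualTo ξ x) (l : L.obj U) :
    l = L.form ξ l e • e := by
  rw [← L.form_smul_comm, (Theta.isSqrt_iff h).mp he, one_smul]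

lemma Theta.IsSqrt.dual_eq (he : L.IsSqrt e x) (h : IsDualTo ξ x) (μ : L.Dual U) :
    μ = μ e • L.form ξ e := by
  refine LinearMap.ext fun l => ?_
  conv_lhs => rw [he.eq_smul h l]
  rw [map_smul, LinearMap.smul_apply, L.form_comm, smul_eq_mul, smul_eq_mul, mul_comm]

/-- The square root `ρ` of `∂_y x` relating square roots of `dx` and `dy`. -/
lemma Theta.IsSqrt.exists_sq (he : L.IsSqrt e x) (h : IsDualTo ξ x) (he' : L.IsSqrt e' y)
    (h' : IsDualTo η y) : ∃ ρ c : U.A, ρ * c = 1 ∧ ρ ^ 2 = η.toDer x ∧ e = ρ • e' ∧ e' = c • e := by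
  refine ⟨L.form η e e', L.form ξ e' e, ?_, ?_, he'.eq_smul h' e, he.eq_smul h e'⟩
  · have h1 := (Theta.isSqrt_iff h).mp he
    conv_lhs at h1 =>
      enter [1]
      rw [he'.eq_smul h' e]
    rw [map_smul, LinearMap.smul_apply] at h1
    simpa using h1
  · have h1 : L.form η e e = η.toDer x := by
      rw [L.form_apply, he, T.ev_dd]
    rw [← h1]
    conv_rhs =>
      rw [he'.eq_smul h' e]
    have h3 := (Theta.isSqrt_iff h').mp he'
    rw [map_smul, map_smul, LinearMap.smul_apply, h3]
    simp
    ring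

end Sqrt

end Theta

/-! ### Étale local square roots -/

section SquareRoots

/-- Where `2` and `v` are invertible, a square root of `v` exists étale locally. -/
lemma exists_etale_sqrt {A : Type u} [CommRing A] (h2 : IsUnit (2 : A)) (v : A)
    (p : PrimeSpectrum A) (hv : v ∉ p.asIdeal) :
    ∃ (B : Type u) (_ : CommRing B) (_ : Algebra A B) (_ : Algebra.Etale A B) (t : Bˣ)
      (q : PrimeSpectrum B), (t : B) ^ 2 = algebraMap A B v ∧
        PrimeSpectrum.comap (algebraMap A B) q = p := by
  let P : StandardEtalePair A :=
    { f := Polynomial.X ^ 2 - Polynomial.C v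
      monic_f := Polynomial.monic_X_pow_sub_C v two_ne_zero
      g := Polynomial.X
      cond := by
        refine ⟨Polynomial.C (half A), 0, 1, ?_⟩
        have h3 : Polynomial.C (half A) * (2 : Polynomial A) = 1 := by
          have h4 : half A * 2 = 1 := by rw [mul_comm]; exact two_mul_half h2
          rw [← Polynomial.C_ofNat, ← Polynomial.C_mul, h4, Polynomial.C_1]
        simp
        linear_combination Polynomial.X * h3 }
  have hX := P.hasMap_X
  have hf : P.X ^ 2 - algebraMap A P.Ring v = 0 := by
    have := hX.1
    simpa [P] using this
  have hg : IsUnit P.X := by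
    have := hX.2
    simpa [P] using this
  -- a point of the algebraic closure of the residue field of `p`
  let K := AlgebraicClosure p.asIdeal.ResidueField
  have hker : RingHom.ker (algebraMap A K) = p.asIdeal := by
    rw [IsScalarTower.algebraMap_eq A p.asIdeal.ResidueField K,
      RingHom.ker_comp_of_injective _ (algebraMap p.asIdeal.ResidueField K).injective,
      Ideal.ker_algebraMap_residueField]
  obtain ⟨z, hz⟩ := IsAlgClosed.exists_pow_nat_eq (algebraMap A K v) (n := 2) two_pos
  have hv0 : algebraMap A K v ≠ 0 := fun h => hv (by rw [← hker]; exact h)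
  have hz0 : z ≠ 0 := by
    rintro rfl
    exact hv0 (by rw [← hz]; simp)
  have hmap : P.HasMap z := ⟨by simp [P, hz], by
    change IsUnit (Polynomial.aeval z Polynomial.X)
    rw [Polynomial.aeval_X]
    exact isUnit_iff_ne_zero.mpr hz0⟩
  let φ := P.lift z hmap
  refine ⟨P.Ring, inferInstance, inferInstance, inferInstance, hg.unit,
    ⟨RingHom.ker φ, RingHom.ker_isPrime _⟩, sub_eq_zero.mp hf, ?_⟩
  ext a
  change φ (algebraMap A P.Ring a) = 0 ↔ a ∈ p.asIdeal
  rw [AlgHom.commutes]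
  exact iff_of_eq (congrArg (a ∈ ·) hker)

variable {R : Type u} [CommRing R] {S : EtaleGroupoid R} {C : RelCurve S} {U V : Chart C}
  (L : Theta C)

/-- The sieve of the étale neighbourhoods on which `dx` has a square root. -/
def sqrtSieve (x : U.A) : Sieve U where
  arrows V f := ∃ e : L.obj V, L.IsSqrt e (res f x)
  downward_closed := by
    rintro V W f ⟨e, he⟩ g
    exact ⟨L.map g e, he.restrict g⟩

/-- By polarization, a symmetric form that takes the value `1` takes invertible values on the
diagonal, locally. -/
lemma Theta.exists_form_notMem (h2 : IsUnit (2 : R)) {ξ : T U} {x : U.A} (h : IsDualTo ξ x)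
    (p : PrimeSpectrum U.A) : ∃ l : L.obj U, L.form ξ l l ∉ p.asIdeal := by
  by_contra! hp
  obtain ⟨n, l, m, hlm⟩ := L.exists_form_eq_one h
  have key : ∀ l m : L.obj U, L.form ξ l m ∈ p.asIdeal := by
    intro l m
    have e : 2 * L.form ξ l m = L.form ξ (l + m) (l + m) - L.form ξ l l - L.form ξ m m := by
      simp only [map_add, LinearMap.add_apply, L.form_comm ξ m l]
      ring
    have h3 : 2 * L.form ξ l m ∈ p.asIdeal := by
      rw [e]
      exact sub_mem (sub_mem (hp _) (hp _)) (hp _)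
    refine (p.isPrime.mem_or_mem h3).resolve_left fun h4 => ?_
    exact p.isPrime.ne_top (Ideal.eq_top_of_isUnit_mem _ h4 (U.isUnit_two h2))
  refine p.isPrime.ne_top ((Ideal.eq_top_iff_one _).mpr ?_)
  rw [← hlm]
  exact sum_mem fun i _ => key _ _

lemma isCovering_sqrtSieve (h2 : IsUnit (2 : R)) {ξ : T U} {x : U.A} (h : IsDualTo ξ x) :
    IsCovering (sqrtSieve L x) := by
  intro p
  obtain ⟨l, hl⟩ := L.exists_form_notMem h2 h p
  obtain ⟨B, _, _, _, t, q, ht, hq⟩ := exists_etale_sqrt (U.isUnit_two h2) _ p hl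
  have hφ : (CommRingCat.ofHom (algebraMap U.A B)).hom.Etale :=
    RingHom.etale_algebraMap.mpr inferInstance
  let f := U.ofEtaleHom (CommRingCat.ofHom (algebraMap U.A B)) hφ
  refine ⟨_, f, ?_, q, hq⟩
  let s : (U.ofEtale (CommRingCat.ofHom (algebraMap U.A B)) hφ).A := (↑t⁻¹ : B)
  refine ⟨s • L.map f l, ?_⟩
  rw [Theta.isSqrt_iff (h.restrict f), map_smul, map_smul, LinearMap.smul_apply, L.form_map]
  change (↑t⁻¹ : B) * (↑t⁻¹ * algebraMap U.A B (L.form ξ l l)) = 1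
  rw [← ht, pow_two, t.inv_mul_cancel_left, t.inv_mul]

end SquareRoots

/-! ### Contractions of operators and Sturm-Liouville operators -/

section Contraction

variable {R : Type u} [CommRing R] {S : EtaleGroupoid R} {C : RelCurve S} {U V : Chart C}
  {L : Theta C}

lemma fn_mul_fn_mul (a b : U.A) (P : DOp U) : fn a * (fn b * P) = fn (a * b) * P := by
  rw [map_mul, mul_assoc]

lemma Theta.contract_tmul (l : L.obj U) (ξ η : T U) (μ : L.Dual U) (ω ω' : Om U) (P : DOp U) :
    L.contract l ξ η ((μ ⊗ₜ (ω ⊗ₜ ω')) ⊗ₜ P) = fn (μ l * (ξ.ev ω * η.ev ω')) * P := rfl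

/-- Induction over pure tensors in `L^∨ ⊗ Ω^{⊗ 2} ⊗ D`. -/
lemma Theta.target_induction {p : L.Target U ⊗[U.A] DOp U → Prop}
    (z : L.Target U ⊗[U.A] DOp U) (h0 : p 0)
    (ht : ∀ (μ : L.Dual U) (ω ω' : Om U) (P : DOp U), p ((μ ⊗ₜ (ω ⊗ₜ ω')) ⊗ₜ P))
    (ha : ∀ y z, p y → p z → p (y + z)) : p z := by
  induction z using TensorProduct.induction_on with
  | zero => exact h0
  | add y z hy hz => exact ha y z hy hz
  | tmul t P =>
    induction t using TensorProduct.induction_on with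
    | zero => rw [TensorProduct.zero_tmul]; exact h0
    | add s t hs ht => rw [TensorProduct.add_tmul]; exact ha _ _ hs ht
    | tmul μ ω =>
      induction ω using TensorProduct.induction_on with
      | zero => rw [TensorProduct.tmul_zero, TensorProduct.zero_tmul]; exact h0
      | add s t hs ht => rw [TensorProduct.tmul_add, TensorProduct.add_tmul]; exact ha _ _ hs ht
      | tmul ω ω' => exact ht μ ω ω' P

/-- Contraction is linear for the right multiplication on operators. -/
lemma Theta.contract_lTensor (l : L.obj U) (ξ η : T U) (a : U.A) (z : L.Target U ⊗[U.A] DOp U) :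
    L.contract l ξ η (LinearMap.lTensor (L.Target U) (mulRightFn a) z)
      = L.contract l ξ η z * fn a := by
  induction z using Theta.target_induction with
  | h0 => simp
  | ht μ ω ω' P =>
    rw [LinearMap.lTensor_tmul, L.contract_tmul, L.contract_tmul, mul_assoc]
    rfl
  | ha y z hy hz => rw [map_add, map_add, hy, hz, map_add, add_mul]

lemma Theta.contract_smul (s : U.A) (l : L.obj U) (ξ η : T U) (z : L.Target U ⊗[U.A] DOp U) :
    L.contract (s • l) ξ η z = fn s * L.contract l ξ η z := by
  induction z using Theta.target_induction with
  | h0 => simp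
  | ht μ ω ω' P =>
    rw [L.contract_tmul, L.contract_tmul, fn_mul_fn_mul, map_smul, smul_eq_mul, mul_assoc]
  | ha y z hy hz => rw [map_add, map_add, hy, hz, mul_add]

lemma Theta.contract_smul_vec (s t : U.A) (l : L.obj U) (ξ η : T U)
    (z : L.Target U ⊗[U.A] DOp U) :
    L.contract l (s • ξ) (t • η) z = fn (s * t) * L.contract l ξ η z := by
  induction z using Theta.target_induction with
  | h0 => simp
  | ht μ ω ω' P =>
    rw [L.contract_tmul, L.contract_tmul, fn_mul_fn_mul, T.ev_smul, T.ev_smul]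
    congr 2
    ring
  | ha y z hy hz => rw [map_add, map_add, hy, hz, mul_add]

/-- An element of `L^∨ ⊗ Ω^{⊗ 2} ⊗ D` is determined by its contractions. -/
lemma Theta.eq_sum_contract {ξ : T U} {x : U.A} (h : IsDualTo ξ x) {n : ℕ}
    {l m : Fin n → L.obj U} (hlm : ∑ i, L.form ξ (l i) (m i) = 1)
    (z : L.Target U ⊗[U.A] DOp U) :
    z = ∑ i, (L.form ξ (m i) ⊗ₜ (dd x ⊗ₜ dd x)) ⊗ₜ[U.A] L.contract (l i) ξ ξ z := by
  induction z using Theta.target_induction with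
  | h0 => simp
  | ht μ ω ω' P =>
    have hμ : μ = ∑ i, μ (l i) • L.form ξ (m i) := by
      refine LinearMap.ext fun l' => ?_
      calc μ l' = ∑ i, μ (L.form ξ (l i) (m i) • l') := by
            simp only [map_smul, smul_eq_mul, ← Finset.sum_mul, hlm, one_mul]
        _ = _ := by
            rw [LinearMap.sum_apply]
            refine Finset.sum_congr rfl fun i _ => ?_
            rw [L.form_smul_comm, map_smul, LinearMap.smul_apply, L.form_comm ξ (m i),
              smul_eq_mul, smul_eq_mul, mul_comm]
    conv_lhs => rw [hμ, h.eq_ev_smul ω, h.eq_ev_smul ω']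
    rw [TensorProduct.sum_tmul, TensorProduct.sum_tmul]
    refine Finset.sum_congr rfl fun i _ => ?_
    rw [L.contract_tmul, ← smul_DOp]
    simp only [← TensorProduct.smul_tmul', TensorProduct.tmul_smul, smul_smul]
    congr 1
    ring
  | ha y z hy hz =>
    conv_lhs => rw [hy, hz]
    rw [← Finset.sum_add_distrib]
    refine Finset.sum_congr rfl fun i _ => ?_
    rw [map_add, TensorProduct.tmul_add]

/-- If `L` has the basis `e = (dx)^{1/2}`, the single contraction with `e` suffices. -/
lemma Theta.IsSqrt.eq_contract {ξ : T U} {x : U.A} {e : L.obj U} (he : L.IsSqrt e x)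
    (h : IsDualTo ξ x) {μ : L.Dual U} (hμ : μ e = 1) (z : L.Target U ⊗[U.A] DOp U) :
    z = (μ ⊗ₜ (dd x ⊗ₜ dd x)) ⊗ₜ[U.A] L.contract e ξ ξ z := by
  have h1 : ∑ _i : Fin 1, L.form ξ e e = 1 := by simpa using (Theta.isSqrt_iff h).mp he
  have h3 := Theta.eq_sum_contract h h1 z
  rw [he.dual_eq h μ, hμ, one_smul]
  simpa using h3

/-- The Sturm-Liouville operator `∂² - a`. -/
def sturm (ξ : T U) (a : U.A) : DOp U := vec ξ * vec ξ - fn a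

lemma sturm_injective {ξ : T U} {x : U.A} (h : IsDualTo ξ x) {a b : U.A}
    (hab : sturm ξ a = sturm ξ b) : a = b :=
  h.fn_injective (sub_right_injective hab)

lemma resD_sturm (f : V ⟶ U) (ξ : T U) (a : U.A) :
    resD f (sturm ξ a) = sturm (resT f ξ) (res f a) := by
  simp [sturm]

/-- The transformation of the operator `∂_x² - a`, acting on `(dx)^{-1/2}`, under a change of the
coordinate; `ρ` is a square root of `∂_y x`. -/
lemma sturm_change (h2 : IsUnit (2 : R)) (ξ : T U) (a ρ : U.A) :
    sturm (ρ ^ 2 • ξ) (schwarz ξ (ρ ^ 2) a) = fn (ρ ^ 3) * sturm ξ a * fn ρ := by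
  have h3 := two_mul_half (U.isUnit_two h2)
  have e : ξ.toDer (ρ ^ 2) = 2 * (ρ * ξ.toDer ρ) := by
    rw [pow_two, Derivation.leibniz, smul_eq_mul]
    ring
  have e' : ξ.toDer (ξ.toDer (ρ ^ 2))
      = 2 * (ξ.toDer ρ ^ 2 + ρ * ξ.toDer (ξ.toDer ρ)) := by
    rw [e, Derivation.leibniz, Derivation.leibniz, ← Nat.cast_two (R := U.A),
      Derivation.map_natCast]
    simp only [smul_eq_mul]
    ring
  have e3 : schwarz ξ (ρ ^ 2) a = ρ ^ 4 * a - ρ ^ 3 * ξ.toDer (ξ.toDer ρ) := by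
    rw [schwarz, e', e]
    linear_combination (ρ ^ 2 * ξ.toDer ρ ^ 2 * (2 * half U.A + 1)
      - ρ ^ 2 * (ξ.toDer ρ ^ 2 + ρ * ξ.toDer (ξ.toDer ρ))) * h3
  have e4 : vec ξ * vec ξ * (fn ρ : DOp U) = fn ρ * (vec ξ * vec ξ)
      + fn (2 * ξ.toDer ρ) * vec ξ + fn (ξ.toDer (ξ.toDer ρ)) := by
    rw [mul_assoc, vec_mul_fn, mul_add, ← mul_assoc, vec_mul_fn, vec_mul_fn, two_mul, map_add]
    simp only [add_mul, mul_assoc]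
    abel
  have e5 : (vec (ρ ^ 2 • ξ) : DOp U) * vec (ρ ^ 2 • ξ)
      = fn (ρ ^ 4) * (vec ξ * vec ξ) + fn (ρ ^ 2 * ξ.toDer (ρ ^ 2)) * vec ξ := by
    rw [← fn_mul_vec, mul_assoc, ← mul_assoc (vec ξ), vec_mul_fn, add_mul, mul_add, mul_assoc,
      fn_mul_fn_mul, fn_mul_fn_mul, ← pow_add]
  have e6 : ρ ^ 3 * ρ = ρ ^ 4 := by ring
  have e7 : ρ ^ 3 * (2 * ξ.toDer ρ) = ρ ^ 2 * (2 * (ρ * ξ.toDer ρ)) := by ring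
  have e8 : ρ ^ 3 * (a * ρ) = ρ ^ 4 * a := by ring
  rw [sturm, sturm, e5, e3, mul_assoc, sub_mul, e4, mul_sub, mul_add, mul_add, fn_mul_fn_mul,
    fn_mul_fn_mul, ← map_mul, ← map_mul, ← map_mul, e, e6, e7, e8, map_sub]
  abel

lemma sturm_mem_order (ξ : T U) (a : U.A) : sturm ξ a ∈ DOp.order U 2 := by
  refine sub_mem (Submodule.subset_span ⟨[ξ, ξ], le_rfl, by simp⟩) ?_
  exact fn_mem_order _ _

end Contraction

/-! ### The potential of an operator -/

section Potential

variable {R : Type u} [CommRing R] {S : EtaleGroupoid R} {C : RelCurve S} {U V : Chart C}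
  {L : Theta C}

/-- The operator `D` sends `(dx)^{-1/2}` to `(dx)^{-1/2} ⊗ dx² ⊗ (∂_x² - a(∂_x))`, for every
coordinate `x` such that `dx` has a square root. -/
def HasPotential (D : DiffOp L) (a : ∀ U : Chart C, T U → U.A) : Prop :=
  ∀ (U : Chart C) (x : U.A) (ξ : T U) (e : L.obj U) (μ : L.Dual U),
    IsDualTo ξ x → L.IsSqrt e x → μ e = 1 → L.contract e ξ ξ (D.toFun U μ) = sturm ξ (a U ξ)

lemma schwarz_one (ξ : T U) (a : U.A) : schwarz ξ 1 a = a := by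
  simp [schwarz]

lemma DiffOp.IsStar.exists_contract {D : DiffOp L} (hD : D.IsStar) {x : U.A} {ξ : T U}
    {e : L.obj U} {μ : L.Dual U} (h : IsDualTo ξ x) (he : L.IsSqrt e x) (hμ : μ e = 1) :
    ∃ a, L.contract e ξ ξ (D.toFun U μ) = sturm ξ a := by
  obtain ⟨ω, hω⟩ := hD U x ξ e μ h he hμ
  refine ⟨-L.pair e ξ ξ (μ ⊗ₜ ω), ?_⟩
  have h1 : L.contract e ξ ξ ((μ ⊗ₜ ω) ⊗ₜ 1) = fn (L.pair e ξ ξ (μ ⊗ₜ ω)) * 1 := rfl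
  rw [hω, map_add, L.contract_tmul, h1, hμ, T.ev_dd, h.2]
  simp [sturm]

/-- The Schwarzian transformation rule of the potential of an operator. -/
lemma DiffOp.contract_change (h2 : IsUnit (2 : R)) (D : DiffOp L) {x y a : U.A} {ξ η : T U}
    {e e' : L.obj U} {μ μ' : L.Dual U} (h : IsDualTo ξ x) (h' : IsDualTo η y)
    (he : L.IsSqrt e x) (he' : L.IsSqrt e' y) (hμ : μ e = 1) (hμ' : μ' e' = 1)
    (ha : L.contract e ξ ξ (D.toFun U μ) = sturm ξ a) :
    L.contract e' η η (D.toFun U μ') = sturm η (schwarz ξ (η.toDer x) a) := by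
  obtain ⟨ρ, c, hρc, hρ, hee', he'e⟩ := he.exists_sq h he' h'
  have e1 : μ' = ρ • μ := by
    rw [he.dual_eq h μ, he.dual_eq h μ', hμ, one_smul]
    congr 1
    rw [hee', map_smul, hμ', smul_eq_mul, mul_one]
  have e2 : η = ρ ^ 2 • ξ := by rw [hρ, ← h.eq_smul η]
  rw [e1, D.linear, L.contract_lTensor, he'e, L.contract_smul, ← hρ, e2, L.contract_smul_vec, ha,
    sturm_change h2, fn_mul_fn_mul]
  congr 3
  linear_combination ρ ^ 3 * hρc

lemma DiffOp.contract_restrict (D : DiffOp L) (f : V ⟶ U) {x : U.A} {ξ : T U}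
    {e : L.obj U} {μ : L.Dual U} {ν : L.Dual V} (h : IsDualTo ξ x) (he : L.IsSqrt e x)
    (hμ : μ e = 1) (hν : ν (L.map f e) = 1) :
    L.contract (L.map f e) (resT f ξ) (resT f ξ) (D.toFun V ν)
      = resD f (L.contract e ξ ξ (D.toFun U μ)) := by
  obtain ⟨ν', hν'⟩ := Theta.exists_dual_restrict f μ
  have e1 : ν = ν' := by
    rw [(he.restrict f).dual_eq (h.restrict f) ν, (he.restrict f).dual_eq (h.restrict f) ν', hν,
      hν', hμ, map_one]
  rw [e1]
  exact D.natural f μ ν' hν' e ξ ξ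

/-- The potential of an operator on a chart with coordinate `x` is glued from its values where `dx`
has a square root; it does not depend on the choice of the root. -/
lemma DiffOp.IsStar.exists_potential_chart (h2 : IsUnit (2 : R)) {D : DiffOp L} (hD : D.IsStar)
    {x : U.A} {ξ : T U} (h : IsDualTo ξ x) :
    ∃ a : U.A, ∀ (V : Chart C) (f : V ⟶ U) (e : L.obj V) (μ : L.Dual V),
      L.IsSqrt e (res f x) → μ e = 1 →
        L.contract e (resT f ξ) (resT f ξ) (D.toFun V μ) = sturm (resT f ξ) (res f a) := by
  choose e he using fun (V : Chart C) (f : V ⟶ U) (hf : sqrtSieve L x f) => hf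
  have hμ : ∀ V f hf, L.form (resT f ξ) (e V f hf) (e V f hf) = 1 := fun V f hf =>
    (Theta.isSqrt_iff (h.restrict f)).mp (he V f hf)
  choose α hα using fun V f hf => hD.exists_contract (h.restrict f) (he V f hf) (hμ V f hf)
  have key : ∀ (V : Chart C) (f : V ⟶ U) (hf : sqrtSieve L x f) (e' : L.obj V) (μ : L.Dual V),
      L.IsSqrt e' (res f x) → μ e' = 1 →
        L.contract e' (resT f ξ) (resT f ξ) (D.toFun V μ) = sturm (resT f ξ) (α V f hf) := by
    intro V f hf e' μ he' hμ'
    have h3 := D.contract_change h2 (h.restrict f) (h.restrict f) (he V f hf) he' (hμ V f hf) hμ'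
      (hα V f hf)
    rwa [(h.restrict f).2, schwarz_one] at h3
  obtain ⟨a, ha⟩ := (isCovering_sqrtSieve L h2 h).exists_glue α (by
    intro V W f g hf
    refine sturm_injective (h.restrict (g ≫ f)) ?_
    have hν : L.form (resT (g ≫ f) ξ) (L.map g (e V f hf)) (L.map g (e V f hf)) = 1 := by
      rw [resT_comp, L.form_map, hμ, map_one]
    rw [← key W (g ≫ f) _ (L.map g (e V f hf)) _ ((he V f hf).restrict g) hν, resT_comp,
      ← resD_sturm, ← hα V f hf]
    exact (D.contract_restrict g (h.restrict f) (he V f hf) (hμ V f hf) (by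
      rw [← resT_comp]; exact hν)).symm)
  refine ⟨a, fun V f e' μ he' hμ' => ?_⟩
  have hf : sqrtSieve L x f := ⟨e', he'⟩
  rw [ha V f hf]
  exact key V f hf e' μ he' hμ'

/-- An operator with principal symbol `1` and subprincipal symbol `0` defines a projective
structure. -/
lemma DiffOp.IsStar.exists_hasPotential (h2 : IsUnit (2 : R)) {D : DiffOp L} (hD : D.IsStar) :
    ∃ a, IsProj a ∧ HasPotential D a := by
  classical
  choose α hα using fun (U : Chart C) (ξ : T U) (h : ∃ x, IsDualTo ξ x) =>
    hD.exists_potential_chart h2 h.choose_spec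
  obtain ⟨a, ha'⟩ : ∃ a : ∀ U : Chart C, T U → U.A, ∀ U ξ (h : ∃ x, IsDualTo ξ x),
      a U ξ = α U ξ h :=
    ⟨fun U ξ => if h : ∃ x, IsDualTo ξ x then α U ξ h else 0, fun U ξ h => dif_pos h⟩
  have ha : ∀ (U : Chart C) (x : U.A) (ξ : T U), IsDualTo ξ x →
      ∀ (V : Chart C) (f : V ⟶ U) (e : L.obj V) (μ : L.Dual V), L.IsSqrt e (res f x) →
        μ e = 1 → L.contract e (resT f ξ) (resT f ξ) (D.toFun V μ)
          = sturm (resT f ξ) (res f (a U ξ)) := by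
    intro U x ξ h V f e μ he hμ
    have hx : ∃ x, IsDualTo ξ x := ⟨x, h⟩
    rw [ha' U ξ hx]
    refine hα U ξ hx V f e μ ?_ hμ
    -- the coordinate chosen for `ξ` may differ from `x`, but has the same differential
    have e1 : dd hx.choose = dd x := by
      rw [h.dd_eq hx.choose, hx.choose_spec.2, one_smul]
    rw [Theta.IsSqrt, he, ← resOm_dd, ← resOm_dd, e1]
  have hpot : HasPotential D a := by
    intro U x ξ e μ h he hμ
    have := ha U x ξ h U (𝟙 U) e μ he hμ
    rwa [resT_id, res_id] at this
  refine ⟨a, ⟨fun {V U} f x ξ h => ?_, fun {U x y ξ η} h h' => ?_⟩, hpot⟩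
  · refine (isCovering_sqrtSieve L h2 (h.restrict f)).ext fun W g ⟨e, he⟩ => ?_
    have hμ := (Theta.isSqrt_iff ((h.restrict f).restrict g)).mp he
    refine sturm_injective ((h.restrict f).restrict g) ?_
    rw [← ha V _ _ (h.restrict f) W g e _ he hμ]
    have h3 := ha U x ξ h W (g ≫ f) e _ he hμ
    rwa [resT_comp, res_comp] at h3
  · refine (isCovering_sqrtSieve L h2 h).ext fun V f ⟨e, he⟩ => ?_
    refine (isCovering_sqrtSieve L h2 (h'.restrict f)).ext fun W g ⟨e', he'⟩ => ?_
    have hr := (h.restrict f).restrict g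
    have hr' := (h'.restrict f).restrict g
    have hμ := (Theta.isSqrt_iff hr).mp (he.restrict g)
    have hμ' := (Theta.isSqrt_iff hr').mp he'
    have h3 := ha U x ξ h W (g ≫ f) _ _ (he.restrict g) hμ
    have h4 := ha U y η h' W (g ≫ f) _ _ he' hμ'
    rw [resT_comp, res_comp] at h3 h4
    have h5 := D.contract_change h2 hr hr' (he.restrict g) he' hμ hμ' h3
    refine sturm_injective hr' (h4.symm.trans (h5.trans ?_))
    congr 1
    simp only [schwarz, toDer_resT, map_sub, map_add, map_mul, map_pow,
      map_half _ (U.isUnit_two h2), map_half _ (V.isUnit_two h2)]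

lemma HasPotential.isStar {D : DiffOp L} {a : ∀ U : Chart C, T U → U.A} (hD : HasPotential D a) :
    D.IsStar := by
  intro U x ξ e μ h he hμ
  refine ⟨-a U ξ • (dd x ⊗ₜ dd x), ?_⟩
  have e1 : sturm ξ (a U ξ) = vec ξ * vec ξ + (-a U ξ) • (1 : DOp U) := by
    rw [sturm, smul_DOp, mul_one, map_neg, sub_eq_add_neg]
  rw [he.eq_contract h hμ (D.toFun U μ), hD U x ξ e μ h he hμ, e1, TensorProduct.tmul_add]
  congr 1
  rw [TensorProduct.tmul_smul, TensorProduct.tmul_smul, TensorProduct.smul_tmul']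

lemma DiffOp.contract_mem_order (D : DiffOp L) (μ : L.Dual U) (l : L.obj U) (ξ η : T U) :
    L.contract l ξ η (D.toFun U μ) ∈ DOp.order U 2 := by
  suffices hs : ∀ z, L.contract l ξ η (LinearMap.lTensor (L.Target U) (DOp.order U 2).subtype z)
      ∈ DOp.order U 2 by
    obtain ⟨z, hz⟩ := D.order_two U μ
    rw [← hz]
    exact hs z
  intro z
  induction z using TensorProduct.induction_on with
  | zero =>
    rw [map_zero, map_zero]
    exact zero_mem _
  | add y z hy hz =>
    rw [map_add, map_add]
    exact add_mem hy hz
  | tmul t P => exact Submodule.smul_mem _ _ P.2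

/-- An operator is determined by its potential. -/
lemma HasPotential.unique (h2 : IsUnit (2 : R)) {D D' : DiffOp L} {a : ∀ U : Chart C, T U → U.A}
    (hD : HasPotential D a) (hD' : HasPotential D' a) : D = D' := by
  refine DiffOp.ext (funext fun U => AddMonoidHom.ext fun μ => ?_)
  obtain ⟨x, ξ, h⟩ := U.exists_dual
  obtain ⟨n, l, m, hlm⟩ := L.exists_form_eq_one h
  rw [Theta.eq_sum_contract h hlm (D.toFun U μ), Theta.eq_sum_contract h hlm (D'.toFun U μ)]
  refine Finset.sum_congr rfl fun i _ => ?_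
  congr 1
  refine (isCovering_sqrtSieve L h2 h).ext_order_two (D.contract_mem_order _ _ _ _)
    (D'.contract_mem_order _ _ _ _) fun V f ⟨e, he⟩ => ?_
  obtain ⟨ν, hν⟩ := Theta.exists_dual_restrict f μ
  rw [← D.natural f μ ν hν, ← D'.natural f μ ν hν]
  congr 1
  have h1 : L.form (resT f ξ) e e = 1 := (Theta.isSqrt_iff (h.restrict f)).mp he
  rw [he.dual_eq (h.restrict f) ν, D.linear, D'.linear]
  congr 1
  rw [he.eq_contract (h.restrict f) h1 (D.toFun V _),
    he.eq_contract (h.restrict f) h1 (D'.toFun V _),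
    hD V _ _ e _ (h.restrict f) he h1, hD' V _ _ e _ (h.restrict f) he h1]

end Potential

/-! ### The operator of a projective structure -/

section Construction

variable {R : Type u} [CommRing R] {S : EtaleGroupoid R} {C : RelCurve S} {U V : Chart C}
  {L : Theta C}

/-- The value at `l` and `μ` of the operator with potential `a`, computed with a square root `e`
of `dx`: the operator sends `e^∨ s` to `e^∨ ⊗ dx² ⊗ (∂_x² - a) s`. -/
def Theta.sandwich (L : Theta C) (ξ : T U) (a : U.A) (e l : L.obj U) (μ : L.Dual U) : DOp U :=
  fn (L.form ξ l e) * sturm ξ a * fn (μ e)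

lemma Theta.sandwich_mem_order (ξ : T U) (a : U.A) (e l : L.obj U) (μ : L.Dual U) :
    L.sandwich ξ a e l μ ∈ DOp.order U 2 := by
  rw [Theta.sandwich]
  exact mul_fn_mem_order_two (fn_mul_mem_order _ (sturm_mem_order _ _)) _

/-- The factor `(∂_y x)²` accounts for the change of the generator `dx²` of `Ω^{⊗ 2}`. -/
lemma Theta.sandwich_change (h2 : IsUnit (2 : R)) {x y a : U.A} {ξ η : T U} {e e' : L.obj U}
    (h : IsDualTo ξ x) (h' : IsDualTo η y) (he : L.IsSqrt e x) (he' : L.IsSqrt e' y)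
    (l : L.obj U) (μ : L.Dual U) :
    L.sandwich η (schwarz ξ (η.toDer x) a) e' l μ
      = fn (η.toDer x ^ 2) * L.sandwich ξ a e l μ := by
  obtain ⟨ρ, c, hρc, hρ, -, he'e⟩ := he.exists_sq h he' h'
  have e2 : η = ρ ^ 2 • ξ := by rw [hρ, ← h.eq_smul η]
  rw [Theta.sandwich, Theta.sandwich, ← hρ, e2, sturm_change h2, L.form_smul, he'e, map_smul,
    map_smul, smul_eq_mul, smul_eq_mul]
  simp only [mul_assoc, fn_mul_fn_mul, ← map_mul]
  rw [← mul_assoc ρ c, hρc, one_mul]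
  congr 2
  linear_combination ρ ^ 4 * L.form ξ l e * hρc

lemma Theta.resD_sandwich (f : V ⟶ U) (ξ : T U) (a : U.A) (e l : L.obj U) {μ : L.Dual U}
    {ν : L.Dual V} (hν : ∀ l, ν (L.map f l) = res f (μ l)) :
    resD f (L.sandwich ξ a e l μ)
      = L.sandwich (resT f ξ) (res f a) (L.map f e) (L.map f l) ν := by
  rw [Theta.sandwich, map_mul, map_mul, resD_fn, resD_fn, resD_sturm, ← hν, ← L.form_map]
  rfl

/-- The value at `l` and `μ` of the operator with potential `a` exists globally on a chart, as
it does not depend on the choice of the square root. -/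
lemma Theta.exists_glue_sandwich (h2 : IsUnit (2 : R)) {x : U.A} {ξ : T U} (h : IsDualTo ξ x)
    (a : U.A) (l : L.obj U) (μ : L.Dual U) :
    ∃ F ∈ DOp.order U 2, ∀ (V : Chart C) (f : V ⟶ U) (e : L.obj V) (ν : L.Dual V),
      L.IsSqrt e (res f x) → (∀ l, ν (L.map f l) = res f (μ l)) →
        resD f F = L.sandwich (resT f ξ) (res f a) e (L.map f l) ν := by
  choose e he using fun (V : Chart C) (f : V ⟶ U) (hf : sqrtSieve L x f) => hf
  choose ν hν using fun (V : Chart C) (f : V ⟶ U) => Theta.exists_dual_restrict f μ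
  have key : ∀ (V : Chart C) (f : V ⟶ U) (hf : sqrtSieve L x f) (e' : L.obj V) (ν' : L.Dual V),
      L.IsSqrt e' (res f x) → (∀ l, ν' (L.map f l) = res f (μ l)) →
        L.sandwich (resT f ξ) (res f a) (e V f hf) (L.map f l) (ν V f)
          = L.sandwich (resT f ξ) (res f a) e' (L.map f l) ν' := by
    intro V f hf e' ν' he' hν'
    have e1 : ν' = ν V f := Theta.dual_restrict_unique f fun l => (hν' l).trans (hν V f l).symm
    have h3 := L.sandwich_change h2 (a := res f a) (h.restrict f) (h.restrict f) (he V f hf) he'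
      (L.map f l) (ν V f)
    rw [(h.restrict f).2, schwarz_one, one_pow, map_one, one_mul] at h3
    rw [e1, h3]
  obtain ⟨F, hF, hF'⟩ := (isCovering_sqrtSieve L h2 h).exists_glue_order_two
    (fun V f hf => L.sandwich (resT f ξ) (res f a) (e V f hf) (L.map f l) (ν V f))
    (fun V f hf => L.sandwich_mem_order _ _ _ _ _) (by
      intro V W f g hf
      have hν' : ∀ l, ν W (g ≫ f) (L.map g l) = res g (ν V f l) := by
        obtain ⟨ν', hν'⟩ := Theta.exists_dual_restrict g (ν V f)
        have e1 : ν W (g ≫ f) = ν' := Theta.dual_restrict_unique (g ≫ f) fun l => by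
          rw [hν, L.map_comp, hν', hν, res_comp]
        rw [e1]
        exact hν'
      rw [L.resD_sandwich g _ _ _ _ hν', ← resT_comp, ← L.map_comp, ← res_comp]
      exact (key W (g ≫ f) _ _ _ ((he V f hf).restrict g) (hν W (g ≫ f))).symm)
  refine ⟨F, hF, fun V f e' ν' he' hν' => ?_⟩
  have hf : sqrtSieve L x f := ⟨e', he'⟩
  rw [hF' V f hf]
  exact key V f hf e' ν' he' hν'

/-- The transformation rule of the glued operators under a change of coordinates. -/
lemma IsProj.exists_sandwich (h2 : IsUnit (2 : R)) (L : Theta C) {a : ∀ U : Chart C, T U → U.A}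
    (ha : IsProj a) {x : U.A} {ξ : T U} (h : IsDualTo ξ x) (l : L.obj U) (μ : L.Dual U) :
    ∃ F ∈ DOp.order U 2, ∀ (V : Chart C) (f : V ⟶ U) (y : V.A) (η : T V) (e : L.obj V)
      (ν : L.Dual V), IsDualTo η y → L.IsSqrt e y → (∀ l, ν (L.map f l) = res f (μ l)) →
        resD f F = fn ((resT f ξ).toDer y ^ 2) * L.sandwich η (a V η) e (L.map f l) ν := by
  obtain ⟨F, hF, hF'⟩ := Theta.exists_glue_sandwich h2 h (a U ξ) l μ
  refine ⟨F, hF, fun V f y η e ν hη he hν => ?_⟩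
  refine (isCovering_sqrtSieve L h2 (h.restrict f)).ext_order_two (resD_mem_order f hF)
    (fn_mul_mem_order _ (L.sandwich_mem_order _ _ _ _ _)) fun W g ⟨e', he'⟩ => ?_
  obtain ⟨ν', hν'⟩ := Theta.exists_dual_restrict g ν
  have hx := (h.restrict f).restrict g
  have h3 := hF' W (g ≫ f) e' ν' he' fun l => by rw [L.map_comp, hν', hν, res_comp]
  rw [resD_comp, resT_comp, res_comp, L.map_comp, ← ha.restrict f h,
    ← ha.restrict g (h.restrict f), ha.change (hη.restrict g) hx,
    L.sandwich_change h2 (hη.restrict g) hx (he.restrict g) he', ha.restrict g hη,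
    ← L.resD_sandwich g _ _ _ _ hν', toDer_resT, ← map_pow] at h3
  rw [h3, map_mul, resD_fn]

/-- Every projective structure is the potential of an operator. -/
lemma IsProj.exists_hasPotential (h2 : IsUnit (2 : R)) (L : Theta C)
    {a : ∀ U : Chart C, T U → U.A} (ha : IsProj a) : ∃ D : DiffOp L, HasPotential D a := by
  choose x ξ h using fun U : Chart C => U.exists_dual
  choose n l m hlm using fun U : Chart C => L.exists_form_eq_one (h U)
  choose F hF2 hF using fun (U : Chart C) => ha.exists_sandwich h2 L (h U)
  -- operators of order at most two are compared where `dx` has a square root; this shows that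
  -- `F U l μ` is linear in `μ` and in `l`, and `G` below is the operator with contractions `F`
  have hext : ∀ (U : Chart C) (P Q : DOp U), P ∈ DOp.order U 2 → Q ∈ DOp.order U 2 →
      (∀ (V : Chart C) (f : V ⟶ U) (e : L.obj V), L.IsSqrt e (res f (x U)) →
        resD f P = resD f Q) → P = Q := fun U P Q hP hQ hPQ =>
    (isCovering_sqrtSieve L h2 (h U)).ext_order_two hP hQ fun V f ⟨e, he⟩ => hPQ V f e he
  have hF' : ∀ (U : Chart C) (k : L.obj U) (μ : L.Dual U) (V : Chart C) (f : V ⟶ U) (e : L.obj V)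
      (ν : L.Dual V), L.IsSqrt e (res f (x U)) → (∀ l, ν (L.map f l) = res f (μ l)) →
        resD f (F U k μ)
          = L.sandwich (resT f (ξ U)) (a V (resT f (ξ U))) e (L.map f k) ν := by
    intro U k μ V f e ν he hν
    rw [hF U k μ V f _ _ e ν ((h U).restrict f) he hν, ((h U).restrict f).2]
    simp
  have hadd : ∀ (U : Chart C) (k : L.obj U) (μ μ' : L.Dual U),
      F U k (μ + μ') = F U k μ + F U k μ' := by
    intro U k μ μ'
    refine hext U _ _ (hF2 _ _ _) (add_mem (hF2 _ _ _) (hF2 _ _ _)) fun V f e he => ?_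
    obtain ⟨ν, hν⟩ := Theta.exists_dual_restrict f μ
    obtain ⟨ν', hν'⟩ := Theta.exists_dual_restrict f μ'
    rw [map_add, hF' U k μ V f e ν he hν, hF' U k μ' V f e ν' he hν',
      hF' U k (μ + μ') V f e (ν + ν') he fun l => by simp [hν, hν'],
      Theta.sandwich, Theta.sandwich, Theta.sandwich, LinearMap.add_apply, map_add, mul_add]
  have hmul : ∀ (U : Chart C) (k : L.obj U) (c : U.A) (μ : L.Dual U),
      F U k (c • μ) = F U k μ * fn c := by
    intro U k c μ
    refine hext U _ _ (hF2 _ _ _) (mul_fn_mem_order_two (hF2 _ _ _) _) fun V f e he => ?_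
    obtain ⟨ν, hν⟩ := Theta.exists_dual_restrict f μ
    rw [map_mul, resD_fn, hF' U k μ V f e ν he hν,
      hF' U k (c • μ) V f e (res f c • ν) he fun l => by simp [hν],
      Theta.sandwich, Theta.sandwich, LinearMap.smul_apply, smul_eq_mul, mul_comm (res f c),
      map_mul, mul_assoc, mul_assoc, mul_assoc]
  have hsum : ∀ (U : Chart C) (k : L.obj U) (μ : L.Dual U),
      ∑ i, fn (L.form (ξ U) (m U i) k) * F U (l U i) μ = F U k μ := by
    intro U k μ
    refine hext U _ _ (sum_mem fun i _ => fn_mul_mem_order _ (hF2 _ _ _)) (hF2 _ _ _)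
      fun V f e he => ?_
    obtain ⟨ν, hν⟩ := Theta.exists_dual_restrict f μ
    have hk : k = ∑ i, L.form (ξ U) (m U i) k • l U i := by
      conv_lhs => rw [← one_smul U.A k, ← hlm U, Finset.sum_smul]
      refine Finset.sum_congr rfl fun i _ => ?_
      rw [← L.form_smul_comm, L.form_comm]
    rw [map_sum, hF' U k μ V f e ν he hν]
    conv_rhs => rw [hk, map_sum, Theta.sandwich, map_sum, LinearMap.sum_apply, map_sum,
      Finset.sum_mul, Finset.sum_mul]
    refine Finset.sum_congr rfl fun i _ => ?_
    rw [map_mul, resD_fn, hF' U (l U i) μ V f e ν he hν, Theta.sandwich, LinearMap.map_smulₛₗ,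
      map_smul, LinearMap.smul_apply, smul_eq_mul, map_mul]
    simp only [mul_assoc]
  obtain ⟨G, hG⟩ : ∃ G : ∀ U : Chart C, L.Dual U →+ L.Target U ⊗[U.A] DOp U, ∀ U μ,
      G U μ = ∑ i, (L.form (ξ U) (m U i) ⊗ₜ (dd (x U) ⊗ₜ dd (x U))) ⊗ₜ[U.A] F U (l U i) μ :=
    ⟨fun U =>
      { toFun := fun μ => ∑ i, (L.form (ξ U) (m U i) ⊗ₜ (dd (x U) ⊗ₜ dd (x U)))
          ⊗ₜ[U.A] F U (l U i) μ
        map_zero' := Finset.sum_eq_zero fun i _ => by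
          have h0 := hadd U (l U i) 0 0
          rw [add_zero, left_eq_add] at h0
          rw [h0, TensorProduct.tmul_zero]
        map_add' := fun μ μ' => by
          rw [← Finset.sum_add_distrib]
          exact Finset.sum_congr rfl fun i _ => by rw [hadd, TensorProduct.tmul_add] },
      fun _ _ => rfl⟩
  have hcon : ∀ (U : Chart C) (k : L.obj U) (ζ θ : T U) (μ : L.Dual U),
      L.contract k ζ θ (G U μ) = fn (ζ.toDer (x U) * θ.toDer (x U)) * F U k μ := by
    intro U k ζ θ μ
    rw [hG, map_sum, ← hsum U k μ, Finset.mul_sum]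
    refine Finset.sum_congr rfl fun i _ => ?_
    rw [L.contract_tmul, fn_mul_fn_mul, T.ev_dd, T.ev_dd]
    congr 2
    ring
  refine ⟨⟨G, fun U μ => ?_, fun U c μ => ?_, fun {V U} f μ ν hν k ζ θ => ?_⟩,
    fun U y η e μ hη he hμ => ?_⟩
  · rw [hG]
    exact sum_mem fun i _ => LinearMap.mem_range.mpr
      ⟨_ ⊗ₜ (⟨_, hF2 U (l U i) μ⟩ : DOp.order U 2), rfl⟩
  · rw [hG, hG, map_sum]
    refine Finset.sum_congr rfl fun i _ => ?_
    rw [hmul]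
    rfl
  · rw [hcon, hcon, map_mul (resD f), resD_fn]
    have h3 : ∀ ζ : T U, (resT f ζ).toDer (x V)
        = res f (ζ.toDer (x U)) * (resT f (ξ U)).toDer (x V) := fun ζ => by
      have h4 := congrArg (fun ζ => (resT f ζ).toDer (x V)) ((h U).eq_smul ζ)
      simpa [resT_smul] using h4
    have h5 : resD f (F U k μ)
        = fn ((resT f (ξ U)).toDer (x V) ^ 2) * F V (L.map f k) ν := by
      refine hext V _ _ (resD_mem_order f (hF2 _ _ _)) (fn_mul_mem_order _ (hF2 _ _ _))
        fun W g e he => ?_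
      obtain ⟨ν', hν'⟩ := Theta.exists_dual_restrict g ν
      rw [map_mul, resD_fn, hF' V (L.map f k) ν W g e ν' he hν', ← resD_comp,
        hF U k μ W (g ≫ f) _ _ e ν' ((h V).restrict g) he fun l => by
          rw [L.map_comp, hν', hν, res_comp],
        resT_comp, toDer_resT, ← map_pow (res g), L.map_comp]
    rw [h5, fn_mul_fn_mul, h3 ζ, h3 θ, map_mul (res f)]
    congr 2
    ring
  · have h3 := hF U e μ U (𝟙 U) y η e μ hη he fun l => by rw [L.map_id, res_id]
    change L.contract e η η (G U μ) = _
    rw [resD_id, resT_id, L.map_id, Theta.sandwich, (Theta.isSqrt_iff hη).mp he, hμ, map_one,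
      one_mul, mul_one] at h3
    rw [hcon, h3, fn_mul_fn_mul]
    have h4 := (h U).isUnit hη
    have h5 : η.toDer (x U) * η.toDer (x U) * (ξ U).toDer y ^ 2 = 1 := by
      linear_combination (η.toDer (x U) * (ξ U).toDer y + 1) * h4
    rw [h5, map_one, one_mul]

end Construction

/-! ### The connection associated with an operator -/

section Associated

variable {R : Type u} [CommRing R] {S : EtaleGroupoid R} {C : RelCurve S} {U V : Chart C}
  {L : Theta C}

lemma Theta.evalDL_tmul (μ : L.Dual U) (P : DOp U) (l : L.obj U) :
    (L.evalDL μ (P.toR ⊗ₜ l)).toD = P * fn (μ l) := rfl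

lemma Theta.evalDL_smul (μ : L.Dual U) (P : DOp U) (z : L.DL U) :
    (L.evalDL μ (P • z)).toD = P * (L.evalDL μ z).toD := by
  induction z using TensorProduct.induction_on with
  | zero =>
    rw [smul_zero, map_zero]
    exact (mul_zero P).symm
  | tmul Q l => exact mul_assoc P Q.toD (fn (μ l))
  | add y z hy hz =>
    rw [smul_add, map_add, map_add]
    exact (congrArg₂ (· + ·) hy hz).trans (mul_add P _ _).symm

/-- The operator `∂_x² - a` applied to `(dx)^{1/2}` vanishes in the quotient of `D ⊗ L`. -/
lemma HasPotential.sturm_tmul_mem {D : DiffOp L} {a : ∀ U : Chart C, T U → U.A}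
    (hD : HasPotential D a) {x : U.A} {ξ : T U} {e : L.obj U} (h : IsDualTo ξ x)
    (he : L.IsSqrt e x) : (sturm ξ (a U ξ)).toR ⊗ₜ e ∈ D.submodule U := by
  refine Submodule.subset_span ⟨e, ξ, ξ, fun μ => ?_⟩
  have h1 := (Theta.isSqrt_iff h).mp he
  rw [L.evalDL_tmul]
  conv_rhs => rw [he.dual_eq h μ, D.linear, L.contract_lTensor, hD U x ξ e _ h he h1]

/-- The coordinates of an element of the quotient of `D ⊗ L` in the frame
`((dx)^{1/2}, ∂_x ⊗ (dx)^{1/2})`, together with the action of `∂_x` on this frame. The functional is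
`P ⊗ (dx)^{1/2} ↦ P (1, 0)`, where `D` acts on `O²` by the connection with matrix `(0 a; 1 0)`. -/
lemma HasPotential.exists_functional {D : DiffOp L} {a : ∀ U : Chart C, T U → U.A}
    (hD : HasPotential D a) {x : U.A} {ξ : T U} {e : L.obj U} (h : IsDualTo ξ x)
    (he : L.IsSqrt e x) :
    ∃ Ψ : L.DL U →+ U.A × U.A, (∀ z ∈ D.submodule U, Ψ z = 0) ∧
      (∀ b c : U.A, Ψ (fn b • L.frame e ξ 0 + fn c • L.frame e ξ 1) = (b, c)) ∧
      Ψ (vec ξ • L.frame e ξ 0) = (0, 1) ∧ Ψ (vec ξ • L.frame e ξ 1) = (a U ξ, 0) := by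
  have h1 := (Theta.isSqrt_iff h).mp he
  -- the connection with matrix `(0 a; 1 0)` on `O²`
  let δ : U.A × U.A →+ U.A × U.A :=
    { toFun := fun p => (ξ.toDer p.1 + a U ξ * p.2, p.1 + ξ.toDer p.2)
      map_zero' := by simp
      map_add' := fun p q => by
        ext <;> simp <;> ring }
  obtain ⟨φ, hφ, hφ'⟩ := h.exists_action δ (fun b p => by
    ext <;> simp [δ, Derivation.leibniz] <;> ring)
  -- `(1, 0)` is killed by `∂_x² - a`
  have hst : φ (sturm ξ (a U ξ)) (1, 0) = 0 := by
    rw [sturm, map_sub, map_mul, endSub_apply, endMul_apply, hφ', hφ', hφ]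
    simp [δ]
  let Ψ : L.DL U →+ U.A × U.A :=
    { toFun := fun z => φ (L.evalDL (L.form ξ e) z).toD (1, 0)
      map_zero' := by
        rw [map_zero]
        change φ 0 (1, 0) = 0
        rw [map_zero]
        rfl
      map_add' := fun y z => by
        rw [map_add]
        exact congrArg (fun F : AddMonoid.End (U.A × U.A) => F (1, 0))
          (map_add φ (L.evalDL (L.form ξ e) y).toD (L.evalDL (L.form ξ e) z).toD) }
  have hΨ : ∀ (P : DOp U) (z : L.DL U), Ψ (P • z) = φ P (Ψ z) := fun P z => by
    change φ (L.evalDL (L.form ξ e) (P • z)).toD (1, 0) = _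
    rw [L.evalDL_smul, map_mul]
    rfl
  have h0 : Ψ (L.frame e ξ 0) = (1, 0) := by
    change φ (1 * fn (L.form ξ e e)) (1, 0) = _
    rw [h1, map_one, one_mul, map_one]
    rfl
  have h3 : Ψ (L.frame e ξ 1) = (0, 1) := by
    change φ (vec ξ * fn (L.form ξ e e)) (1, 0) = _
    rw [h1, map_one, mul_one, hφ']
    simp [δ]
  refine ⟨Ψ, fun z hz => ?_, fun b c => ?_, ?_, ?_⟩
  · refine Submodule.span_induction ?_ (map_zero Ψ) ?_ ?_ hz
    · rintro y ⟨l, ζ, θ, hy⟩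
      change φ (L.evalDL (L.form ξ e) y).toD (1, 0) = 0
      rw [hy, he.eq_smul h l, h.eq_smul ζ, h.eq_smul θ, L.contract_smul, L.contract_smul_vec,
        hD U x ξ e _ h he h1, map_mul, map_mul, endMul_apply, endMul_apply, hst, map_zero,
        map_zero]
    · intro y z _ _ hy hz
      rw [map_add, hy, hz, add_zero]
    · intro P z _ hz
      rw [hΨ, hz, map_zero]
  · rw [map_add, hΨ, hΨ, h0, h3, hφ, hφ]
    simp
  · rw [hΨ, h0, hφ']
    simp [δ]
  · rw [hΨ, h3, hφ']
    simp [δ]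

/-- The connection of canonical type with coefficient `a` is the one associated with the
operator with potential `a`. -/
lemma HasPotential.isAssociated {D : DiffOp L} {a : ∀ U : Chart C, T U → U.A}
    (h2 : IsUnit (2 : R)) (hD : HasPotential D a) {N : Connection (canonicalTorsor C)}
    (hN : HasCoeff h2 N a) : D.IsAssociated N := by
  intro U x ξ e w h he hw η
  refine ⟨η.toDer x • !![0, a U ξ; 1, 0], 0, fun j => ?_, ?_⟩
  · have hf0 : vec ξ • L.frame e ξ 0 = L.frame e ξ 1 := by
      change (vec ξ * 1).toR ⊗ₜ e = (vec ξ).toR ⊗ₜ e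
      rw [mul_one]
    have hf1 : vec ξ • L.frame e ξ 1 - fn (a U ξ) • L.frame e ξ 0
        = (sturm ξ (a U ξ)).toR ⊗ₜ e := by
      change (vec ξ * vec ξ).toR ⊗ₜ e - (fn (a U ξ) * 1).toR ⊗ₜ e = _
      rw [mul_one, ← TensorProduct.sub_tmul]
      rfl
    rw [h.vec_eq η, Fin.sum_univ_two]
    fin_cases j
    · have e0 : (fn (η.toDer x) * vec ξ) • L.frame e ξ 0
          - (fn (η.toDer x * 0) • L.frame e ξ 0 + fn (η.toDer x * 1) • L.frame e ξ 1) = 0 := by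
        rw [mul_smul, hf0]
        simp
      exact e0 ▸ zero_mem _
    · have e1 : (fn (η.toDer x) * vec ξ) • L.frame e ξ 1
          - (fn (η.toDer x * a U ξ) • L.frame e ξ 0 + fn (η.toDer x * 0) • L.frame e ξ 1)
          = fn (η.toDer x) • (sturm ξ (a U ξ)).toR ⊗ₜ e := by
        rw [← hf1, mul_smul, smul_sub, map_mul, mul_smul]
        simp
      exact e1 ▸ Submodule.smul_mem _ _ (hD.sturm_tmul_mem h he)
  · rw [eq_halfSection h2 h hw, zero_smul, add_zero]
    conv_lhs => rw [h.eq_smul η, N.mat_smul, hN U x ξ h]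

/-- The matrix of an associated connection is determined: its entries are recovered by applying
the functional on the quotient of `D ⊗ L`, and the scalar ambiguity vanishes because the trace does. -/
lemma HasPotential.hasCoeff {D : DiffOp L} {a : ∀ U : Chart C, T U → U.A}
    (h2 : IsUnit (2 : R)) (ha : IsProj a) (hD : HasPotential D a)
    {N : Connection (canonicalTorsor C)} (hN : D.IsAssociated N) : HasCoeff h2 N a := by
  -- charts with a square root of `dx`
  have key : ∀ (U : Chart C) (x : U.A) (ξ : T U) (e : L.obj U) (h : IsDualTo ξ x),
      L.IsSqrt e x → (N.toFun U ξ).mat (𝟙 U) (halfSection h2 h) = !![0, a U ξ; 1, 0] := by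
    intro U x ξ e h he
    obtain ⟨M, c, hM, hMN⟩ := hN U x ξ e _ h he (halfSection_add h2 h) ξ
    obtain ⟨Ψ, hΨ, hb, h0, h1⟩ := hD.exists_functional h he
    have e0 := hΨ _ (hM 0)
    have e1 := hΨ _ (hM 1)
    rw [Fin.sum_univ_two, map_sub, hb, h0, sub_eq_zero] at e0
    rw [Fin.sum_univ_two, map_sub, hb, h1, sub_eq_zero] at e1
    rw [Prod.ext_iff] at e0 e1
    have eM : M = !![0, a U ξ; 1, 0] := by
      ext i j
      fin_cases i <;> fin_cases j
      · exact e0.1.symm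
      · exact e1.1.symm
      · exact e0.2.symm
      · exact e1.2.symm
    have htr := (N.toFun U ξ).trace_mat (𝟙 U) (halfSection h2 h)
    rw [hMN, eM, Matrix.trace_fin_two] at htr
    have hc : c = 0 := by
      refine (U.isUnit_two h2).mul_left_cancel ?_
      simp at htr
      linear_combination htr
    rw [hMN, eM, hc, zero_smul, add_zero]
  intro U x ξ h
  have hm : ∀ (V : Chart C) (f : V ⟶ U), sqrtSieve L x f →
      ((N.toFun U ξ).mat (𝟙 U) (halfSection h2 h)).map (res f) = !![0, res f (a U ξ); 1, 0] := by
    intro V f ⟨e, he⟩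
    rw [← N.mat_restrict, map_halfSection h2 f h, key V _ _ e (h.restrict f) he, ha.restrict f h]
  have hJ := isCovering_sqrtSieve L h2 h
  ext i j
  refine hJ.ext fun V f hf => ?_
  have h3 := congrFun (congrFun (hm V f hf) i) j
  rw [Matrix.map_apply] at h3
  rw [h3, ← map_normal, Matrix.map_apply]

end Associated

end IndigenousBundles

end

open IndigenousBundles in
theorem mainTheorem4 {R : Type u} [CommRing R] (h2 : IsUnit (2 : R))
    (S : EtaleGroupoid R) (C : RelCurve S) :
    (∀ L : Theta C,
      ∃ (Φ : {D : DiffOp L // D.IsStar} → Connection (canonicalTorsor C))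
        (hΦ : ∀ D, IsIndigenous (canonicalTorsor C) (Φ D)),
        (∀ D N, D.1.IsAssociated N ↔ N = Φ D) ∧
        (∀ D, IsCanonical (Φ D)) ∧
        Function.Bijective (fun D => (⟦⟨canonicalTorsor C, Φ D, hΦ D⟩⟧ :
          Quotient (indigenousSetoid C)))) ∧
    (∀ E : IndigenousBundle C,
      ∃! N : Connection (canonicalTorsor C), IsCanonical N ∧
        ∃ hN : IsIndigenous (canonicalTorsor C) N,
          Nonempty (E.Iso ⟨canonicalTorsor C, N, hN⟩)) := by
  refine ⟨fun L => ?_, fun E => ?_⟩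
  · choose a ha hDa using fun D : {D : DiffOp L // D.IsStar} => D.2.exists_hasPotential h2
    choose Φ hΦ using fun D => (ha D).exists_hasCoeff h2
    refine ⟨Φ, fun D => (hΦ D).isIndigenous, fun D N => ⟨fun h => ?_, fun h => ?_⟩,
      fun D => (hΦ D).isCanonical, fun D D' h => ?_, fun q => ?_⟩
    · exact ((hDa D).hasCoeff h2 (ha D) h).unique (hΦ D)
    · rw [h]
      exact (hDa D).isAssociated h2 (hΦ D)
    · have e : Φ D = Φ D' := (Quotient.exact h).elim fun ψ =>
        (hΦ D).isCanonical.eq_of_iso h2 (hΦ D').isCanonical ψ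
      -- the coefficients of `Φ D` are determined at the vector fields dual to coordinates
      have e' : HasPotential D'.1 (a D) := fun U x ξ l μ h hl hμ => by
        have h3 := hΦ D U x ξ h
        rw [e, hΦ D' U x ξ h] at h3
        have h4 : a D' U ξ = a D U ξ := congrFun (congrFun h3 0) 1
        rw [← h4]
        exact hDa D' U x ξ l μ h hl hμ
      exact Subtype.ext ((hDa D).unique h2 e')
    · induction q using Quotient.inductionOn with
      | h E =>
        obtain ⟨N, hN, hi, φ⟩ := E.exists_isCanonical h2
        obtain ⟨b, hb⟩ := hN.exists_hasCoeff h2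
        obtain ⟨D, hD⟩ := hb.isProj.exists_hasPotential h2 L
        let D' : {D : DiffOp L // D.IsStar} := ⟨D, hD.isStar⟩
        refine ⟨D', Quotient.sound ?_⟩
        have e : N = Φ D' :=
          ((hDa D').hasCoeff h2 (ha D') (hD.isAssociated h2 hb)).unique (hΦ D')
        subst e
        exact (indigenousSetoid C).iseqv.symm φ
  · obtain ⟨N, hN, hi, e⟩ := E.exists_isCanonical h2
    refine ⟨N, ⟨hN, hi, e⟩, fun N' ⟨hN', hi', e'⟩ => ?_⟩
    have h : Nonempty (IndigenousBundle.Iso ⟨canonicalTorsor C, N', hi'⟩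
        ⟨canonicalTorsor C, N, hi⟩) :=
      (indigenousSetoid C).iseqv.trans ((indigenousSetoid C).iseqv.symm e') e
    exact h.elim fun ψ => hN'.eq_of_iso h2 hN ψ
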